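/- Let $\omega=e^{2\pi i/3}$, $\tau=e^{-\pi i/3}$, $\Lambda=\mathbb Z\oplus\omega\mathbb Z$, $z_S=i/\sqrt3$ and $2D_{\bar z}=\frac1i(\partial_{x_1}+i\partial_{x_2})$ for $z=x_1+ix_2$. Let $V:\mathbb C\to\mathbb C$ be real analytic with $$V(z)=V(-z),\quad V(z+\gamma)=V(z)\ (\gamma\in\Lambda),\quad V(\omega z)=\omega^2V(z),\quad \overline{V(\bar z)}=V(z).$$ For $\alpha,k\in\mathbb C$ put $$P(\alpha,k)=(2D_{\bar z}+k)^2-\alpha^2V,\qquad D_S(\alpha)=\begin{pmatrix}2D_{\bar z}&\alpha V\\ \alpha&2D_{\bar z}\end{pmatrix},\qquad H(\alpha,k)=\begin{pmatrix}0&D_S(\alpha)+k\\(D_S(\alpha)+k)^*&0\end{pmatrix},$$ acting on $H^2(\mathbb C/\Lambda)$, $H^1(\mathbb C/\Lambda;\mathbb C^2)$ and $H^1(\mathbb C/\Lambda;\mathbb C^4)$ respectively, and let $\mathcal A$ be the set of (magic) $\alpha$ such that $\ker P(\alpha,k)\ne\{0\}$ for every $k\in\mathbb C$. Let $L^2_\ell(\mathbb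 C/\Lambda;\mathbb C)=\{u\in L^2:u(\tau z)=\tau^\ell u(z)\}$ and $L^2_\ell(\mathbb C/\Lambda;\mathbb C^2)=\{(u_1,u_2)\in L^2:\bar\tau u_1(\tau z)=\tau^\ell u_1(z),\ u_2(\tau z)=\tau^\ell u_2(z)\}$. A protected state at $\alpha$ is (the smooth representative of) a nonzero $u\in\ker P(\alpha,0)\cap L^2_0(\mathbb C/\Lambda;\mathbb C)$; for $\alpha\neq0$ put $\mathbf u=(\alpha^{-1}2D_{\bar z}u,\,-u)^t$. We say that $\alpha\in\mathcal A$ has multiplicity $2$ if $\dim\ker H(\alpha,k)=4$ for all $k\in\mathbb C$. **Proposition.** Let $\alpha\in\mathcal A$. Then protected states at $\alpha$ exist, and for every protected state $u$ at $\alpha$: 1. $\alpha$ has multiplicity $2$ if and only if the zeros of $\mathbf u$ are exactly the stacking points $\pm z_S$ (modulo $\Lambda$), each of multiplicity one (that is, $\mathbf u=0$ and $\partial_z\mathbf u\ne0$ there). 2. If $\dim\ker H(\alpha,0)\le4$, then $\alpha$ has multiplicity $2$ if and only if $\mathbf u(z_S)=\mathbf u(-z_S)=0$. 3. If $\alpha$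 has multiplicity $2$, then $\ker D_S(\alpha)=\mathbb C\mathbf u\oplus\mathbb C\mathbf v$ with $\mathbf u\in L^2_0(\mathbb C/\Lambda;\mathbb C^2)$ and some nonzero $\mathbf v\in L^2_2(\mathbb C/\Lambda;\mathbb C^2)$. -/

import Mathlib

open MeasureTheory
open scoped ComplexConjugate

noncomputable section

namespace ScalarModel

/-- `ω = e^{2πi/3}`. -/
def ω : ℂ := Complex.exp (2 * Real.pi * Complex.I / 3)

/-- `τ = e^{-πi/3}`. -/
def τ : ℂ := Complex.exp (-(Real.pi * Complex.I / 3))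

/-- The stacking point `z_S = i/√3`, which satisfies `ω z_S ≡ z_S` modulo the lattice. -/
def zS : ℂ := Complex.I / (Real.sqrt 3 : ℝ)

/-- The lattice `Λ = ℤ ⊕ ωℤ`. -/
def lattice : AddSubgroup ℂ where
  carrier := {z | ∃ m n : ℤ, z = m + n * ω}
  zero_mem' := ⟨0, 0, by simp⟩
  add_mem' := by
    rintro _ _ ⟨m, n, rfl⟩ ⟨m', n', rfl⟩
    exact ⟨m + m', n + n', by push_cast; ring⟩
  neg_mem' := by
    rintro _ ⟨m, n, rfl⟩
    exact ⟨-m, -n, by push_cast; ring⟩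

/-- The half-open fundamental parallelogram of `Λ`. -/
def cell : Set ℂ :=
  {z | ∃ s ∈ Set.Ico (0 : ℝ) 1, ∃ t ∈ Set.Ico (0 : ℝ) 1, z = s + t * ω}

/-- Real analytic potentials with
`V(z) = V(-z)`, `V(z + γ) = V(z)`, `V(ωz) = ω² V(z)`, `conj (V (conj z)) = V(z)`. -/
structure Potential where
  toFun : ℂ → ℂ
  analytic : AnalyticOnNhd ℝ toFun Set.univ
  even : ∀ z, toFun z = toFun (-z)
  periodic : ∀ γ ∈ lattice, ∀ z, toFun (z + γ) = toFun z
  rot : ∀ z, toFun (ω * z) = ω ^ 2 * toFun z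
  conj_symm : ∀ z, conj (toFun (conj z)) = toFun z

instance : CoeFun Potential (fun _ => ℂ → ℂ) := ⟨Potential.toFun⟩

/-! ### Differential operators on smooth functions, `z = x₁ + i x₂` -/

/-- `∂_{x₁}`. -/
def dx1 (φ : ℂ → ℂ) (z : ℂ) : ℂ := fderiv ℝ φ z 1

/-- `∂_{x₂}`. -/
def dx2 (φ : ℂ → ℂ) (z : ℂ) : ℂ := fderiv ℝ φ z Complex.I

/-- `2 D_{z̄} = (1/i)(∂_{x₁} + i ∂_{x₂})`. -/
def twoDzbar (φ : ℂ → ℂ) (z : ℂ) : ℂ := (1 / Complex.I) * (dx1 φ z + Complex.I * dx2 φ z)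

/-- `2 D_z = (1/i)(∂_{x₁} - i ∂_{x₂})`, the formal adjoint of `2 D_{z̄}`. -/
def twoDz (φ : ℂ → ℂ) (z : ℂ) : ℂ := (1 / Complex.I) * (dx1 φ z - Complex.I * dx2 φ z)

/-- `∂_z = (1/2)(∂_{x₁} - i ∂_{x₂})`. -/
def dz (φ : ℂ → ℂ) (z : ℂ) : ℂ := (1 / 2) * (dx1 φ z - Complex.I * dx2 φ z)

/-- Test functions on `ℂ/Λ`: smooth `Λ`-periodic functions. -/
def IsTest (φ : ℂ → ℂ) : Prop :=
  ContDiff ℝ (⊤ : ℕ∞) φ ∧ ∀ γ ∈ lattice, ∀ z, φ (z + γ) = φ z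

/-- `(D + k) f = g` on `ℂ/Λ` in the weak sense, where `D` is one of `∂_{x₁}`, `∂_{x₂}`, `2D_{z̄}`,
`2D_z` (so that `-D` is the transpose of `D`). -/
def WeakEq (D : (ℂ → ℂ) → ℂ → ℂ) (k : ℂ) (f g : ℂ → ℂ) : Prop :=
  ∀ φ, IsTest φ → ∫ z in cell, f z * (k * φ z - D φ z) = ∫ z in cell, g z * φ z

/-! ### Facts needed for the kernels below to be subspaces -/

theorem exists_bound_cell {ψ : ℂ → ℂ} (hψ : Continuous ψ) : ∃ C, ∀ z ∈ cell, ‖ψ z‖ ≤ C := by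
  have hK : IsCompact
      ((fun p : ℝ × ℝ => (p.1 : ℂ) + p.2 * ω) '' (Set.Icc 0 1 ×ˢ Set.Icc 0 1)) :=
    (isCompact_Icc.prod isCompact_Icc).image (by fun_prop)
  obtain ⟨C, hC⟩ := hK.exists_bound_of_continuousOn hψ.continuousOn
  refine ⟨C, fun z hz => hC z ?_⟩
  obtain ⟨s, hs, t, ht, rfl⟩ := hz
  exact ⟨(s, t), ⟨Set.Ico_subset_Icc_self hs, Set.Ico_subset_Icc_self ht⟩, rfl⟩

theorem measurableSet_cell : MeasurableSet cell := by
  have him : ω.im ≠ 0 := by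
    have h : (2 * Real.pi * Complex.I / 3 : ℂ) = ((2 * Real.pi / 3 : ℝ) : ℂ) * Complex.I := by
      push_cast; ring
    rw [ω, h, Complex.exp_ofReal_mul_I_im]
    apply ne_of_gt
    apply Real.sin_pos_of_pos_of_lt_pi <;> linarith [Real.pi_pos]
  have h : cell = {z | z.re - z.im / ω.im * ω.re ∈ Set.Ico (0 : ℝ) 1} ∩
      {z | z.im / ω.im ∈ Set.Ico (0 : ℝ) 1} := by
    ext z
    constructor
    · rintro ⟨s, hs, t, ht, rfl⟩
      simpa [him] using And.intro hs ht
    · rintro ⟨hs, ht⟩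
      refine ⟨_, hs, _, ht, ?_⟩
      apply Complex.ext <;> simp [him]
  rw [h]
  exact (measurableSet_Ico.preimage (by fun_prop)).inter (measurableSet_Ico.preimage (by fun_prop))

theorem integrable_mul_cell {f ψ : ℂ → ℂ} (hf : IntegrableOn f cell) (hψ : Continuous ψ) :
    IntegrableOn (fun z => f z * ψ z) cell := by
  obtain ⟨C, hC⟩ := exists_bound_cell hψ
  refine Integrable.mul_bdd (c := C) hf hψ.aestronglyMeasurable ?_
  exact (ae_restrict_iff' measurableSet_cell).2 (Filter.Eventually.of_forall hC)

/-- `D` maps smooth functions to continuous functions. -/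
def MapsToCont (D : (ℂ → ℂ) → ℂ → ℂ) : Prop := ∀ φ, ContDiff ℝ (⊤ : ℕ∞) φ → Continuous (D φ)

theorem mapsToCont_dx1 : MapsToCont dx1 := fun _ h =>
  (h.continuous_fderiv (by simp)).clm_apply continuous_const

theorem mapsToCont_dx2 : MapsToCont dx2 := fun _ h =>
  (h.continuous_fderiv (by simp)).clm_apply continuous_const

theorem mapsToCont_twoDzbar : MapsToCont twoDzbar := fun φ h =>
  continuous_const.mul ((mapsToCont_dx1 φ h).add (continuous_const.mul (mapsToCont_dx2 φ h)))

theorem mapsToCont_twoDz : MapsToCont twoDz := fun φ h =>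
  continuous_const.mul ((mapsToCont_dx1 φ h).sub (continuous_const.mul (mapsToCont_dx2 φ h)))

theorem WeakEq.congr {D k} {f f' g g' : ℂ → ℂ} (h : WeakEq D k f g)
    (hf : f' =ᵐ[volume] f) (hg : g' =ᵐ[volume] g) : WeakEq D k f' g' := by
  intro φ hφ
  rw [integral_congr_ae (g := fun z => f z * (k * φ z - D φ z)),
    integral_congr_ae (f := fun z => g' z * φ z) (g := fun z => g z * φ z)]
  · exact h φ hφ
  · filter_upwards [ae_restrict_of_ae hg] with z hz using by rw [hz]
  · filter_upwards [ae_restrict_of_ae hf] with z hz using by rw [hz]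

theorem WeakEq.add {D k} (hD : MapsToCont D) {f f' g g' : ℂ → ℂ}
    (hf : IntegrableOn f cell) (hf' : IntegrableOn f' cell)
    (hg : IntegrableOn g cell) (hg' : IntegrableOn g' cell)
    (h : WeakEq D k f g) (h' : WeakEq D k f' g') :
    WeakEq D k (fun z => f z + f' z) (fun z => g z + g' z) := by
  intro φ hφ
  have hc : Continuous φ := hφ.1.continuous
  have hψ : Continuous (fun z => k * φ z - D φ z) :=
    (continuous_const.mul hc).sub (hD φ hφ.1)
  simp only [add_mul]
  rw [integral_add (integrable_mul_cell hf hψ) (integrable_mul_cell hf' hψ),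
    integral_add (integrable_mul_cell hg hc) (integrable_mul_cell hg' hc), h φ hφ, h' φ hφ]

theorem WeakEq.smul {D k} (c : ℂ) {f g : ℂ → ℂ} (h : WeakEq D k f g) :
    WeakEq D k (fun z => c * f z) (fun z => c * g z) := by
  intro φ hφ
  simp only [mul_assoc]
  rw [integral_const_mul, integral_const_mul, h φ hφ]

theorem WeakEq.zero {D k} : WeakEq D k (fun _ => 0) (fun _ => 0) := by
  intro φ _
  simp

theorem Potential.continuous (V : Potential) : Continuous V :=
  V.analytic.continuous

/-! ### Function spaces on `ℂ/Λ` -/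

/-- Measurable functions on `ℂ` modulo equality almost everywhere. -/
abbrev FunClass : Type := ℂ →ₘ[(volume : Measure ℂ)] ℂ

/-- `L²(ℂ/Λ)`: classes of `Λ`-periodic functions that are square integrable over a period cell. -/
def L2 : Submodule ℂ FunClass where
  carrier := {u | (∀ γ ∈ lattice, ∀ᵐ z, u (z + γ) = u z) ∧ MemLp u 2 (volume.restrict cell)}
  zero_mem' := by
    refine ⟨fun γ _ => ?_, ?_⟩
    · have h0 : ⇑(0 : FunClass) =ᵐ[volume] 0 := AEEqFun.coeFn_zero
      filter_upwards [h0, (measurePreserving_add_right volume γ).quasiMeasurePreserving.ae h0]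
        with z h1 h2
      rw [h1, h2]
      rfl
    · exact (memLp_congr_ae (ae_restrict_of_ae AEEqFun.coeFn_zero)).2 MemLp.zero
  add_mem' := by
    intro u v hu hv
    refine ⟨fun γ hγ => ?_, ?_⟩
    · have h0 := AEEqFun.coeFn_add u v
      filter_upwards [h0, (measurePreserving_add_right volume γ).quasiMeasurePreserving.ae h0,
        hu.1 γ hγ, hv.1 γ hγ] with z h1 h2 h3 h4
      rw [h1, h2, Pi.add_apply, Pi.add_apply, h3, h4]
    · exact (memLp_congr_ae (ae_restrict_of_ae (AEEqFun.coeFn_add u v))).2 (hu.2.add hv.2)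
  smul_mem' := by
    intro c u hu
    refine ⟨fun γ hγ => ?_, ?_⟩
    · have h0 := AEEqFun.coeFn_smul c u
      filter_upwards [h0, (measurePreserving_add_right volume γ).quasiMeasurePreserving.ae h0,
        hu.1 γ hγ] with z h1 h2 h3
      rw [h1, h2, Pi.smul_apply, Pi.smul_apply, h3]
    · exact (memLp_congr_ae (ae_restrict_of_ae (AEEqFun.coeFn_smul c u))).2 (hu.2.const_smul c)

theorem volume_cell_lt_top : volume cell < ⊤ := by
  obtain ⟨C, hC⟩ := exists_bound_cell continuous_id
  refine lt_of_le_of_lt (measure_mono (t := Metric.closedBall 0 C) ?_) measure_closedBall_lt_top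
  intro z hz
  simpa using hC z hz

theorem integrableOn_of_mem_L2 {u : FunClass} (hu : u ∈ L2) : IntegrableOn u cell := by
  have : IsFiniteMeasure (volume.restrict cell) :=
    ⟨by rw [Measure.restrict_apply_univ]; exact volume_cell_lt_top⟩
  exact hu.2.integrable (by norm_num)

/-- The functions in `L²(ℂ/Λ)` whose first order weak derivatives lie in `S`. -/
def derivsIn (S : Submodule ℂ FunClass) (hS : S ≤ L2) : Submodule ℂ FunClass where
  carrier := {u | u ∈ L2 ∧ (∃ p ∈ S, WeakEq dx1 0 u p) ∧ (∃ q ∈ S, WeakEq dx2 0 u q)}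
  zero_mem' := by
    refine ⟨L2.zero_mem, ⟨0, S.zero_mem, ?_⟩, ⟨0, S.zero_mem, ?_⟩⟩ <;>
    exact WeakEq.zero.congr AEEqFun.coeFn_zero AEEqFun.coeFn_zero
  add_mem' := by
    rintro u v ⟨hu, ⟨p, hp, h1⟩, ⟨q, hq, h2⟩⟩ ⟨hv, ⟨p', hp', h1'⟩, ⟨q', hq', h2'⟩⟩
    have hi {w : FunClass} (hw : w ∈ S) := integrableOn_of_mem_L2 (hS hw)
    have hu' := integrableOn_of_mem_L2 hu
    have hv' := integrableOn_of_mem_L2 hv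
    exact ⟨L2.add_mem hu hv,
      ⟨p + p', S.add_mem hp hp', (WeakEq.add mapsToCont_dx1 hu' hv' (hi hp) (hi hp') h1 h1').congr
        (AEEqFun.coeFn_add _ _) (AEEqFun.coeFn_add _ _)⟩,
      ⟨q + q', S.add_mem hq hq', (WeakEq.add mapsToCont_dx2 hu' hv' (hi hq) (hi hq') h2 h2').congr
        (AEEqFun.coeFn_add _ _) (AEEqFun.coeFn_add _ _)⟩⟩
  smul_mem' := by
    rintro c u ⟨hu, ⟨p, hp, h1⟩, ⟨q, hq, h2⟩⟩
    exact ⟨L2.smul_mem c hu,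
      ⟨c • p, S.smul_mem c hp, (h1.smul c).congr (AEEqFun.coeFn_smul _ _)
        (AEEqFun.coeFn_smul _ _)⟩,
      ⟨c • q, S.smul_mem c hq, (h2.smul c).congr (AEEqFun.coeFn_smul _ _)
        (AEEqFun.coeFn_smul _ _)⟩⟩

/-- The Sobolev space `H¹(ℂ/Λ)`. -/
def H1 : Submodule ℂ FunClass := derivsIn L2 le_rfl

theorem H1_le_L2 : H1 ≤ L2 := fun _ h => h.1

/-- The Sobolev space `H²(ℂ/Λ)`. -/
def H2 : Submodule ℂ FunClass := derivsIn H1 H1_le_L2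

/-- `L²_ℓ(ℂ/Λ; ℂ)`: `u(τz) = τ^ℓ u(z)`. -/
def L2sym1 (l : ℤ) : Set FunClass :=
  {u | u ∈ L2 ∧ ∀ᵐ z, u (τ * z) = τ ^ l * u z}

/-- `L²_ℓ(ℂ/Λ; ℂ²)`: `(τ̄ u₁(τz), u₂(τz)) = τ^ℓ (u₁(z), u₂(z))`. -/
def L2sym2 (l : ℤ) : Set (Fin 2 → FunClass) :=
  {u | (∀ j, u j ∈ L2) ∧ ∀ᵐ z, conj τ * u 0 (τ * z) = τ ^ l * u 0 z ∧ u 1 (τ * z) = τ ^ l * u 1 z}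

/-! ### The operators -/

/-- The kernel on `H²(ℂ/Λ)` of `P(α,k) = (2D_{z̄} + k)² - α² V`, that is, of
`u ↦ (2D_{z̄} + k) w - α² V u` with `w = (2D_{z̄} + k) u`. -/
def kerP (V : Potential) (α k : ℂ) : Set FunClass :=
  {u | u ∈ H2 ∧ ∃ w ∈ H1, WeakEq twoDzbar k u w ∧ WeakEq twoDzbar k w (fun z => α ^ 2 * V z * u z)}

/-- The set `𝒜` of magic parameters: `ker_{H²} P(α,k) ≠ {0}` for all `k`. -/
def magic (V : Potential) : Set ℂ := {α | ∀ k : ℂ, ∃ u ∈ kerP V α k, u ≠ 0}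

/-- `(D_S(α) + k) u = 0` weakly, `D_S(α) = (2D_{z̄}, αV; α, 2D_{z̄})`. -/
def SolvesDS (V : Potential) (α k : ℂ) (u₁ u₂ : FunClass) : Prop :=
  WeakEq twoDzbar k u₁ (fun z => -(α * V z) * u₂ z) ∧
  WeakEq twoDzbar k u₂ (fun z => -α * u₁ z)

/-- `(D_S(α) + k)^* u = 0` weakly; the adjoint is `(2D_z + k̄, ᾱ; ᾱ V̄, 2D_z + k̄)`. -/
def SolvesDSadj (V : Potential) (α k : ℂ) (u₁ u₂ : FunClass) : Prop :=
  WeakEq twoDz (conj k) u₁ (fun z => -(conj α) * u₂ z) ∧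
  WeakEq twoDz (conj k) u₂ (fun z => -(conj α * conj (V z)) * u₁ z)

theorem WeakEq.add_class {D k} (hD : MapsToCont D) {c : ℂ → ℂ} (hc : Continuous c)
    {u u' v v' : FunClass} (hu : u ∈ L2) (hu' : u' ∈ L2) (hv : v ∈ L2) (hv' : v' ∈ L2)
    (h : WeakEq D k u (fun z => c z * v z)) (h' : WeakEq D k u' (fun z => c z * v' z)) :
    WeakEq D k ⇑(u + u') (fun z => c z * (v + v') z) := by
  have hi {w : FunClass} (hw : w ∈ L2) : IntegrableOn (fun z => c z * w z) cell := by
    simpa only [mul_comm] using integrable_mul_cell (integrableOn_of_mem_L2 hw) hc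
  refine (WeakEq.add hD (integrableOn_of_mem_L2 hu) (integrableOn_of_mem_L2 hu') (hi hv) (hi hv')
    h h').congr (AEEqFun.coeFn_add _ _) ?_
  filter_upwards [AEEqFun.coeFn_add v v'] with z hz
  rw [hz, Pi.add_apply, mul_add]

theorem WeakEq.smul_class {D k} {c : ℂ → ℂ} (a : ℂ) {u v : FunClass}
    (h : WeakEq D k u (fun z => c z * v z)) :
    WeakEq D k ⇑(a • u) (fun z => c z * (a • v) z) := by
  refine (h.smul a).congr (AEEqFun.coeFn_smul _ _) ?_
  filter_upwards [AEEqFun.coeFn_smul a v] with z hz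
  rw [hz, Pi.smul_apply, smul_eq_mul]
  ring

theorem WeakEq.zero_class {D k} {c : ℂ → ℂ} :
    WeakEq D k ⇑(0 : FunClass) (fun z => c z * (0 : FunClass) z) := by
  refine WeakEq.zero.congr AEEqFun.coeFn_zero ?_
  filter_upwards [(AEEqFun.coeFn_zero : ⇑(0 : FunClass) =ᵐ[volume] 0)] with z hz
  rw [hz, Pi.zero_apply, mul_zero]

/-- The kernel of `D_S(α) + k` on `H¹(ℂ/Λ; ℂ²)`. -/
def kerDS (V : Potential) (α k : ℂ) : Submodule ℂ (Fin 2 → FunClass) where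
  carrier := {u | (∀ j, u j ∈ H1) ∧ SolvesDS V α k (u 0) (u 1)}
  zero_mem' := ⟨fun _ => H1.zero_mem, WeakEq.zero_class, WeakEq.zero_class⟩
  add_mem' := by
    intro u v hu hv
    have hV := V.continuous
    have a (j) := H1_le_L2 (hu.1 j)
    have b (j) := H1_le_L2 (hv.1 j)
    exact ⟨fun j => H1.add_mem (hu.1 j) (hv.1 j),
      WeakEq.add_class mapsToCont_twoDzbar (by fun_prop) (a _) (b _) (a _) (b _) hu.2.1 hv.2.1,
      WeakEq.add_class mapsToCont_twoDzbar (by fun_prop) (a _) (b _) (a _) (b _) hu.2.2 hv.2.2⟩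
  smul_mem' := fun c _ hu => ⟨fun j => H1.smul_mem c (hu.1 j),
    WeakEq.smul_class c hu.2.1, WeakEq.smul_class c hu.2.2⟩

/-- The kernel on `H¹(ℂ/Λ; ℂ⁴)` of the self-adjoint operator
`H(α,k) = (0, D_S(α) + k; (D_S(α) + k)^*, 0)`. -/
def kerH (V : Potential) (α k : ℂ) : Submodule ℂ (Fin 4 → FunClass) where
  carrier := {u | (∀ j, u j ∈ H1) ∧ SolvesDS V α k (u 2) (u 3) ∧ SolvesDSadj V α k (u 0) (u 1)}
  zero_mem' := ⟨fun _ => H1.zero_mem, ⟨WeakEq.zero_class, WeakEq.zero_class⟩,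
    ⟨WeakEq.zero_class, WeakEq.zero_class⟩⟩
  add_mem' := by
    intro u v hu hv
    have hV := V.continuous
    have a (j) := H1_le_L2 (hu.1 j)
    have b (j) := H1_le_L2 (hv.1 j)
    have hV' : Continuous fun z => -(conj α * conj (V z)) :=
      (continuous_const.mul (Complex.continuous_conj.comp hV)).neg
    exact ⟨fun j => H1.add_mem (hu.1 j) (hv.1 j),
      ⟨WeakEq.add_class mapsToCont_twoDzbar (by fun_prop) (a _) (b _) (a _) (b _)
        hu.2.1.1 hv.2.1.1,
      WeakEq.add_class mapsToCont_twoDzbar (by fun_prop) (a _) (b _) (a _) (b _)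
        hu.2.1.2 hv.2.1.2⟩,
      ⟨WeakEq.add_class mapsToCont_twoDz (by fun_prop) (a _) (b _) (a _) (b _)
        hu.2.2.1 hv.2.2.1,
      WeakEq.add_class mapsToCont_twoDz hV' (a _) (b _) (a _) (b _)
        hu.2.2.2 hv.2.2.2⟩⟩
  smul_mem' := fun c _ hu => ⟨fun j => H1.smul_mem c (hu.1 j),
    ⟨WeakEq.smul_class c hu.2.1.1, WeakEq.smul_class c hu.2.1.2⟩,
    ⟨WeakEq.smul_class c hu.2.2.1, WeakEq.smul_class c hu.2.2.2⟩⟩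

/-- `α` has multiplicity two: `dim ker H(α,k) = 4` for all `k`. -/
def MultiplicityTwo (V : Potential) (α : ℂ) : Prop :=
  ∀ k : ℂ, Module.finrank ℂ (kerH V α k) = 4

/-! ### Protected states and their zeros -/

/-- `u` is (the smooth representative of) a protected state at `α`: a nonzero element of
`ker P(α,0) ∩ L²_0(ℂ/Λ; ℂ)`. -/
def IsProtectedState (V : Potential) (α : ℂ) (u : ℂ → ℂ) : Prop :=
  ContDiff ℝ (⊤ : ℕ∞) u ∧ u ≠ 0 ∧ ∃ U ∈ kerP V α 0, U ∈ L2sym1 0 ∧ ⇑U =ᵐ[volume] u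

/-- The vector `𝐮 = (α⁻¹ 2D_{z̄} u, -u)` attached to a solution of `P(α,0) u = 0`, `α ≠ 0`. -/
def bold (α : ℂ) (u : ℂ → ℂ) : Fin 2 → ℂ → ℂ :=
  ![fun z => α⁻¹ * twoDzbar u z, fun z => -u z]

/-- The vector valued function `F` vanishes at `z`. -/
def VanishesAt (F : Fin 2 → ℂ → ℂ) (z : ℂ) : Prop := ∀ j, F j z = 0

/-- `F` has a zero of multiplicity one at `z`: `F(z) = 0` and `∂_z F(z) ≠ 0`. -/
def SimpleZeroAt (F : Fin 2 → ℂ → ℂ) (z : ℂ) : Prop :=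
  VanishesAt F z ∧ ∃ j, dz (F j) z ≠ 0

/-- The zeros of `F` are exactly `±z_S` modulo `Λ`, each of multiplicity one. -/
def ZerosExactlyStacking (F : Fin 2 → ℂ → ℂ) : Prop :=
  SimpleZeroAt F zS ∧ SimpleZeroAt F (-zS) ∧
  ∀ z, VanishesAt F z → z - zS ∈ lattice ∨ z + zS ∈ lattice

end ScalarModel

end

noncomputable section

namespace ScalarModel

open Set Filter Topology

/-! ### The lattice, the period cell and its coordinates -/

/-! Fourier series on the torus reduce the statement to the spaces `sol V α k` of smooth periodic
solutions of `(D_S(α) + k) u = 0`. Ellipticity of `2D_{z̄}` makes weak solutions smooth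
(`exists_smooth_of_weakEq`) and these spaces finite dimensional. Since `V` is even, `(u₁, u₂) ↦
(conj u₂(-z), conj u₁(-z))` exchanges the kernels of `D_S(α) + k` and of its adjoint. Hence `dim ker
H(α,k)` is twice `dim sol V α k` (`finrank_kerH`), and multiplicity two means that every `sol V α k`
has dimension two.

The Wronskian of solutions with parameters `k` and `k'` is annihilated by `2D_{z̄} + k + k'`, so it
is identically zero or a nowhere vanishing multiple of a character. At a magic `α` the second case
is excluded: a nonzero solution with a generic third parameter would be parallel to two independent
vectors at every point (`wronskian_eq_zero_of_magic`). So any other solution is `v = f u`, where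
`(2D_{z̄} + k' - k) f = 0` away from the zeros of `u`. Conversely, at a zero of `u` the equation
gives `∂̄u = 0`, so `u` may be multiplied by a function with a simple pole there (`exists_mul_sol`).

Solutions are thus counted as in Riemann–Roch on an elliptic curve. If the zeros of `u` are two
inequivalent simple points, then `dim sol V α k = 2` for every `k` (`finrank_sol_of_zeros`). Three
zeros counted with multiplicity give at least three independent solutions with the parameter of `u`
(`three_le_finrank_of_three_zeros`, `three_le_finrank_of_double_zero`,
`three_le_finrank_of_triple_zero`).

For a protected state the zero set is invariant under rotation by `τ`. A zero not fixed by `τ²`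
modulo `Λ` produces three inequivalent zeros; if all zeros lie in `Λ`, a simple zero forces
dimension at most one, and a multiple zero is triple by symmetry. In dimension two only `±z_S`
remain, and there can be no further zeros or multiplicity (`vanishesAt_zS`,
`zerosExactlyStacking_of_finrank_le`). The second kernel element is `Φ u` with `Φ` elliptic with
simple poles at `±z_S`, corrected by a multiple of `u` to become an eigenvector of the rotation
(`exists_rot_eigenvector`).

Protected states exist for every `α`, by the Fredholm alternative for `α² ξ⁻² V` on rotation
invariant Fourier coefficients (`exists_invSeq`): multiplication by `V` changes the rotation weight,
so the zero frequency imposes no obstruction. -/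

theorem omega_eq : ω = ⟨-1 / 2, Real.sqrt 3 / 2⟩ := by
  have h : (2 * Real.pi * Complex.I / 3 : ℂ) = ((Real.pi - Real.pi / 3 : ℝ) : ℂ) * Complex.I := by
    push_cast; ring
  rw [ω, h]
  apply Complex.ext
  · rw [Complex.exp_ofReal_mul_I_re, Real.cos_pi_sub, Real.cos_pi_div_three]; norm_num
  · rw [Complex.exp_ofReal_mul_I_im, Real.sin_pi_sub, Real.sin_pi_div_three]

theorem tau_eq : τ = -ω := by
  have h : (-(Real.pi * Complex.I / 3) : ℂ) = ((-(Real.pi / 3) : ℝ) : ℂ) * Complex.I := by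
    push_cast; ring
  rw [τ, h, omega_eq]
  apply Complex.ext
  · rw [Complex.exp_ofReal_mul_I_re, Real.cos_neg, Real.cos_pi_div_three]; norm_num
  · rw [Complex.exp_ofReal_mul_I_im, Real.sin_neg, Real.sin_pi_div_three]; simp

theorem omega_re : ω.re = -1 / 2 := by rw [omega_eq]

theorem omega_im : ω.im = Real.sqrt 3 / 2 := by rw [omega_eq]

theorem omega_im_pos : 0 < ω.im := by rw [omega_im]; positivity

theorem omega_sq : ω ^ 2 = -1 - ω := by
  have h3 : Real.sqrt 3 * Real.sqrt 3 = 3 := Real.mul_self_sqrt (by norm_num)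
  rw [omega_eq, sq]
  apply Complex.ext
  · simp; nlinarith
  · simp; ring

theorem one_mem_lattice : (1 : ℂ) ∈ lattice := ⟨1, 0, by simp⟩

theorem omega_mem_lattice : ω ∈ lattice := ⟨0, 1, by simp⟩

theorem mul_omega_mem_lattice {γ : ℂ} (h : γ ∈ lattice) : ω * γ ∈ lattice := by
  obtain ⟨m, n, rfl⟩ := h
  refine ⟨-n, m - n, ?_⟩
  push_cast
  linear_combination (n : ℂ) * omega_sq

theorem mul_tau_mem_lattice {γ : ℂ} (h : γ ∈ lattice) : τ * γ ∈ lattice := by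
  rw [tau_eq, neg_mul]
  exact lattice.neg_mem (mul_omega_mem_lattice h)

/-- `Λ`-periodic functions. -/
def Periodic (f : ℂ → ℂ) : Prop := ∀ γ ∈ lattice, ∀ z, f (z + γ) = f z

/-- The real coordinates `(s, t) ↦ s + tω`. -/
def par : (ℝ × ℝ) ≃L[ℝ] ℂ :=
  LinearEquiv.toContinuousLinearEquiv
    { toFun := fun p => p.1 + p.2 * ω
      invFun := fun z => (z.re - z.im / ω.im * ω.re, z.im / ω.im)
      map_add' := fun p q => by simp; ring
      map_smul' := fun c p => by simp; ring
      left_inv := fun p => by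
        have := omega_im_pos.ne'
        ext <;> simp [this]
      right_inv := fun z => by
        have := omega_im_pos.ne'
        apply Complex.ext <;> simp [this] }

theorem par_apply (p : ℝ × ℝ) : par p = p.1 + p.2 * ω := rfl

theorem par_symm_apply (z : ℂ) :
    par.symm z = (z.re - z.im / ω.im * ω.re, z.im / ω.im) := rfl

theorem cell_eq_image : cell = par '' (Ico 0 1 ×ˢ Ico 0 1) := by
  ext z
  constructor
  · rintro ⟨s, hs, t, ht, rfl⟩
    exact ⟨(s, t), ⟨hs, ht⟩, rfl⟩
  · rintro ⟨⟨s, t⟩, ⟨hs, ht⟩, rfl⟩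
    exact ⟨s, hs, t, ht, rfl⟩

theorem preimage_cell : par ⁻¹' cell = Ico 0 1 ×ˢ Ico 0 1 := by
  rw [cell_eq_image, preimage_image_eq _ par.injective]

/-- Both measures are Haar measures on `ℂ`. The Jacobian is left unspecified: only its not being
zero matters, because Fourier coefficients are normalized by the area of the cell. -/
theorem map_par_volume : ∃ c : NNReal, c ≠ 0 ∧ (volume : Measure ℂ) = c • Measure.map par volume := by
  have h1 : (Measure.map par (volume : Measure (ℝ × ℝ))).IsAddHaarMeasure :=
    par.isAddHaarMeasure_map _
  refine ⟨Measure.addHaarScalarFactor volume (Measure.map par volume), ?_, ?_⟩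
  · exact (Measure.addHaarScalarFactor_pos_of_isAddHaarMeasure _ _).ne'
  · exact Measure.isAddLeftInvariant_eq_smul _ _

theorem Ico_prod_ae_eq_Icc : (Ico (0 : ℝ) 1 ×ˢ Ico (0 : ℝ) 1 : Set (ℝ × ℝ)) =ᵐ[volume]
    Icc ((0 : ℝ), (0 : ℝ)) (1, 1) := by
  rw [← Icc_prod_Icc]
  exact Measure.set_prod_ae_eq Ico_ae_eq_Icc Ico_ae_eq_Icc

/-- Integrals over the period cell in coordinates. -/
theorem setIntegral_cell : ∃ J : ℝ, J ≠ 0 ∧ ∀ f : ℂ → ℂ,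
    ∫ z in cell, f z = J • ∫ x in Icc ((0 : ℝ), (0 : ℝ)) (1, 1), f (par x) := by
  obtain ⟨c, hc, h⟩ := map_par_volume
  refine ⟨c, by simpa using hc, fun f => ?_⟩
  have he : MeasurableEmbedding par := par.toHomeomorph.measurableEmbedding
  rw [h, Measure.restrict_smul, integral_smul_nnreal_measure, he.setIntegral_map, preimage_cell,
    setIntegral_congr_set Ico_prod_ae_eq_Icc]
  rfl

theorem exists_sub_mem_cell (z : ℂ) : ∃ γ ∈ lattice, z - γ ∈ cell := by
  refine ⟨⌊(par.symm z).1⌋ + ⌊(par.symm z).2⌋ * ω, ⟨_, _, rfl⟩, Int.fract (par.symm z).1,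
    ⟨Int.fract_nonneg _, Int.fract_lt_one _⟩, Int.fract (par.symm z).2,
    ⟨Int.fract_nonneg _, Int.fract_lt_one _⟩, ?_⟩
  have h : z = (par.symm z).1 + (par.symm z).2 * ω := by
    rw [← par_apply, par.apply_symm_apply]
  have h1 (x : ℝ) : ((Int.fract x : ℝ) : ℂ) = (x : ℂ) - (⌊x⌋ : ℂ) := by
    rw [Int.fract]; push_cast; rfl
  rw [h1, h1]
  linear_combination h

theorem countable_lattice : (lattice : Set ℂ).Countable := by
  have : (lattice : Set ℂ) = range fun p : ℤ × ℤ => (p.1 + p.2 * ω : ℂ) := by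
    ext z
    constructor
    · rintro ⟨m, n, rfl⟩
      exact ⟨(m, n), rfl⟩
    · rintro ⟨⟨m, n⟩, rfl⟩
      exact ⟨m, n, rfl⟩
  rw [this]
  exact countable_range _

/-- Almost everywhere periodic functions. -/
def AEPeriodic (f : ℂ → ℂ) : Prop := ∀ γ ∈ lattice, ∀ᵐ z, f (z + γ) = f z

theorem Periodic.aePeriodic {f : ℂ → ℂ} (h : Periodic f) : AEPeriodic f :=
  fun γ hγ => Eventually.of_forall (h γ hγ)

/-- Countably many translates of the cell cover the plane, so the exceptional null sets can be
united. -/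
theorem AEPeriodic.ae_eq {f g : ℂ → ℂ} (hf : AEPeriodic f) (hg : AEPeriodic g)
    (h : f =ᵐ[volume.restrict cell] g) : f =ᵐ[volume] g := by
  have h0 : ∀ᵐ z, z ∈ cell → f z = g z := (ae_restrict_iff' measurableSet_cell).1 h
  have h1 : ∀ᵐ z, ∀ γ ∈ (lattice : Set ℂ), z + γ ∈ cell → f z = g z := by
    rw [ae_ball_iff countable_lattice]
    intro γ hγ
    filter_upwards [(measurePreserving_add_right volume γ).quasiMeasurePreserving.ae h0,
      hf γ hγ, hg γ hγ] with z h2 h3 h4 h5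
    rw [← h3, ← h4, h2 h5]
  filter_upwards [h1] with z hz
  obtain ⟨γ, hγ, hc⟩ := exists_sub_mem_cell z
  exact hz (-γ) (lattice.neg_mem hγ) (by rwa [← sub_eq_add_neg])

/-! ### First order operators with constant coefficients -/

/-- The operator `a ∂_{x₁} + b ∂_{x₂}`. -/
def firstOrder (a b : ℂ) (φ : ℂ → ℂ) (z : ℂ) : ℂ := a * dx1 φ z + b * dx2 φ z

theorem dx1_eq_firstOrder : dx1 = firstOrder 1 0 := by
  ext φ z; simp [firstOrder]

theorem dx2_eq_firstOrder : dx2 = firstOrder 0 1 := by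
  ext φ z; simp [firstOrder]

theorem twoDzbar_eq_firstOrder : twoDzbar = firstOrder (1 / Complex.I) 1 := by
  ext φ z; simp [firstOrder, twoDzbar]; ring_nf; simp

theorem twoDz_eq_firstOrder : twoDz = firstOrder (1 / Complex.I) (-1) := by
  ext φ z; simp [firstOrder, twoDz]; ring_nf; simp; ring

theorem firstOrder_mul {a b : ℂ} {f g : ℂ → ℂ} {z : ℂ} (hf : DifferentiableAt ℝ f z)
    (hg : DifferentiableAt ℝ g z) :
    firstOrder a b (fun w => f w * g w) z =
      firstOrder a b f z * g z + f z * firstOrder a b g z := by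
  simp only [firstOrder, dx1, dx2]
  rw [fderiv_fun_mul hf hg]
  simp
  ring

theorem mapsToCont_firstOrder (a b : ℂ) : MapsToCont (firstOrder a b) := fun φ h =>
  (continuous_const.mul (mapsToCont_dx1 φ h)).add (continuous_const.mul (mapsToCont_dx2 φ h))

/-- The divergence theorem on the unit square, whose boundary terms cancel by periodicity. The
countable exceptional set is what later lets poles be removed: there the function is continuous but
perhaps not differentiable. -/
theorem integral_firstOrder_eq_zero {a b : ℂ} {W G : ℂ → ℂ} {N : Set ℂ} (hN : N.Countable)
    (hW : Continuous W) (hP : Periodic W) (hd : ∀ z ∉ N, DifferentiableAt ℝ W z)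
    (hG : Continuous G) (h : ∀ z ∉ N, firstOrder a b W z = G z) : ∫ z in cell, G z = 0 := by
  obtain ⟨J, -, hJ⟩ := setIntegral_cell
  rw [hJ]
  -- `A` and `B` are the components of the vector field `a ∂_{x₁} + b ∂_{x₂}` in the coordinates `s
  -- + tω`.
  set A : ℂ := a - b * (ω.re / ω.im : ℝ) with hA
  set B : ℂ := b * (1 / ω.im : ℝ) with hB
  have hpar : Continuous par := par.continuous
  have hWp : Continuous fun x => W (par x) := hW.comp hpar
  set W' : ℝ × ℝ → ℝ × ℝ →L[ℝ] ℂ := fun x => (fderiv ℝ W (par x)).comp (par : ℝ × ℝ →L[ℝ] ℂ)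
    with hW'
  have hs : (par ⁻¹' N).Countable := hN.preimage par.injective
  have hdW (x : ℝ × ℝ) (hx : x ∉ par ⁻¹' N) : HasFDerivAt (fun x => W (par x)) (W' x) x :=
    (hd _ hx).hasFDerivAt.comp x par.hasFDerivAt
  have him := omega_im_pos.ne'
  have hdiv (x : ℝ × ℝ) (hx : x ∉ par ⁻¹' N) :
      (A • W' x) (1, 0) + (B • W' x) (0, 1) = G (par x) := by
    rw [← h _ hx]
    have e1 : par (1, 0) = 1 := by simp [par_apply]
    have e2 : par (0, 1) = ω.re • (1 : ℂ) + ω.im • Complex.I := by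
      rw [par_apply]; apply Complex.ext <;> simp
    have e3 : fderiv ℝ W (par x) (par (0, 1)) = ω.re * fderiv ℝ W (par x) 1 +
        ω.im * fderiv ℝ W (par x) Complex.I := by
      rw [e2, map_add, map_smul, map_smul, Complex.real_smul, Complex.real_smul]
    simp only [hW', _root_.smul_apply, ContinuousLinearMap.comp_apply,
      ContinuousLinearEquiv.coe_coe, e1, e3, firstOrder, dx1, dx2, hA, hB, smul_eq_mul]
    have him' : (ω.im : ℂ) ≠ 0 := by exact_mod_cast him
    push_cast
    field_simp
    ring
  have hae : ∀ᵐ x : ℝ × ℝ, (A • W' x) (1, 0) + (B • W' x) (0, 1) = G (par x) := by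
    filter_upwards [hs.ae_notMem volume] with x hx using hdiv x hx
  have key := integral_divergence_prod_Icc_of_hasFDerivAt_off_countable_of_le
    (fun x => A • W (par x)) (fun x => B • W (par x)) (fun x => A • W' x) (fun x => B • W' x)
    (0, 0) (1, 1) (by constructor <;> norm_num) (par ⁻¹' N) hs (hWp.const_smul A).continuousOn
    (hWp.const_smul B).continuousOn (fun x hx => (hdW x hx.2).const_smul A)
    (fun x hx => (hdW x hx.2).const_smul B)
    (by
      have : IntegrableOn (fun x => G (par x)) (Icc ((0 : ℝ), (0 : ℝ)) (1, 1)) :=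
        (hG.comp hpar).continuousOn.integrableOn_compact isCompact_Icc
      exact this.congr (ae_restrict_of_ae (hae.mono fun x hx => hx.symm)))
  -- Opposite sides of the parallelogram differ by the periods `ω` and `1`.
  have e1 (x : ℝ) : W (par (x, 1)) = W (par (x, 0)) := by
    rw [← hP ω omega_mem_lattice (par (x, 0))]; congr 1; simp [par_apply]
  have e2 (y : ℝ) : W (par (1, y)) = W (par (0, y)) := by
    rw [← hP 1 one_mem_lattice (par (0, y))]; congr 1; simp [par_apply]; ring
  simp only [e1, e2, sub_self, zero_add] at key
  rw [setIntegral_congr_fun (g := fun x => G (par x)) measurableSet_Icc (fun x _ => rfl),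
    ← integral_congr_ae (ae_restrict_of_ae hae)]
  rw [key, smul_zero]

/-- Weak equations from pointwise equations off a countable set. -/
theorem weakEq_of_pointwise {a b k : ℂ} {f g : ℂ → ℂ} {N : Set ℂ} (hN : N.Countable)
    (hf : Continuous f) (hP : Periodic f) (hd : ∀ z ∉ N, DifferentiableAt ℝ f z)
    (hg : Continuous g) (h : ∀ z ∉ N, firstOrder a b f z + k * f z = g z) :
    WeakEq (firstOrder a b) k f g := by
  intro φ hφ
  have hφd : Differentiable ℝ φ := hφ.1.differentiable (by simp)
  have hφc := hφ.1.continuous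
  have hDφ := mapsToCont_firstOrder a b φ hφ.1
  have h1 : Continuous fun z => f z * (k * φ z - firstOrder a b φ z) := by fun_prop
  have h2 : Continuous fun z => g z * φ z := by fun_prop
  have hint {F : ℂ → ℂ} (hF : Continuous F) : IntegrableOn F cell := by
    have := integrable_mul_cell (f := fun _ => 1) (ψ := F)
      (integrableOn_const volume_cell_lt_top.ne) hF
    simpa using this
  -- Integration by parts: the integral of the derivative of `f φ` vanishes.
  have key := integral_firstOrder_eq_zero (a := a) (b := b) (W := fun z => f z * φ z)
    (G := fun z => g z * φ z - f z * (k * φ z - firstOrder a b φ z)) hN (by fun_prop)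
    (fun γ hγ z => by simp only [hP γ hγ, hφ.2 γ hγ]) (fun z hz => (hd z hz).mul (hφd z))
    (h2.sub h1) (fun z hz => by
      rw [firstOrder_mul (hd z hz) (hφd z), ← h z hz]; ring)
  rw [integral_sub (hint h2) (hint h1), sub_eq_zero] at key
  exact key.symm

/-! ### Characters of the torus -/

/-- The first coordinate of the covector of a character, up to `2πi`. -/
def freq1 (n : ℤ × ℤ) : ℂ := 2 * Real.pi * Complex.I * n.1

/-- The second coordinate of the covector of a character, up to `2πi`. -/
def freq2 (n : ℤ × ℤ) : ℂ := 2 * Real.pi * Complex.I * ((n.1 + 2 * n.2) / Real.sqrt 3)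

/-- The points of the dual lattice. -/
def freq (n : ℤ × ℤ) : ℂ := 2 * Real.pi * (n.1 + Complex.I * ((n.1 + 2 * n.2) / Real.sqrt 3))

/-- The phase of a character. -/
def phase (n : ℤ × ℤ) (z : ℂ) : ℂ := freq1 n * z.re + freq2 n * z.im

/-- The characters of `ℂ/Λ`. -/
def expo (n : ℤ × ℤ) (z : ℂ) : ℂ := Complex.exp (phase n z)

theorem sqrt3_ne : ((Real.sqrt 3 : ℝ) : ℂ) ≠ 0 := by
  have : Real.sqrt 3 ≠ 0 := by positivity
  exact_mod_cast this

theorem sqrt3_sq : ((Real.sqrt 3 : ℝ) : ℂ) ^ 2 = 3 := by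
  have : Real.sqrt 3 ^ 2 = 3 := Real.sq_sqrt (by norm_num)
  exact_mod_cast this

/-- In the coordinates `s + tω` the phase is `2πi (n₁ s + n₂ t)`, which explains the form of `freq2`
and makes the characters periodic. -/
theorem phase_par (n : ℤ × ℤ) (x : ℝ × ℝ) :
    phase n (par x) = 2 * Real.pi * Complex.I * (n.1 * x.1 + n.2 * x.2) := by
  have h1 : (par x).re = x.1 - x.2 / 2 := by
    simp [par_apply, omega_re]; ring
  have h2 : (par x).im = x.2 * Real.sqrt 3 / 2 := by
    simp [par_apply, omega_im]; ring
  have := sqrt3_ne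
  rw [phase, h1, h2, freq1, freq2]
  push_cast
  field_simp
  ring

theorem phase_add_index (n m : ℤ × ℤ) (z : ℂ) : phase (n + m) z = phase n z + phase m z := by
  simp [phase, freq1, freq2]; ring

theorem expo_add (n m : ℤ × ℤ) (z : ℂ) : expo (n + m) z = expo n z * expo m z := by
  rw [expo, phase_add_index, Complex.exp_add, expo, expo]

theorem expo_zero (z : ℂ) : expo 0 z = 1 := by simp [expo, phase, freq1, freq2]

theorem expo_ne_zero (n : ℤ × ℤ) (z : ℂ) : expo n z ≠ 0 := Complex.exp_ne_zero _

theorem norm_expo (n : ℤ × ℤ) (z : ℂ) : ‖expo n z‖ = 1 := by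
  have : phase n z = ((2 * Real.pi * n.1 * z.re +
      2 * Real.pi * ((n.1 + 2 * n.2) / Real.sqrt 3) * z.im : ℝ) : ℂ) * Complex.I := by
    simp only [phase, freq1, freq2]; push_cast; ring
  rw [expo, this, Complex.norm_exp_ofReal_mul_I]

theorem expo_periodic (n : ℤ × ℤ) : Periodic (expo n) := by
  rintro _ ⟨k, l, rfl⟩ z
  have h : phase n (z + (k + l * ω)) = phase n z + (n.1 * k + n.2 * l : ℤ) *
      (2 * Real.pi * Complex.I) := by
    have h0 : (k + l * ω : ℂ) = par (k, l) := by simp [par_apply]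
    have h1 : z + (k + l * ω) = par (par.symm z + ((k : ℝ), (l : ℝ))) := by
      rw [map_add, par.apply_symm_apply, h0]
    rw [h1, phase_par]
    conv_rhs => rw [← par.apply_symm_apply z, phase_par]
    simp
    ring
  rw [expo, h, Complex.exp_add, Complex.exp_int_mul_two_pi_mul_I, mul_one, expo]

theorem phase_eq_clm (n : ℤ × ℤ) : phase n = fun z =>
    (freq1 n • (Complex.ofRealCLM.comp Complex.reCLM) +
      freq2 n • (Complex.ofRealCLM.comp Complex.imCLM) : ℂ →L[ℝ] ℂ) z := by
  ext z; simp [phase]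

theorem hasFDerivAt_expo (n : ℤ × ℤ) (z : ℂ) : HasFDerivAt (expo n)
    (expo n z • (freq1 n • (Complex.ofRealCLM.comp Complex.reCLM) +
      freq2 n • (Complex.ofRealCLM.comp Complex.imCLM) : ℂ →L[ℝ] ℂ)) z := by
  have h : HasFDerivAt (phase n) (freq1 n • (Complex.ofRealCLM.comp Complex.reCLM) +
      freq2 n • (Complex.ofRealCLM.comp Complex.imCLM) : ℂ →L[ℝ] ℂ) z := by
    rw [phase_eq_clm]
    exact ContinuousLinearMap.hasFDerivAt _
  exact h.cexp

theorem contDiff_expo (n : ℤ × ℤ) : ContDiff ℝ (⊤ : ℕ∞) (expo n) := by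
  have : ContDiff ℝ (⊤ : ℕ∞) (phase n) := by
    rw [phase_eq_clm]
    exact ContinuousLinearMap.contDiff _
  exact this.cexp

theorem continuous_expo (n : ℤ × ℤ) : Continuous (expo n) := (contDiff_expo n).continuous

theorem isTest_expo (n : ℤ × ℤ) : IsTest (expo n) := ⟨contDiff_expo n, expo_periodic n⟩

theorem dx1_expo (n : ℤ × ℤ) (z : ℂ) : dx1 (expo n) z = freq1 n * expo n z := by
  rw [dx1, (hasFDerivAt_expo n z).fderiv]; simp; ring

theorem dx2_expo (n : ℤ × ℤ) (z : ℂ) : dx2 (expo n) z = freq2 n * expo n z := by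
  rw [dx2, (hasFDerivAt_expo n z).fderiv]; simp; ring

theorem firstOrder_expo (a b : ℂ) (n : ℤ × ℤ) (z : ℂ) :
    firstOrder a b (expo n) z = (a * freq1 n + b * freq2 n) * expo n z := by
  rw [firstOrder, dx1_expo, dx2_expo]; ring

theorem freq_eq (n : ℤ × ℤ) : 1 / Complex.I * freq1 n + 1 * freq2 n = freq n := by
  have := Complex.I_ne_zero
  rw [freq1, freq2, freq]
  field_simp

theorem twoDzbar_expo (n : ℤ × ℤ) (z : ℂ) : twoDzbar (expo n) z = freq n * expo n z := by
  rw [twoDzbar_eq_firstOrder, firstOrder_expo, freq_eq]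

theorem freq_add (n m : ℤ × ℤ) : freq (n + m) = freq n + freq m := by
  simp [freq]; ring

theorem freq_neg (n : ℤ × ℤ) : freq (-n) = -freq n := by
  simp [freq]; ring

theorem freq1_neg (n : ℤ × ℤ) : freq1 (-n) = -freq1 n := by simp [freq1]

theorem freq2_neg (n : ℤ × ℤ) : freq2 (-n) = -freq2 n := by simp [freq2]; ring

/-- The weight `1 + |n₁| + |n₂|`. -/
def wt (n : ℤ × ℤ) : ℝ := 1 + |(n.1 : ℝ)| + |(n.2 : ℝ)|

theorem one_le_wt (n : ℤ × ℤ) : 1 ≤ wt n := by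
  have := abs_nonneg (n.1 : ℝ); have := abs_nonneg (n.2 : ℝ); rw [wt]; linarith

theorem wt_pos (n : ℤ × ℤ) : 0 < wt n := lt_of_lt_of_le one_pos (one_le_wt n)

/-- This is the ellipticity of `2D_{z̄}`: the real and imaginary parts `2πn₁` and `2π(n₁ + 2n₂)/√3`
of its symbol control both indices. -/
theorem wt_le_norm_freq (n : ℤ × ℤ) : wt n ≤ 1 + ‖freq n‖ := by
  have hpi := Real.pi_gt_three
  have h3 : (0 : ℝ) < Real.sqrt 3 := by positivity
  have h3' : Real.sqrt 3 < 2 := by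
    rw [Real.sqrt_lt' (by norm_num)]; norm_num
  have e : freq n = ⟨2 * Real.pi * n.1, 2 * Real.pi * ((n.1 + 2 * n.2) / Real.sqrt 3)⟩ := by
    have : freq n = ((2 * Real.pi * n.1 : ℝ) : ℂ) +
        ((2 * Real.pi * ((n.1 + 2 * n.2) / Real.sqrt 3) : ℝ) : ℂ) * Complex.I := by
      rw [freq]; push_cast; ring
    rw [this, ← Complex.mk_eq_add_mul_I]
  have h1 := Complex.abs_re_le_norm (freq n)
  have h2 := Complex.abs_im_le_norm (freq n)
  rw [e] at h1 h2
  simp only [abs_mul, abs_div, abs_of_pos h3, abs_of_pos Real.pi_pos, abs_two] at h1 h2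
  rw [← e] at h1 h2
  have h4 : 3 * |(n.1 + 2 * n.2 : ℝ)| ≤ ‖freq n‖ := by
    refine le_trans ?_ h2
    rw [← mul_div_assoc, le_div_iff₀ h3]
    nlinarith [abs_nonneg (n.1 + 2 * n.2 : ℝ), mul_nonneg (abs_nonneg (n.1 + 2 * n.2 : ℝ)) h3.le]
  have h5 : 6 * |(n.1 : ℝ)| ≤ ‖freq n‖ := by
    refine le_trans ?_ h1
    nlinarith [abs_nonneg (n.1 : ℝ)]
  have h6 : 2 * |(n.2 : ℝ)| ≤ |(n.1 + 2 * n.2 : ℝ)| + |(n.1 : ℝ)| := by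
    have : (2 * n.2 : ℝ) = (n.1 + 2 * n.2) - n.1 := by ring
    have h7 := abs_sub (n.1 + 2 * n.2 : ℝ) n.1
    rwa [← this, abs_mul, abs_two] at h7
  have := abs_nonneg (n.1 : ℝ)
  rw [wt]
  linarith [abs_nonneg (n.1 + 2 * n.2 : ℝ)]

theorem norm_freq12_le (n : ℤ × ℤ) : ‖freq1 n‖ ≤ 14 * wt n ∧ ‖freq2 n‖ ≤ 14 * wt n := by
  have hpi := Real.pi_lt_d2
  have hp := Real.pi_pos
  have h3 : (1 : ℝ) < Real.sqrt 3 := by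
    rw [Real.lt_sqrt (by norm_num)]; norm_num
  have a1 := abs_nonneg (n.1 : ℝ)
  have a2 := abs_nonneg (n.2 : ℝ)
  constructor
  · rw [freq1]
    simp only [norm_mul, Complex.norm_ofNat, Complex.norm_real, Complex.norm_I, mul_one,
      Complex.norm_intCast, Real.norm_eq_abs, abs_of_pos hp, wt]
    nlinarith
  · have h : ‖(n.1 + 2 * n.2 : ℂ)‖ ≤ |(n.1 : ℝ)| + 2 * |(n.2 : ℝ)| := by
      refine (norm_add_le _ _).trans ?_
      simp
    rw [freq2]
    simp only [norm_mul, norm_div, Complex.norm_ofNat, Complex.norm_real, Complex.norm_I, mul_one,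
      Real.norm_eq_abs, abs_of_pos hp, abs_of_pos (one_pos.trans h3), wt]
    have : ‖(n.1 + 2 * n.2 : ℂ)‖ / Real.sqrt 3 ≤ |(n.1 : ℝ)| + 2 * |(n.2 : ℝ)| :=
      (div_le_self (norm_nonneg _) h3.le).trans h
    have h7 : 0 ≤ ‖(n.1 + 2 * n.2 : ℂ)‖ / Real.sqrt 3 := by positivity
    nlinarith

theorem wt_add_le (n m : ℤ × ℤ) : wt (n + m) ≤ wt n * wt m := by
  have h1 := abs_add_le (n.1 : ℝ) m.1
  have h2 := abs_add_le (n.2 : ℝ) m.2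
  simp only [wt, Prod.fst_add, Prod.snd_add, Int.cast_add]
  nlinarith [abs_nonneg (n.1 : ℝ), abs_nonneg (n.2 : ℝ), abs_nonneg (m.1 : ℝ),
    abs_nonneg (m.2 : ℝ), mul_nonneg (abs_nonneg (n.1 : ℝ)) (abs_nonneg (m.1 : ℝ)),
    mul_nonneg (abs_nonneg (n.2 : ℝ)) (abs_nonneg (m.1 : ℝ)),
    mul_nonneg (abs_nonneg (n.1 : ℝ)) (abs_nonneg (m.2 : ℝ)),
    mul_nonneg (abs_nonneg (n.2 : ℝ)) (abs_nonneg (m.2 : ℝ))]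

theorem summable_wt : Summable fun n : ℤ × ℤ => (wt n ^ 4)⁻¹ := by
  have h1 : Summable fun a : ℤ => ((1 + |(a : ℝ)|) ^ 2)⁻¹ := by
    -- The shift by `1/2` keeps the denominator away from zero at every integer, and `|a + 1/2| ≤ 1
    -- + |a|`.
    have h2 : Summable fun a : ℤ => 1 / |(a : ℝ) + 1 / 2| ^ (2 : ℝ) :=
      (Real.summable_one_div_int_add_rpow (1 / 2) 2).2 (by norm_num)
    refine Summable.of_nonneg_of_le (fun a => by positivity) (fun a => ?_) h2
    have h3 : 0 < |(a : ℝ) + 1 / 2| := by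
      rw [abs_pos]
      intro h
      have h4 : (2 * a + 1 : ℝ) = 0 := by linarith
      have h5 : 2 * a + 1 = 0 := by exact_mod_cast h4
      omega
    rw [one_div, Real.rpow_two]
    gcongr
    have := abs_add_le (a : ℝ) (1 / 2)
    rw [abs_of_pos (by norm_num : (0 : ℝ) < 1 / 2)] at this
    linarith
  have h2 := h1.mul_of_nonneg h1 (fun a => by positivity) (fun a => by positivity)
  refine Summable.of_nonneg_of_le (fun n => by have := wt_pos n; positivity) (fun n => ?_) h2
  rw [← mul_inv]
  have a1 := abs_nonneg (n.1 : ℝ)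
  have a2 := abs_nonneg (n.2 : ℝ)
  gcongr
  have h5 : (1 + |(n.1 : ℝ)|) * (1 + |(n.2 : ℝ)|) ≤ wt n ^ 2 := by
    rw [wt]; nlinarith
  calc _ = ((1 + |(n.1 : ℝ)|) * (1 + |(n.2 : ℝ)|)) ^ 2 := by ring
    _ ≤ (wt n ^ 2) ^ 2 := by gcongr
    _ = _ := by ring

theorem finite_wt_le (R : ℝ) : {n : ℤ × ℤ | wt n ≤ R}.Finite := by
  refine ((finite_Icc (-⌈R⌉) ⌈R⌉).prod (finite_Icc (-⌈R⌉) ⌈R⌉)).subset ?_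
  rintro ⟨a, b⟩ h
  have h' : 1 + |(a : ℝ)| + |(b : ℝ)| ≤ R := h
  have hR := Int.le_ceil R
  have ha : |(a : ℝ)| ≤ (⌈R⌉ : ℝ) := by linarith [abs_nonneg (b : ℝ)]
  have hb : |(b : ℝ)| ≤ (⌈R⌉ : ℝ) := by linarith [abs_nonneg (a : ℝ)]
  rw [abs_le] at ha hb
  exact ⟨⟨by exact_mod_cast ha.1, by exact_mod_cast ha.2⟩,
    ⟨by exact_mod_cast hb.1, by exact_mod_cast hb.2⟩⟩

/-! ### Fourier coefficients -/

theorem integral_cell_one_ne_zero : (∫ _ in cell, (1 : ℂ)) ≠ 0 := by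
  obtain ⟨J, hJ, h⟩ := setIntegral_cell
  rw [h]
  have h1 : (volume : Measure (ℝ × ℝ)).real (Icc ((0 : ℝ), (0 : ℝ)) (1, 1)) = 1 := by
    rw [← Icc_prod_Icc, Measure.real, Measure.volume_eq_prod, Measure.prod_prod]; simp
  rw [setIntegral_const, h1]
  simpa using hJ

/-- Fourier coefficients. -/
def coef (f : ℂ → ℂ) (n : ℤ × ℤ) : ℂ :=
  (∫ _ in cell, (1 : ℂ))⁻¹ * ∫ z in cell, f z * expo (-n) z

theorem integrableOn_cell_of_continuous {f : ℂ → ℂ} (hf : Continuous f) : IntegrableOn f cell := by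
  have := integrable_mul_cell (f := fun _ => 1) (ψ := f)
    (integrableOn_const volume_cell_lt_top.ne) hf
  simpa using this

theorem integral_expo {n : ℤ × ℤ} (hn : n ≠ 0) : ∫ z in cell, expo n z = 0 := by
  have h := integral_firstOrder_eq_zero (a := 1 / Complex.I) (b := 1) (W := expo n)
    (G := fun z => freq n * expo n z) (N := ∅) countable_empty (continuous_expo n)
    (expo_periodic n) (fun z _ => (hasFDerivAt_expo n z).differentiableAt)
    (continuous_const.mul (continuous_expo n)) (fun z _ => by
      rw [firstOrder_expo, freq_eq])
  rw [integral_const_mul] at h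
  refine (mul_eq_zero.1 h).resolve_left fun h0 => hn ?_
  have h1 := wt_le_norm_freq n
  rw [h0, norm_zero, wt] at h1
  have a1 := abs_nonneg (n.1 : ℝ)
  have a2 := abs_nonneg (n.2 : ℝ)
  have h2 : |(n.1 : ℝ)| = 0 := by linarith
  have h3 : |(n.2 : ℝ)| = 0 := by linarith
  rw [abs_eq_zero] at h2 h3
  exact Prod.ext (by exact_mod_cast h2) (by exact_mod_cast h3)

theorem freq_eq_zero {n : ℤ × ℤ} (h0 : freq n = 0) : n = 0 := by
  have h1 := wt_le_norm_freq n
  rw [h0, norm_zero, wt] at h1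
  have a1 := abs_nonneg (n.1 : ℝ)
  have a2 := abs_nonneg (n.2 : ℝ)
  have h2 : |(n.1 : ℝ)| = 0 := by linarith
  have h3 : |(n.2 : ℝ)| = 0 := by linarith
  rw [abs_eq_zero] at h2 h3
  exact Prod.ext (by exact_mod_cast h2) (by exact_mod_cast h3)

theorem coef_one (n : ℤ × ℤ) : coef (fun _ => 1) n = if n = 0 then 1 else 0 := by
  split_ifs with h
  · subst h
    simp only [coef, neg_zero, expo_zero, mul_one]
    exact inv_mul_cancel₀ integral_cell_one_ne_zero
  · simp only [coef, one_mul]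
    rw [integral_expo (neg_ne_zero.2 h), mul_zero]

theorem coef_const_mul (c : ℂ) (f : ℂ → ℂ) (n : ℤ × ℤ) :
    coef (fun z => c * f z) n = c * coef f n := by
  simp only [coef, mul_assoc]
  rw [integral_const_mul]
  ring

theorem coef_add {f g : ℂ → ℂ} (hf : IntegrableOn f cell) (hg : IntegrableOn g cell)
    (n : ℤ × ℤ) : coef (fun z => f z + g z) n = coef f n + coef g n := by
  simp only [coef, add_mul]
  rw [integral_add (integrable_mul_cell hf (continuous_expo _))
    (integrable_mul_cell hg (continuous_expo _)), mul_add]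

theorem norm_coef_le {f : ℂ → ℂ} : ∃ C, ∀ n, ‖coef f n‖ ≤ C := by
  refine ⟨‖(∫ _ in cell, (1 : ℂ))⁻¹‖ * ∫ z in cell, ‖f z‖, fun n => ?_⟩
  rw [coef, norm_mul]
  gcongr
  refine (norm_integral_le_integral_norm _).trans (le_of_eq ?_)
  simp [norm_expo]

/-- Testing against the character of index `-n` diagonalizes the operator, so a weak equation
becomes one scalar equation per frequency. -/
theorem coef_of_weakEq {k : ℂ} {a b : ℂ} {f g : ℂ → ℂ}
    (h : WeakEq (firstOrder a b) k f g) (n : ℤ × ℤ) :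
    (k + (a * freq1 n + b * freq2 n)) * coef f n = coef g n := by
  have := h _ (isTest_expo (-n))
  have e : ∀ z, f z * (k * expo (-n) z - firstOrder a b (expo (-n)) z) =
      (k + (a * freq1 n + b * freq2 n)) * (f z * expo (-n) z) := by
    intro z
    rw [firstOrder_expo, freq1_neg, freq2_neg]; ring
  simp only [e] at this
  rw [integral_const_mul] at this
  rw [coef, coef, ← this]
  ring

theorem coef_of_weakEq_twoDzbar {k : ℂ} {f g : ℂ → ℂ} (h : WeakEq twoDzbar k f g) (n : ℤ × ℤ) : (k + freq n) * coef f n = coef g n := by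
  rw [twoDzbar_eq_firstOrder] at h
  rw [← freq_eq]
  exact coef_of_weakEq h n

/-! ### Fourier series -/

/-- The function with given Fourier coefficients. -/
def series (a : ℤ × ℤ → ℂ) (z : ℂ) : ℂ := ∑' n, a n * expo n z

theorem periodic_series (a : ℤ × ℤ → ℂ) : Periodic (series a) := fun γ hγ z => by
  simp only [series, expo_periodic _ γ hγ]

theorem summable_series {a : ℤ × ℤ → ℂ} (ha : Summable fun n => ‖a n‖) (z : ℂ) :
    Summable fun n => a n * expo n z :=
  Summable.of_norm (by simpa [norm_expo] using ha)

theorem continuous_series {a : ℤ × ℤ → ℂ} (ha : Summable fun n => ‖a n‖) :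
    Continuous (series a) :=
  continuous_tsum (fun n => continuous_const.mul (continuous_expo n)) ha
    (fun n z => by simp [norm_expo])

theorem coef_series_mul {a : ℤ × ℤ → ℂ} (ha : Summable fun n => ‖a n‖) {u : ℂ → ℂ}
    (hu : IntegrableOn u cell) (n : ℤ × ℤ) :
    coef (fun z => series a z * u z) n = ∑' m, a m * coef u (n - m) := by
  have h := hasSum_integral_of_summable_integral_norm (μ := volume.restrict cell)
    (F := fun m z => a m * (u z * expo (-(n - m)) z))
    (fun m => (integrable_mul_cell hu (continuous_expo _)).const_mul _) (by
      simp only [norm_mul, norm_expo, mul_one, integral_const_mul]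
      exact ha.mul_right _)
  simp only [integral_const_mul] at h
  simp only [coef]
  have e : ∀ m, a m * ((∫ _ in cell, (1 : ℂ))⁻¹ * ∫ z in cell, u z * expo (-(n - m)) z) =
      (∫ _ in cell, (1 : ℂ))⁻¹ * (a m * ∫ z in cell, u z * expo (-(n - m)) z) :=
    fun m => by ring
  rw [tsum_congr e, tsum_mul_left, h.tsum_eq]
  congr 1
  apply integral_congr_ae
  refine Eventually.of_forall fun z => ?_
  simp only [series]
  rw [mul_assoc, ← tsum_mul_right]
  refine tsum_congr fun m => ?_
  rw [neg_sub, sub_eq_add_neg, expo_add]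
  ring

theorem coef_series {a : ℤ × ℤ → ℂ} (ha : Summable fun n => ‖a n‖) (n : ℤ × ℤ) :
    coef (series a) n = a n := by
  have h := coef_series_mul ha (u := fun _ => 1) (integrableOn_const volume_cell_lt_top.ne) n
  simp only [mul_one, coef_one] at h
  rw [h, tsum_eq_single n]
  · simp
  · intro m hm
    rw [if_neg (sub_ne_zero.2 hm.symm), mul_zero]

/-- Rapidly decaying sequences. -/
def Rapid (a : ℤ × ℤ → ℂ) : Prop := ∀ N : ℕ, ∃ C, ∀ n, wt n ^ N * ‖a n‖ ≤ C

theorem Rapid.summable_pow {a : ℤ × ℤ → ℂ} (ha : Rapid a) (N : ℕ) :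
    Summable fun n => wt n ^ N * ‖a n‖ := by
  obtain ⟨C, hC⟩ := ha (N + 4)
  refine Summable.of_nonneg_of_le (fun n => by have := wt_pos n; positivity) (fun n => ?_)
    (summable_wt.mul_left C)
  have h := wt_pos n
  rw [← div_eq_mul_inv, le_div_iff₀ (by positivity)]
  refine le_trans (le_of_eq ?_) (hC n)
  ring

theorem Rapid.summable {a : ℤ × ℤ → ℂ} (ha : Rapid a) : Summable fun n => ‖a n‖ := by
  simpa using ha.summable_pow 0

/-- A symbol of order one costs one power of the weight; this is what permits term by term
differentiation to any order. -/
theorem Rapid.mul_of_le {a c : ℤ × ℤ → ℂ} {C : ℝ} (ha : Rapid a)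
    (hc : ∀ n, ‖c n‖ ≤ C * wt n) : Rapid fun n => c n * a n := by
  intro N
  obtain ⟨C', hC'⟩ := ha (N + 1)
  have hC0 : 0 ≤ C := by
    have := (norm_nonneg _).trans (hc 0)
    exact nonneg_of_mul_nonneg_left this (wt_pos 0)
  refine ⟨C * C', fun n => ?_⟩
  have h := wt_pos n
  rw [norm_mul]
  calc wt n ^ N * (‖c n‖ * ‖a n‖) ≤ wt n ^ N * ((C * wt n) * ‖a n‖) := by
        gcongr; exact hc n
    _ = C * (wt n ^ (N + 1) * ‖a n‖) := by ring
    _ ≤ C * C' := by gcongr; exact hC' n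

theorem hasFDerivAt_series {a : ℤ × ℤ → ℂ} (ha : Rapid a) (z : ℂ) :
    HasFDerivAt (series a)
      (series (fun n => freq1 n * a n) z • (Complex.ofRealCLM.comp Complex.reCLM) +
        series (fun n => freq2 n * a n) z • (Complex.ofRealCLM.comp Complex.imCLM)
          : ℂ →L[ℝ] ℂ) z := by
  have r1 := ha.mul_of_le fun n => (norm_freq12_le n).1
  have r2 := ha.mul_of_le fun n => (norm_freq12_le n).2
  have h := hasFDerivAt_tsum (𝕜 := ℝ) (u := fun n => ‖freq1 n * a n‖ + ‖freq2 n * a n‖)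
    (f := fun n z => a n * expo n z)
    (f' := fun n z => a n • (expo n z • (freq1 n • (Complex.ofRealCLM.comp Complex.reCLM) +
      freq2 n • (Complex.ofRealCLM.comp Complex.imCLM) : ℂ →L[ℝ] ℂ))) (x₀ := 0)
    (r1.summable.add r2.summable) (fun n z => (hasFDerivAt_expo n z).const_mul (a n))
    (fun n z => by
      refine ContinuousLinearMap.opNorm_le_bound _ (by positivity) fun w => ?_
      have e1 := Complex.abs_re_le_norm w
      have e2 := Complex.abs_im_le_norm w
      have : (a n • (expo n z • (freq1 n • (Complex.ofRealCLM.comp Complex.reCLM) +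
          freq2 n • (Complex.ofRealCLM.comp Complex.imCLM) : ℂ →L[ℝ] ℂ))) w =
          expo n z * ((freq1 n * a n) * w.re + (freq2 n * a n) * w.im) := by
        simp; ring
      rw [this, norm_mul, norm_expo, one_mul]
      refine (norm_add_le _ _).trans ?_
      rw [norm_mul, norm_mul _ (w.im : ℂ), Complex.norm_real, Complex.norm_real, add_mul]
      gcongr
      · exact e1
      · exact e2) (summable_series ha.summable 0) z
  convert! h using 1
  ext w
  have s1 := summable_series r1.summable z
  have s2 := summable_series r2.summable z
  have hs : HasSum (fun n => (a n • (expo n z • (freq1 n • (Complex.ofRealCLM.comp Complex.reCLM) +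
      freq2 n • (Complex.ofRealCLM.comp Complex.imCLM) : ℂ →L[ℝ] ℂ))))
      (series (fun n => freq1 n * a n) z • (Complex.ofRealCLM.comp Complex.reCLM) +
        series (fun n => freq2 n * a n) z • (Complex.ofRealCLM.comp Complex.imCLM)
          : ℂ →L[ℝ] ℂ) := by
    have t1 := s1.hasSum.smul_const (Complex.ofRealCLM.comp Complex.reCLM : ℂ →L[ℝ] ℂ)
    have t2 := s2.hasSum.smul_const (Complex.ofRealCLM.comp Complex.imCLM : ℂ →L[ℝ] ℂ)
    refine (t1.add t2).congr_fun fun n => ?_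
    ext w
    simp
    ring
  rw [hs.tsum_eq]

theorem contDiff_series {a : ℤ × ℤ → ℂ} (ha : Rapid a) : ContDiff ℝ (⊤ : ℕ∞) (series a) := by
  rw [contDiff_infty]
  intro N
  induction N generalizing a with
  | zero => exact contDiff_zero.2 (continuous_series ha.summable)
  | succ N ih =>
    push_cast
    rw [contDiff_succ_iff_fderiv]
    refine ⟨fun z => (hasFDerivAt_series ha z).differentiableAt, by simp, ?_⟩
    have : fderiv ℝ (series a) = fun z =>
      (series (fun n => freq1 n * a n) z • (Complex.ofRealCLM.comp Complex.reCLM) +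
        series (fun n => freq2 n * a n) z • (Complex.ofRealCLM.comp Complex.imCLM)
          : ℂ →L[ℝ] ℂ) := funext fun z => (hasFDerivAt_series ha z).fderiv
    rw [this]
    exact ((ih (ha.mul_of_le fun n => (norm_freq12_le n).1)).smul contDiff_const).add
      ((ih (ha.mul_of_le fun n => (norm_freq12_le n).2)).smul contDiff_const)

theorem isTest_series {a : ℤ × ℤ → ℂ} (ha : Rapid a) : IsTest (series a) :=
  ⟨contDiff_series ha, periodic_series a⟩

theorem IsTest.continuous {φ : ℂ → ℂ} (h : IsTest φ) : Continuous φ := h.1.continuous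

theorem IsTest.periodic {φ : ℂ → ℂ} (h : IsTest φ) : Periodic φ := h.2

theorem IsTest.differentiable {φ : ℂ → ℂ} (h : IsTest φ) : Differentiable ℝ φ :=
  h.1.differentiable (by simp)

theorem fderiv_periodic {f : ℂ → ℂ} (h : Periodic f) {γ : ℂ} (hγ : γ ∈ lattice) (z : ℂ) :
    fderiv ℝ f (z + γ) = fderiv ℝ f z := by
  have : (fun w => f (w + γ)) = f := funext (h γ hγ)
  rw [← fderiv_comp_add_right, this]

theorem IsTest.firstOrder {φ : ℂ → ℂ} (h : IsTest φ) (a b : ℂ) : IsTest (firstOrder a b φ) := by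
  have hd : ContDiff ℝ (⊤ : ℕ∞) (fderiv ℝ φ) := h.1.fderiv_right (by simp)
  refine ⟨?_, fun γ hγ z => ?_⟩
  · exact (contDiff_const.mul (hd.clm_apply contDiff_const)).add
      (contDiff_const.mul (hd.clm_apply contDiff_const))
  · simp only [ScalarModel.firstOrder, dx1, dx2, fderiv_periodic h.2 hγ]

theorem IsTest.weakEq {φ : ℂ → ℂ} (h : IsTest φ) (a b k : ℂ) :
    WeakEq (ScalarModel.firstOrder a b) k φ
      (fun z => ScalarModel.firstOrder a b φ z + k * φ z) :=
  weakEq_of_pointwise (N := ∅) countable_empty h.continuous h.periodic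
    (fun z _ => h.differentiable z)
    ((h.firstOrder a b).continuous.add (continuous_const.mul h.continuous)) (fun _ _ => rfl)

/-- Applying `2D_{z̄}` multiplies coefficients by `freq n`, so bounded coefficients of all iterated
derivatives give every power of decay. -/
theorem IsTest.rapid {φ : ℂ → ℂ} (h : IsTest φ) : Rapid (coef φ) := by
  intro N
  induction N generalizing φ with
  | zero => simpa using norm_coef_le (f := φ)
  | succ N ih =>
    obtain ⟨C, hC⟩ := ih h
    obtain ⟨C', hC'⟩ := ih (h.firstOrder (1 / Complex.I) 1)
    refine ⟨C + C', fun n => ?_⟩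
    have e := coef_of_weakEq (h.weakEq (1 / Complex.I) 1 0) n
    rw [freq_eq, zero_add] at e
    simp only [zero_mul, add_zero] at e
    have h1 := wt_pos n
    calc wt n ^ (N + 1) * ‖coef φ n‖ = wt n ^ N * (wt n * ‖coef φ n‖) := by ring
      _ ≤ wt n ^ N * ((1 + ‖freq n‖) * ‖coef φ n‖) := by gcongr; exact wt_le_norm_freq n
      _ = wt n ^ N * ‖coef φ n‖ + wt n ^ N * ‖freq n * coef φ n‖ := by rw [norm_mul]; ring
      _ ≤ C + C' := by rw [e]; exact add_le_add (hC n) (hC' n)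

/-! ### Injectivity of the Fourier coefficients -/

section Torus

-- The probability Haar measure, for which the characters of the torus are orthonormal.
local instance : MeasureSpace UnitAddCircle := ⟨AddCircle.haarAddCircle⟩

/-- The linear coordinates on `ℂ` with values indexed by `Fin 2`. -/
def parPi : (Fin 2 → ℝ) ≃ᵐ ℂ := MeasurableEquiv.finTwoArrow.trans par.toHomeomorph.toMeasurableEquiv

/-- The measurable section of the covering `ℂ → ℂ/Λ`. -/
def torusSection (x : UnitAddTorus (Fin 2)) : ℂ :=
  parPi (UnitAddTorus.measurableEquivPiIoc (fun _ => 0) x).1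

theorem parPi_apply (x : Fin 2 → ℝ) : parPi x = par (x 0, x 1) := rfl

theorem measurableSet_piIoc : MeasurableSet {x : Fin 2 → ℝ | ∀ i, x i ∈ Ioc (0 : ℝ) (0 + 1)} :=
  MeasurableSet.univ_pi' fun _ => measurableSet_Ioc

theorem measurableEmbedding_torusSection : MeasurableEmbedding torusSection :=
  parPi.measurableEmbedding.comp ((MeasurableEmbedding.subtype_coe measurableSet_piIoc).comp
    (UnitAddTorus.measurableEquivPiIoc (fun _ => (0 : ℝ))).measurableEmbedding)

/-- The section identifies the torus with a half-open parallelogram that agrees with the cell up to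
a null set, so Haar measure on the torus becomes area on the cell up to a constant. -/
theorem map_torusSection : ∃ c : NNReal, c ≠ 0 ∧
    (volume : Measure ℂ).restrict cell = c • Measure.map torusSection volume := by
  obtain ⟨c, hc, h⟩ := map_par_volume
  refine ⟨c, hc, ?_⟩
  have h1 : Measure.map torusSection volume = Measure.map parPi
      (Measure.map Subtype.val (Measure.map
        (UnitAddTorus.measurableEquivPiIoc (fun _ : Fin 2 => (0 : ℝ))) volume)) := by
    rw [Measure.map_map measurable_subtype_coe (MeasurableEquiv.measurable _),
      Measure.map_map parPi.measurable (measurable_subtype_coe.comp (MeasurableEquiv.measurable _))]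
    rfl
  have h2 := (UnitAddTorus.measurePreserving_equivPiIoc (fun _ : Fin 2 => (0 : ℝ))).map_eq
  have h3 : Measure.map parPi ((volume : Measure (Fin 2 → ℝ)).restrict
      {x : Fin 2 → ℝ | ∀ i, x i ∈ Ioc (0 : ℝ) (0 + 1)}) =
      Measure.map par ((volume : Measure (ℝ × ℝ)).restrict (Ioc 0 1 ×ˢ Ioc 0 1)) := by
    have h4 := ((volume_preserving_finTwoArrow ℝ).restrict_preimage
      ((measurableSet_Ioc (a := (0 : ℝ)) (b := 1)).prod (measurableSet_Ioc (a := (0 : ℝ)) (b := 1)))).map_eq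
    rw [← h4, Measure.map_map par.continuous.measurable (MeasurableEquiv.measurable _)]
    congr 2
    ext x
    simp [Fin.forall_fin_two]
  have h5 : (Ioc (0 : ℝ) 1 ×ˢ Ioc (0 : ℝ) 1 : Set (ℝ × ℝ)) =ᵐ[volume]
      (Ico (0 : ℝ) 1 ×ˢ Ico (0 : ℝ) 1 : Set (ℝ × ℝ)) :=
    Measure.set_prod_ae_eq Ico_ae_eq_Ioc.symm Ico_ae_eq_Ioc.symm
  have h6 : Measure.map torusSection volume = Measure.map parPi ((volume : Measure (Fin 2 → ℝ)).restrict
      {x : Fin 2 → ℝ | ∀ i, x i ∈ Ioc (0 : ℝ) (0 + 1)}) := by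
    rw [h1, h2]
    exact congrArg (Measure.map parPi) (map_comap_subtype_coe measurableSet_piIoc volume)
  rw [h6, h3, Measure.restrict_congr_set h5,
    ← preimage_cell, ← Measure.restrict_map par.continuous.measurable measurableSet_cell]
  conv_lhs => rw [h]
  rw [Measure.restrict_smul]

theorem mFourier_eq_expo (n : Fin 2 → ℤ) (x : UnitAddTorus (Fin 2)) :
    UnitAddTorus.mFourier n x = expo (n 0, n 1) (torusSection x) := by
  set y := UnitAddTorus.measurableEquivPiIoc (fun _ => (0 : ℝ)) x with hy
  have hx : x = fun i => ((y.1 i : ℝ) : UnitAddCircle) := by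
    have := (UnitAddTorus.measurableEquivPiIoc (fun _ : Fin 2 => (0 : ℝ))).symm_apply_apply x
    rw [UnitAddTorus.coe_symm_measurableEquivPiIoc_apply] at this
    exact this.symm
  conv_lhs => rw [hx]
  rw [torusSection, ← hy, parPi_apply, expo, phase_par]
  simp only [UnitAddTorus.mFourier, ContinuousMap.coe_mk, Fin.prod_univ_two, fourier_coe_apply]
  rw [← Complex.exp_add]
  congr 1
  push_cast
  ring

/-- Completeness of the Fourier basis of `L²` of the standard torus, transported to the cell by
`torusSection`. -/
theorem ae_eq_zero_of_coef_eq_zero {f : ℂ → ℂ} (hf : MemLp f 2 (volume.restrict cell))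
    (h : ∀ n, coef f n = 0) : f =ᵐ[volume.restrict cell] 0 := by
  obtain ⟨c, hc, hm⟩ := map_torusSection
  have he := measurableEmbedding_torusSection
  have hm' : Measure.map torusSection volume = c⁻¹ • (volume : Measure ℂ).restrict cell := by
    rw [hm, smul_smul, inv_mul_cancel₀ hc, one_smul]
  have hg : MemLp (f ∘ torusSection) 2 volume := by
    rw [← he.memLp_map_measure_iff, hm']
    exact hf.smul_measure (by simp)
  have hcoef (n : Fin 2 → ℤ) : UnitAddTorus.mFourierCoeff (f ∘ torusSection) n = 0 := by
    have h1 := h (n 0, n 1)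
    rw [coef, mul_eq_zero, inv_eq_zero] at h1
    have h2 := h1.resolve_left integral_cell_one_ne_zero
    rw [UnitAddTorus.mFourierCoeff]
    simp only [mFourier_eq_expo, Function.comp_apply, smul_eq_mul, Pi.neg_apply]
    rw [← he.integral_map (μ := volume)
      (fun z => expo (-n 0, -n 1) z * f z), hm', integral_smul_nnreal_measure]
    have h3 : ∀ z, expo (-n 0, -n 1) z * f z = f z * expo (-(n 0, n 1)) z := fun z => mul_comm _ _
    simp only [h3, h2, smul_zero]
  have h0 : hg.toLp = 0 := by
    apply UnitAddTorus.mFourierBasis.repr.injective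
    ext n
    rw [UnitAddTorus.mFourierBasis_repr, map_zero]
    refine (integral_congr_ae ?_).trans (hcoef n)
    filter_upwards [hg.coeFn_toLp] with x hx
    rw [hx]
  have h1 : f ∘ torusSection =ᵐ[volume] 0 := by
    have := hg.coeFn_toLp
    rw [h0] at this
    exact this.symm.trans (Lp.coeFn_zero _ _ _)
  rw [hm]
  have h2 : ∀ᵐ z ∂(Measure.map torusSection volume), f z = 0 := by
    rw [he.ae_map_iff]; exact h1
  exact (Measure.AbsolutelyContinuous.rfl.smul_left c).ae_le h2

end Torus

/-! ### Fourier uniqueness and inversion for periodic functions -/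

theorem memLp_cell_of_continuous {f : ℂ → ℂ} (hf : Continuous f) :
    MemLp f 2 (volume.restrict cell) := by
  have : IsFiniteMeasure (volume.restrict cell) :=
    ⟨by rw [Measure.restrict_apply_univ]; exact volume_cell_lt_top⟩
  obtain ⟨C, hC⟩ := exists_bound_cell hf
  exact MemLp.of_bound hf.aestronglyMeasurable C
    ((ae_restrict_iff' measurableSet_cell).2 (Eventually.of_forall hC))

theorem integrableOn_cell_of_memLp {f : ℂ → ℂ} (hf : MemLp f 2 (volume.restrict cell)) :
    IntegrableOn f cell := by
  have : IsFiniteMeasure (volume.restrict cell) :=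
    ⟨by rw [Measure.restrict_apply_univ]; exact volume_cell_lt_top⟩
  exact hf.integrable (by norm_num)

theorem ae_eq_of_coef_eq {f g : ℂ → ℂ} (hf : MemLp f 2 (volume.restrict cell))
    (hg : MemLp g 2 (volume.restrict cell)) (hf' : AEPeriodic f) (hg' : AEPeriodic g)
    (h : ∀ n, coef f n = coef g n) : f =ᵐ[volume] g := by
  refine hf'.ae_eq hg' ?_
  have h0 := ae_eq_zero_of_coef_eq_zero (hf.sub hg) fun n => by
    have h1 := coef_add (integrableOn_cell_of_memLp hf)
      ((integrableOn_cell_of_memLp hg).const_mul (-1)) n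
    rw [coef_const_mul, h] at h1
    refine Eq.trans ?_ (h1.trans (by ring))
    congr 1
    ext z
    simp [sub_eq_add_neg]
  filter_upwards [h0] with z hz
  exact sub_eq_zero.1 hz

theorem eq_of_coef_eq {f g : ℂ → ℂ} (hf : Continuous f) (hg : Continuous g) (hf' : Periodic f)
    (hg' : Periodic g) (h : ∀ n, coef f n = coef g n) : f = g :=
  Measure.eq_of_ae_eq (ae_eq_of_coef_eq (memLp_cell_of_continuous hf) (memLp_cell_of_continuous hg)
    hf'.aePeriodic hg'.aePeriodic h) hf hg

theorem IsTest.series_coef {φ : ℂ → ℂ} (h : IsTest φ) : series (coef φ) = φ :=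
  eq_of_coef_eq (continuous_series h.rapid.summable) h.continuous (periodic_series _) h.periodic
    fun n => coef_series h.rapid.summable n

theorem IsTest.coef_mul {φ u : ℂ → ℂ} (h : IsTest φ) (hu : IntegrableOn u cell) (n : ℤ × ℤ) :
    coef (fun z => φ z * u z) n = ∑' m, coef φ m * coef u (n - m) := by
  rw [← coef_series_mul h.rapid.summable hu, h.series_coef]

theorem twoDzbar_series {a : ℤ × ℤ → ℂ} (ha : Rapid a) (z : ℂ) :
    twoDzbar (series a) z = series (fun n => freq n * a n) z := by
  have r1 := ha.mul_of_le fun n => (norm_freq12_le n).1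
  have r2 := ha.mul_of_le fun n => (norm_freq12_le n).2
  rw [twoDzbar_eq_firstOrder, firstOrder, dx1, dx2, (hasFDerivAt_series ha z).fderiv]
  simp only [series, _root_.add_apply, _root_.smul_apply, ContinuousLinearMap.comp_apply,
    Complex.reCLM_apply, Complex.imCLM_apply, Complex.one_re, Complex.one_im, Complex.I_re,
    Complex.I_im, Complex.ofRealCLM_apply, Complex.ofReal_one, Complex.ofReal_zero, smul_eq_mul,
    mul_one, mul_zero, add_zero, zero_add]
  rw [← tsum_mul_left, ← tsum_mul_left, ← ((summable_series r1.summable z).mul_left _).tsum_add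
    ((summable_series r2.summable z).mul_left _)]
  refine tsum_congr fun n => ?_
  rw [← freq_eq]
  ring

/-- Solvability of `(2D_{z̄} + κ) g = h`. -/
theorem IsTest.exists_solution {h : ℂ → ℂ} (hh : IsTest h) (κ : ℂ)
    (h0 : ∀ n, freq n + κ = 0 → coef h n = 0) :
    ∃ g, IsTest g ∧ ∀ z, twoDzbar g z + κ * g z = h z := by
  -- Only finitely many divisors are small, so their inverses are uniformly bounded, zero divisors
  -- contributing `0⁻¹ = 0`.
  have hfin : {n : ℤ × ℤ | ‖freq n + κ‖ ≤ 1}.Finite := by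
    refine (finite_wt_le (2 + ‖κ‖)).subset fun n (hn : ‖freq n + κ‖ ≤ 1) => ?_
    have h1 := wt_le_norm_freq n
    have h2 := norm_sub_le (freq n + κ) κ
    rw [add_sub_cancel_right] at h2
    show wt n ≤ _
    linarith
  obtain ⟨C, hC⟩ : ∃ C, ∀ n, ‖(freq n + κ)⁻¹‖ ≤ C := by
    obtain ⟨C, hC⟩ := (hfin.image fun n => ‖(freq n + κ)⁻¹‖).bddAbove
    refine ⟨max C 1, fun n => ?_⟩
    by_cases hn : ‖freq n + κ‖ ≤ 1
    · exact le_max_of_le_left (hC ⟨n, hn, rfl⟩)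
    · rw [norm_inv]
      exact le_max_of_le_right (inv_le_one_of_one_le₀ (not_le.1 hn).le)
  have hC0 : 0 ≤ C := (norm_nonneg _).trans (hC 0)
  have hr : Rapid fun n => (freq n + κ)⁻¹ * coef h n :=
    hh.rapid.mul_of_le (C := C) fun n =>
      (hC n).trans (le_mul_of_one_le_right hC0 (one_le_wt n))
  have hr' : Rapid fun n => freq n * ((freq n + κ)⁻¹ * coef h n) :=
    hr.mul_of_le (C := 28) fun n => by
      rw [← freq_eq]
      refine (norm_add_le _ _).trans ?_
      have h1 := (norm_freq12_le n).1
      have h2 := (norm_freq12_le n).2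
      simp only [norm_mul, norm_div, Complex.norm_I, norm_one, one_mul, div_one]
      linarith
  refine ⟨series fun n => (freq n + κ)⁻¹ * coef h n, isTest_series hr, fun z => ?_⟩
  rw [twoDzbar_series hr]
  conv_rhs => rw [← hh.series_coef]
  simp only [series]
  rw [← tsum_mul_left, ← (summable_series hr'.summable z).tsum_add
    ((summable_series hr.summable z).mul_left _)]
  refine tsum_congr fun n => ?_
  -- At a resonant frequency the left side vanishes, and so does the coefficient of `h` by the
  -- solvability condition.
  by_cases hn : freq n + κ = 0
  · simp [h0 n hn]
  · field_simp

/-! ### Regularity of weak solutions -/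

/-- The weight is submultiplicative, so a polynomial bound on `a` survives convolution with rapidly
decaying coefficients. -/
theorem Rapid.bounded_conv {v a : ℤ × ℤ → ℂ} (hv : Rapid v) (N : ℕ)
    (hN : ∃ C, ∀ n, wt n ^ N * ‖a n‖ ≤ C) :
    ∃ C, ∀ n, wt n ^ N * ‖∑' m, v m * a (n - m)‖ ≤ C := by
  obtain ⟨C, hC⟩ := hN
  have hs := hv.summable_pow N
  refine ⟨∑' m, wt m ^ N * ‖v m‖ * C, fun n => ?_⟩
  have hle (m : ℤ × ℤ) : ‖(wt n ^ N : ℝ) • (v m * a (n - m))‖ ≤ wt m ^ N * ‖v m‖ * C := by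
    have h1 := wt_pos n
    have h2 := wt_pos m
    have h3 := wt_pos (n - m)
    rw [norm_smul, norm_mul, Real.norm_eq_abs, abs_of_pos (by positivity)]
    have h4 : wt n ≤ wt m * wt (n - m) := by
      have := wt_add_le m (n - m)
      rwa [add_sub_cancel] at this
    calc wt n ^ N * (‖v m‖ * ‖a (n - m)‖)
        ≤ (wt m * wt (n - m)) ^ N * (‖v m‖ * ‖a (n - m)‖) := by gcongr
      _ = wt m ^ N * ‖v m‖ * (wt (n - m) ^ N * ‖a (n - m)‖) := by ring
      _ ≤ _ := by gcongr; exact hC _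
  have := tsum_of_norm_bounded (hs.mul_right C).hasSum hle
  rwa [tsum_const_smul'', norm_smul, Real.norm_eq_abs,
    abs_of_pos (pow_pos (wt_pos n) N)] at this

theorem bounded_coef_mul {φ u : ℂ → ℂ} (h : IsTest φ) (hu : IntegrableOn u cell) (N : ℕ)
    (hN : ∃ C, ∀ n, wt n ^ N * ‖coef u n‖ ≤ C) :
    ∃ C, ∀ n, wt n ^ N * ‖coef (fun z => φ z * u z) n‖ ≤ C := by
  simp only [h.coef_mul hu]
  exact h.rapid.bounded_conv N hN

/-- The elliptic estimate: inverting `k + freq n` gains one power of the weight. -/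
theorem bounded_of_weakEq {k : ℂ} {f g : ℂ → ℂ} (h : WeakEq twoDzbar k f g) (N : ℕ)
    (hf : ∃ C, ∀ n, wt n ^ N * ‖coef f n‖ ≤ C) (hg : ∃ C, ∀ n, wt n ^ N * ‖coef g n‖ ≤ C) :
    ∃ C, ∀ n, wt n ^ (N + 1) * ‖coef f n‖ ≤ C := by
  obtain ⟨C, hC⟩ := hf
  obtain ⟨C', hC'⟩ := hg
  refine ⟨(1 + ‖k‖) * C + C', fun n => ?_⟩
  have e := coef_of_weakEq_twoDzbar h n
  have h1 := wt_pos n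
  have h2 : ‖freq n‖ ≤ ‖k + freq n‖ + ‖k‖ := by
    have := norm_sub_le (k + freq n) k
    rwa [add_sub_cancel_left] at this
  have h3 := wt_le_norm_freq n
  calc wt n ^ (N + 1) * ‖coef f n‖ = wt n * (wt n ^ N * ‖coef f n‖) := by ring
    _ ≤ ((1 + ‖k‖) + ‖k + freq n‖) * (wt n ^ N * ‖coef f n‖) := by gcongr; linarith
    _ = (1 + ‖k‖) * (wt n ^ N * ‖coef f n‖) + wt n ^ N * ‖(k + freq n) * coef f n‖ := by
      rw [norm_mul]; ring
    _ ≤ _ := by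
      rw [e]
      have := hC n
      have := hC' n
      gcongr

theorem exists_isTest_of_rapid {f : ℂ → ℂ} (hf : MemLp f 2 (volume.restrict cell))
    (hf' : AEPeriodic f) (h : Rapid (coef f)) : ∃ s, IsTest s ∧ f =ᵐ[volume] s :=
  ⟨series (coef f), isTest_series h, ae_eq_of_coef_eq hf
    (memLp_cell_of_continuous (isTest_series h).continuous) hf' (isTest_series h).periodic.aePeriodic
    fun n => (coef_series h.summable n).symm⟩

theorem eq_of_weakEq_isTest {k : ℂ} {f g : ℂ → ℂ} (hf : IsTest f) (hg : IsTest g)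
    (h : WeakEq twoDzbar k f g) (z : ℂ) : twoDzbar f z + k * f z = g z := by
  rw [twoDzbar_eq_firstOrder] at h ⊢
  have h1 := hf.firstOrder (1 / Complex.I) 1
  have hc : Continuous fun z => firstOrder (1 / Complex.I) 1 f z + k * f z :=
    h1.continuous.add (continuous_const.mul hf.continuous)
  refine congrFun (eq_of_coef_eq hc hg.continuous (fun γ hγ z => ?_) hg.periodic fun n => ?_) z
  · rw [h1.2 γ hγ, hf.2 γ hγ]
  · rw [← coef_of_weakEq h, ← coef_of_weakEq (hf.weakEq (1 / Complex.I) 1 k)]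

/-- Weak solutions of a first order system with smooth coefficients are smooth. -/
theorem exists_smooth_of_weakEq {k : ℂ} {c₁ c₂ f₁ f₂ : ℂ → ℂ} (hc₁ : IsTest c₁) (hc₂ : IsTest c₂)
    (h₁ : MemLp f₁ 2 (volume.restrict cell)) (h₂ : MemLp f₂ 2 (volume.restrict cell))
    (p₁ : AEPeriodic f₁) (p₂ : AEPeriodic f₂)
    (w₁ : WeakEq twoDzbar k f₁ (fun z => c₁ z * f₂ z))
    (w₂ : WeakEq twoDzbar k f₂ (fun z => c₂ z * f₁ z)) :
    ∃ s₁ s₂, IsTest s₁ ∧ IsTest s₂ ∧ f₁ =ᵐ[volume] s₁ ∧ f₂ =ᵐ[volume] s₂ ∧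
      (∀ z, twoDzbar s₁ z + k * s₁ z = c₁ z * s₂ z) ∧
      (∀ z, twoDzbar s₂ z + k * s₂ z = c₂ z * s₁ z) := by
  -- Bootstrap: multiplication by the smooth coefficients loses nothing and each use of the
  -- equations gains one power, for both components at once.
  have key (N : ℕ) : (∃ C, ∀ n, wt n ^ N * ‖coef f₁ n‖ ≤ C) ∧
      (∃ C, ∀ n, wt n ^ N * ‖coef f₂ n‖ ≤ C) := by
    induction N with
    | zero =>
      simp only [pow_zero, one_mul]
      exact ⟨norm_coef_le, norm_coef_le⟩
    | succ N ih =>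
      exact ⟨bounded_of_weakEq w₁ N ih.1 (bounded_coef_mul hc₁ (integrableOn_cell_of_memLp h₂) N ih.2),
        bounded_of_weakEq w₂ N ih.2 (bounded_coef_mul hc₂ (integrableOn_cell_of_memLp h₁) N ih.1)⟩
  obtain ⟨s₁, t₁, e₁⟩ := exists_isTest_of_rapid h₁ p₁ fun N => (key N).1
  obtain ⟨s₂, t₂, e₂⟩ := exists_isTest_of_rapid h₂ p₂ fun N => (key N).2
  have tm {f g : ℂ → ℂ} (hf : IsTest f) (hg : IsTest g) : IsTest fun z => f z * g z :=
    ⟨hf.1.mul hg.1, fun γ hγ z => by simp only [hf.2 γ hγ, hg.2 γ hγ]⟩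
  refine ⟨s₁, s₂, t₁, t₂, e₁, e₂, eq_of_weakEq_isTest t₁ (tm hc₁ t₂) (w₁.congr e₁.symm ?_),
    eq_of_weakEq_isTest t₂ (tm hc₂ t₁) (w₂.congr e₂.symm ?_)⟩
  · filter_upwards [e₂] with z hz using by rw [hz]
  · filter_upwards [e₁] with z hz using by rw [hz]

/-! ### Test functions -/

theorem IsTest.mul {f g : ℂ → ℂ} (hf : IsTest f) (hg : IsTest g) : IsTest fun z => f z * g z :=
  ⟨hf.1.mul hg.1, fun γ hγ z => by simp only [hf.2 γ hγ, hg.2 γ hγ]⟩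

theorem IsTest.add {f g : ℂ → ℂ} (hf : IsTest f) (hg : IsTest g) : IsTest fun z => f z + g z :=
  ⟨hf.1.add hg.1, fun γ hγ z => by simp only [hf.2 γ hγ, hg.2 γ hγ]⟩

theorem isTest_const (c : ℂ) : IsTest fun _ => c := ⟨contDiff_const, fun _ _ _ => rfl⟩

theorem IsTest.const_mul {f : ℂ → ℂ} (hf : IsTest f) (c : ℂ) : IsTest fun z => c * f z :=
  (isTest_const c).mul hf

theorem IsTest.neg {f : ℂ → ℂ} (hf : IsTest f) : IsTest fun z => -f z := by
  simpa using hf.const_mul (-1)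

theorem IsTest.sub {f g : ℂ → ℂ} (hf : IsTest f) (hg : IsTest g) : IsTest fun z => f z - g z := by
  simpa [sub_eq_add_neg] using hf.add hg.neg

theorem IsTest.conj {f : ℂ → ℂ} (hf : IsTest f) : IsTest fun z => conj (f z) :=
  ⟨Complex.conjCLE.contDiff.comp hf.1, fun γ hγ z => by simp only [hf.2 γ hγ]⟩

theorem IsTest.comp_neg {f : ℂ → ℂ} (hf : IsTest f) : IsTest fun z => f (-z) :=
  ⟨hf.1.comp contDiff_neg, fun γ hγ z => by
    simp only [neg_add, hf.2 _ (lattice.neg_mem hγ)]⟩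

theorem IsTest.comp_tau {f : ℂ → ℂ} (hf : IsTest f) : IsTest fun z => f (τ * z) :=
  ⟨hf.1.comp (contDiff_const.mul contDiff_id), fun γ hγ z => by
    simp only [mul_add, hf.2 _ (mul_tau_mem_lattice hγ)]⟩

theorem Potential.isTest (V : Potential) : IsTest V :=
  ⟨V.analytic.contDiff, V.periodic⟩

theorem IsTest.twoDzbar {f : ℂ → ℂ} (hf : IsTest f) : IsTest (twoDzbar f) := by
  rw [twoDzbar_eq_firstOrder]; exact hf.firstOrder _ _

theorem twoDzbar_add {f g : ℂ → ℂ} {z : ℂ} (hf : DifferentiableAt ℝ f z)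
    (hg : DifferentiableAt ℝ g z) :
    twoDzbar (fun w => f w + g w) z = twoDzbar f z + twoDzbar g z := by
  simp only [twoDzbar, dx1, dx2]
  rw [fderiv_fun_add hf hg]
  simp only [_root_.add_apply]
  ring

theorem twoDzbar_const (c z : ℂ) : twoDzbar (fun _ => c) z = 0 := by
  simp [twoDzbar, dx1, dx2]

theorem twoDzbar_mul {f g : ℂ → ℂ} {z : ℂ} (hf : DifferentiableAt ℝ f z)
    (hg : DifferentiableAt ℝ g z) :
    twoDzbar (fun w => f w * g w) z = twoDzbar f z * g z + f z * twoDzbar g z := by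
  rw [twoDzbar_eq_firstOrder]; exact firstOrder_mul hf hg

theorem twoDzbar_const_mul (c : ℂ) {f : ℂ → ℂ} {z : ℂ} (hf : DifferentiableAt ℝ f z) :
    twoDzbar (fun w => c * f w) z = c * twoDzbar f z := by
  rw [twoDzbar_mul (differentiableAt_const c) hf, twoDzbar_const]; ring

theorem fderiv_comp_const_mul {f : ℂ → ℂ} {c z : ℂ} (hf : DifferentiableAt ℝ f (c * z)) (v : ℂ) :
    fderiv ℝ (fun w => f (c * w)) z v = fderiv ℝ f (c * z) (c * v) := by
  have h1 : HasFDerivAt (fun w : ℂ => c * w) (c • ContinuousLinearMap.id ℝ ℂ) z :=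
    (hasFDerivAt_id z).const_mul c
  rw [show (fun w => f (c * w)) = f ∘ fun w => c * w from rfl,
    (hf.hasFDerivAt.comp z h1).fderiv]
  simp

theorem fderiv_apply_eq (f : ℂ → ℂ) (z v : ℂ) :
    fderiv ℝ f z v = v.re * fderiv ℝ f z 1 + v.im * fderiv ℝ f z Complex.I := by
  have : v = v.re • (1 : ℂ) + v.im • Complex.I := by apply Complex.ext <;> simp
  conv_lhs => rw [this, map_add, map_smul, map_smul, Complex.real_smul, Complex.real_smul]

theorem twoDzbar_comp_const_mul {f : ℂ → ℂ} {c z : ℂ} (hf : DifferentiableAt ℝ f (c * z)) :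
    twoDzbar (fun w => f (c * w)) z = conj c * twoDzbar f (c * z) := by
  simp only [twoDzbar, dx1, dx2]
  rw [fderiv_comp_const_mul hf, fderiv_comp_const_mul hf, fderiv_apply_eq f (c * z) (c * 1),
    fderiv_apply_eq f (c * z) (c * Complex.I)]
  have hc : conj c = c.re - c.im * Complex.I := by
    apply Complex.ext <;> simp
  rw [hc]
  simp only [mul_one, Complex.mul_re, Complex.mul_im, Complex.I_re, Complex.I_im, mul_zero,
    zero_sub, Complex.ofReal_neg, add_zero]
  ring_nf
  simp
  ring

theorem fderiv_conj_apply {f : ℂ → ℂ} {z : ℂ} (hf : DifferentiableAt ℝ f z) (v : ℂ) :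
    fderiv ℝ (fun w => conj (f w)) z v = conj (fderiv ℝ f z v) := by
  have h := (Complex.conjCLE.toContinuousLinearMap.hasFDerivAt (x := f z)).comp z hf.hasFDerivAt
  have e : (fun w => conj (f w)) = (Complex.conjCLE.toContinuousLinearMap : ℂ → ℂ) ∘ f := by
    ext w; simp
  rw [e, h.fderiv]
  simp

theorem conj_twoDz_conj {f : ℂ → ℂ} {z : ℂ} (hf : DifferentiableAt ℝ f z) :
    twoDz (fun w => conj (f w)) z = -conj (twoDzbar f z) := by
  simp only [twoDz, twoDzbar, dx1, dx2]
  rw [fderiv_conj_apply hf, fderiv_conj_apply hf]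
  simp
  ring

/-! ### The smooth kernel of `D_S(α) + k` -/

/-- Smooth periodic solutions of `(D_S(α) + k) u = 0`. -/
def sol (V : Potential) (α k : ℂ) : Submodule ℂ (Fin 2 → ℂ → ℂ) where
  carrier := {u | (∀ j, IsTest (u j)) ∧
    (∀ z, twoDzbar (u 0) z + k * u 0 z = -(α * V z) * u 1 z) ∧
    ∀ z, twoDzbar (u 1) z + k * u 1 z = -α * u 0 z}
  zero_mem' := by
    have h0 (z : ℂ) : twoDzbar (0 : ℂ → ℂ) z = 0 := twoDzbar_const 0 z
    exact ⟨fun _ => isTest_const 0, fun z => by simp [h0], fun z => by simp [h0]⟩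
  add_mem' := by
    rintro u v ⟨hu, hu1, hu2⟩ ⟨hv, hv1, hv2⟩
    have h (j) (z) : twoDzbar ((u + v) j) z = twoDzbar (u j) z + twoDzbar (v j) z :=
      twoDzbar_add ((hu j).differentiable z) ((hv j).differentiable z)
    refine ⟨fun j => (hu j).add (hv j), fun z => ?_, fun z => ?_⟩
    · rw [h]
      simp only [Pi.add_apply]
      linear_combination hu1 z + hv1 z
    · rw [h]
      simp only [Pi.add_apply]
      linear_combination hu2 z + hv2 z
  smul_mem' := by
    rintro c u ⟨hu, hu1, hu2⟩
    have h (j) (z) : twoDzbar ((c • u) j) z = c * twoDzbar (u j) z :=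
      twoDzbar_const_mul c ((hu j).differentiable z)
    refine ⟨fun j => (hu j).const_mul c, fun z => ?_, fun z => ?_⟩
    · rw [h]
      simp only [Pi.smul_apply, smul_eq_mul]
      linear_combination c * hu1 z
    · rw [h]
      simp only [Pi.smul_apply, smul_eq_mul]
      linear_combination c * hu2 z

theorem coef_twoDzbar {f : ℂ → ℂ} (hf : IsTest f) (k : ℂ) (n : ℤ × ℤ) :
    coef (fun z => twoDzbar f z + k * f z) n = (k + freq n) * coef f n := by
  have h := hf.weakEq (1 / Complex.I) 1 k
  rw [← twoDzbar_eq_firstOrder] at h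
  exact (coef_of_weakEq_twoDzbar h n).symm

theorem coef_eq_zero_of_twoDzbar {f : ℂ → ℂ} (hf : IsTest f) {k : ℂ}
    (h : ∀ z, twoDzbar f z + k * f z = 0) (n : ℤ × ℤ) (hn : freq n + k ≠ 0) : coef f n = 0 := by
  have e := coef_twoDzbar hf k n
  simp only [h] at e
  have : coef (fun _ => 0) n = 0 := by simp [coef]
  rw [this] at e
  rw [add_comm] at hn
  exact (mul_eq_zero.1 e.symm).resolve_left hn

theorem coef_zero (n : ℤ × ℤ) : coef (fun _ => 0) n = 0 := by simp [coef]

theorem eq_zero_of_twoDzbar {f : ℂ → ℂ} (hf : IsTest f) {k : ℂ}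
    (h : ∀ z, twoDzbar f z + k * f z = 0) (hk : ∀ n, freq n + k ≠ 0) : f = fun _ => 0 :=
  eq_of_coef_eq hf.continuous continuous_const hf.periodic (fun _ _ _ => rfl) fun n => by
    rw [coef_eq_zero_of_twoDzbar hf h n (hk n), coef_zero]

/-- The map `freq` is injective, so the equation kills every Fourier coefficient except that of
index `m`. -/
theorem eq_expo_of_twoDzbar {f : ℂ → ℂ} (hf : IsTest f) {m : ℤ × ℤ}
    (h : ∀ z, twoDzbar f z + -freq m * f z = 0) : ∃ c, f = fun z => c * expo m z := by
  have hi (n m : ℤ × ℤ) (hn : n ≠ m) : freq n + -freq m ≠ 0 := fun h0 => hn (by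
    have : freq (n - m) = 0 := by rw [sub_eq_add_neg, freq_add, freq_neg, h0]
    exact sub_eq_zero.1 (freq_eq_zero this))
  refine ⟨coef f m, eq_of_coef_eq hf.continuous ((isTest_expo m).const_mul _).continuous hf.periodic
    ((isTest_expo m).const_mul _).periodic fun n => ?_⟩
  rw [coef_const_mul]
  by_cases hn : n = m
  · subst hn
    have : coef (expo n) n = 1 := by
      have h1 := coef_one 0
      rw [if_pos rfl] at h1
      rw [← h1]
      simp only [coef, ← expo_add, add_neg_cancel, neg_zero, expo_zero, mul_one]
    rw [this, mul_one]
  · rw [coef_eq_zero_of_twoDzbar hf h n (hi n m hn), coef_eq_zero_of_twoDzbar (isTest_expo m)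
      (k := -freq m) (fun z => by rw [twoDzbar_expo]; ring) n (hi n m hn), mul_zero]

theorem exists_bound_coef_mul {φ : ℂ → ℂ} (h : IsTest φ) : ∃ C, 0 ≤ C ∧ ∀ (f : ℂ → ℂ) (M : ℝ),
    IsTest f → (∀ n, ‖coef f n‖ ≤ M) → ∀ n, ‖coef (fun z => φ z * f z) n‖ ≤ C * M := by
  have hs := h.rapid.summable
  refine ⟨∑' m, ‖coef φ m‖, tsum_nonneg fun _ => norm_nonneg _, fun f M hf hM n => ?_⟩
  rw [h.coef_mul (integrableOn_cell_of_continuous hf.continuous)]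
  refine tsum_of_norm_bounded (hs.hasSum.mul_right M) fun m => ?_
  rw [norm_mul]
  gcongr
  exact hM _

/-- Solutions are determined by finitely many Fourier coefficients. -/
theorem exists_coef_determines (V : Potential) (α k : ℂ) : ∃ R : ℝ, ∀ u ∈ sol V α k,
    (∀ j n, wt n ≤ R → coef (u j) n = 0) → u = 0 := by
  obtain ⟨C₁, p₁, h₁⟩ := exists_bound_coef_mul (V.isTest.const_mul α).neg
  obtain ⟨C₂, p₂, h₂⟩ := exists_bound_coef_mul (isTest_const (-α))
  -- Beyond this radius `‖k + freq n‖ ≥ 2(C₁ + C₂ + 1)`, so the equations halve any uniform bound on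
  -- the coefficients.
  refine ⟨1 + ‖k‖ + 2 * (C₁ + C₂ + 1), fun u hu h0 => ?_⟩
  obtain ⟨B₀, hB₀⟩ := norm_coef_le (f := u 0)
  obtain ⟨B₁, hB₁⟩ := norm_coef_le (f := u 1)
  have step (M : ℝ) (hM : ∀ j n, ‖coef (u j) n‖ ≤ M) : ∀ j n, ‖coef (u j) n‖ ≤ M / 2 := by
    have hM0 : 0 ≤ M := (norm_nonneg _).trans (hM 0 0)
    have key (j : Fin 2) (n : ℤ × ℤ) (C : ℝ) (hC : C ≤ C₁ + C₂)
        (h : ‖(k + freq n) * coef (u j) n‖ ≤ C * M) : ‖coef (u j) n‖ ≤ M / 2 := by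
      by_cases hn : wt n ≤ 1 + ‖k‖ + 2 * (C₁ + C₂ + 1)
      · rw [h0 j n hn, norm_zero]; positivity
      · have h3 := wt_le_norm_freq n
        have h4 : ‖freq n‖ ≤ ‖k + freq n‖ + ‖k‖ := by
          have := norm_sub_le (k + freq n) k
          rwa [add_sub_cancel_left] at this
        have h5 : 2 * (C₁ + C₂ + 1) ≤ ‖k + freq n‖ := by linarith
        rw [norm_mul] at h
        have h6 := norm_nonneg (coef (u j) n)
        have h7 : 2 * (C₁ + C₂ + 1) * ‖coef (u j) n‖ ≤ (C₁ + C₂ + 1) * M := by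
          calc _ ≤ ‖k + freq n‖ * ‖coef (u j) n‖ := by gcongr
            _ ≤ C * M := h
            _ ≤ _ := by gcongr; linarith
        have h8 : 0 < C₁ + C₂ + 1 := by linarith
        have h9 : (C₁ + C₂ + 1) * (2 * ‖coef (u j) n‖) ≤ (C₁ + C₂ + 1) * M := by linarith
        linarith [le_of_mul_le_mul_left h9 h8]
    have e₀ (n) := coef_twoDzbar (hu.1 0) k n
    have e₁ (n) := coef_twoDzbar (hu.1 1) k n
    simp only [hu.2.1, hu.2.2] at e₀ e₁
    intro j n
    fin_cases j
    · exact key 0 n C₁ (by linarith) (by rw [← e₀]; exact h₁ _ M (hu.1 1) (hM 1) n)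
    · exact key 1 n C₂ (by linarith) (by rw [← e₁]; exact h₂ _ M (hu.1 0) (hM 0) n)
  -- Iterating the halving drives all coefficients to zero.
  have hM : ∀ i : ℕ, ∀ j n, ‖coef (u j) n‖ ≤ max B₀ B₁ * (1 / 2) ^ i := by
    intro i
    induction i with
    | zero =>
      intro j n
      rw [pow_zero, mul_one]
      fin_cases j
      · exact (hB₀ n).trans (le_max_left _ _)
      · exact (hB₁ n).trans (le_max_right _ _)
    | succ i ih =>
      intro j n
      refine (step _ ih j n).trans (le_of_eq ?_)
      ring
  ext j : 1
  refine eq_of_coef_eq (hu.1 j).continuous continuous_const (hu.1 j).periodic (fun _ _ _ => rfl)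
    (g := fun _ => 0) fun n => ?_
  rw [coef_zero, ← norm_le_zero_iff]
  refine ge_of_tendsto' (f := fun i : ℕ => max B₀ B₁ * (1 / 2 : ℝ) ^ i) (x := atTop) ?_
    fun i => hM i j n
  simpa using (tendsto_pow_atTop_nhds_zero_of_lt_one (r := (1 / 2 : ℝ)) (by norm_num)
    (by norm_num)).const_mul (max B₀ B₁)

/-- Finitely many Fourier coefficients embed the solution space. Without this, an upper bound on
`finrank` would say nothing about the actual dimension. -/
instance finiteDimensional_sol (V : Potential) (α k : ℂ) : FiniteDimensional ℂ (sol V α k) := by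
  obtain ⟨R, hR⟩ := exists_coef_determines V α k
  have : Finite {n : ℤ × ℤ | wt n ≤ R} := finite_wt_le R
  let L : sol V α k →ₗ[ℂ] (Fin 2 → {n : ℤ × ℤ | wt n ≤ R} → ℂ) :=
    { toFun := fun u j n => coef (u.1 j) n
      map_add' := fun u v => by
        ext j n
        exact coef_add (integrableOn_cell_of_continuous (u.2.1 j).continuous)
          (integrableOn_cell_of_continuous (v.2.1 j).continuous) _
      map_smul' := fun c u => by
        ext j n
        exact coef_const_mul c _ _ }
  refine FiniteDimensional.of_injective L ((injective_iff_map_eq_zero L).2 fun u hu => ?_)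
  refine Subtype.ext (hR u.1 u.2 fun j n hn => ?_)
  exact congrFun (congrFun hu j) ⟨n, hn⟩

/-! ### Classes of smooth periodic functions -/

/-- The class of a smooth periodic function. -/
def IsTest.toClass {f : ℂ → ℂ} (h : IsTest f) : FunClass :=
  AEEqFun.mk f h.continuous.aestronglyMeasurable

theorem IsTest.coe_toClass {f : ℂ → ℂ} (h : IsTest f) : ⇑h.toClass =ᵐ[volume] f :=
  AEEqFun.coeFn_mk _ _

theorem IsTest.toClass_eq_iff {f : ℂ → ℂ} (h : IsTest f) {U : FunClass} :
    h.toClass = U ↔ ⇑U =ᵐ[volume] f := by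
  constructor
  · rintro rfl
    exact h.coe_toClass
  · intro hU
    exact AEEqFun.ext (h.coe_toClass.trans hU.symm)

theorem AEPeriodic.congr {f g : ℂ → ℂ} (hf : AEPeriodic f) (h : f =ᵐ[volume] g) :
    AEPeriodic g := fun γ hγ => by
  filter_upwards [h, (measurePreserving_add_right volume γ).quasiMeasurePreserving.ae h,
    hf γ hγ] with z h1 h2 h3
  rw [← h1, ← h2, h3]

theorem IsTest.toClass_mem_L2 {f : ℂ → ℂ} (h : IsTest f) : h.toClass ∈ L2 :=
  ⟨h.periodic.aePeriodic.congr h.coe_toClass.symm,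
    (memLp_congr_ae (ae_restrict_of_ae h.coe_toClass)).2 (memLp_cell_of_continuous h.continuous)⟩

theorem IsTest.toClass_mem_derivsIn {S : Submodule ℂ FunClass} {hS : S ≤ L2}
    (hT : ∀ {g : ℂ → ℂ} (h : IsTest g), h.toClass ∈ S) {f : ℂ → ℂ} (h : IsTest f) :
    h.toClass ∈ derivsIn S hS := by
  refine ⟨h.toClass_mem_L2, ⟨(h.firstOrder 1 0).toClass, hT _, ?_⟩,
    ⟨(h.firstOrder 0 1).toClass, hT _, ?_⟩⟩
  · rw [dx1_eq_firstOrder]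
    refine (h.weakEq 1 0 0).congr h.coe_toClass ((h.firstOrder 1 0).coe_toClass.trans ?_)
    exact Eventually.of_forall fun z => by simp
  · rw [dx2_eq_firstOrder]
    refine (h.weakEq 0 1 0).congr h.coe_toClass ((h.firstOrder 0 1).coe_toClass.trans ?_)
    exact Eventually.of_forall fun z => by simp

theorem IsTest.toClass_mem_H1 {f : ℂ → ℂ} (h : IsTest f) : h.toClass ∈ H1 :=
  IsTest.toClass_mem_derivsIn (fun h => h.toClass_mem_L2) h

theorem IsTest.toClass_mem_H2 {f : ℂ → ℂ} (h : IsTest f) : h.toClass ∈ H2 :=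
  IsTest.toClass_mem_derivsIn (fun h => h.toClass_mem_H1) h

theorem IsTest.weakEq_twoDzbar {f g : ℂ → ℂ} (h : IsTest f) {k : ℂ}
    (e : ∀ z, ScalarModel.twoDzbar f z + k * f z = g z) : WeakEq ScalarModel.twoDzbar k f g := by
  have := h.weakEq (1 / Complex.I) 1 k
  rw [← twoDzbar_eq_firstOrder] at this
  rwa [funext e] at this

theorem IsTest.weakEq_twoDz {f g : ℂ → ℂ} (h : IsTest f) {k : ℂ}
    (e : ∀ z, twoDz f z + k * f z = g z) : WeakEq twoDz k f g := by
  have := h.weakEq (1 / Complex.I) (-1) k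
  rw [← twoDz_eq_firstOrder] at this
  rwa [funext e] at this

theorem mem_kerDS_of_sol {V : Potential} {α k : ℂ} {u : Fin 2 → ℂ → ℂ} (hu : u ∈ sol V α k) :
    (fun j => (hu.1 j).toClass) ∈ kerDS V α k := by
  refine ⟨fun j => (hu.1 j).toClass_mem_H1,
    ((hu.1 0).weakEq_twoDzbar hu.2.1).congr (hu.1 0).coe_toClass ?_,
    ((hu.1 1).weakEq_twoDzbar hu.2.2).congr (hu.1 1).coe_toClass ?_⟩
  · filter_upwards [(hu.1 1).coe_toClass] with z hz using by rw [hz]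
  · filter_upwards [(hu.1 0).coe_toClass] with z hz using by rw [hz]

theorem exists_sol_of_weakEq {V : Potential} {α k : ℂ} {f₁ f₂ : ℂ → ℂ}
    (h₁ : MemLp f₁ 2 (volume.restrict cell)) (h₂ : MemLp f₂ 2 (volume.restrict cell))
    (p₁ : AEPeriodic f₁) (p₂ : AEPeriodic f₂)
    (w₁ : WeakEq twoDzbar k f₁ (fun z => -(α * V z) * f₂ z))
    (w₂ : WeakEq twoDzbar k f₂ (fun z => -α * f₁ z)) :
    ∃ u ∈ sol V α k, f₁ =ᵐ[volume] u 0 ∧ f₂ =ᵐ[volume] u 1 := by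
  obtain ⟨s₁, s₂, t₁, t₂, e₁, e₂, d₁, d₂⟩ := exists_smooth_of_weakEq (V.isTest.const_mul α).neg
    (isTest_const (-α)) h₁ h₂ p₁ p₂ w₁ w₂
  refine ⟨![s₁, s₂], ⟨?_, d₁, d₂⟩, e₁, e₂⟩
  intro j
  fin_cases j
  · exact t₁
  · exact t₂

theorem exists_sol_of_solvesDS {V : Potential} {α k : ℂ} {U₁ U₂ : FunClass} (h₁ : U₁ ∈ H1)
    (h₂ : U₂ ∈ H1) (h : SolvesDS V α k U₁ U₂) :
    ∃ u ∈ sol V α k, ⇑U₁ =ᵐ[volume] u 0 ∧ ⇑U₂ =ᵐ[volume] u 1 :=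
  exists_sol_of_weakEq (H1_le_L2 h₁).2 (H1_le_L2 h₂).2 (H1_le_L2 h₁).1 (H1_le_L2 h₂).1 h.1 h.2

/-! ### The adjoint kernel -/

/-- The reflection intertwining `D_S(α) + k` and its adjoint. -/
def reflect (u : Fin 2 → ℂ → ℂ) : Fin 2 → ℂ → ℂ :=
  ![fun z => conj (u 1 (-z)), fun z => conj (u 0 (-z))]

theorem reflect_reflect (u : Fin 2 → ℂ → ℂ) : reflect (reflect u) = u := by
  ext j z
  fin_cases j <;> simp [reflect]

theorem reflect_add (u v : Fin 2 → ℂ → ℂ) : reflect (u + v) = reflect u + reflect v := by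
  ext j z
  fin_cases j <;> simp [reflect]

theorem reflect_smul (c : ℂ) (u : Fin 2 → ℂ → ℂ) : reflect (c • u) = conj c • reflect u := by
  ext j z
  fin_cases j <;> simp [reflect]

/-- Smooth periodic solutions of `(D_S(α) + k)^* w = 0`. -/
def adjSol (V : Potential) (α k : ℂ) : Submodule ℂ (Fin 2 → ℂ → ℂ) where
  carrier := {w | reflect w ∈ sol V α k}
  zero_mem' := by
    have : reflect 0 = 0 := by ext j z; fin_cases j <;> simp [reflect]
    rw [mem_ofPred_eq, this]
    exact zero_mem _
  add_mem' := fun hu hv => by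
    rw [mem_ofPred_eq, reflect_add]
    exact add_mem hu hv
  smul_mem' := fun c u hu => by
    rw [mem_ofPred_eq, reflect_smul]
    exact Submodule.smul_mem _ _ hu

/-- `reflect` is only conjugate linear, so ranks are compared along the ring automorphism `conj` of
`ℂ`. -/
theorem rank_adjSol (V : Potential) (α k : ℂ) :
    Module.rank ℂ (adjSol V α k) = Module.rank ℂ (sol V α k) := by
  refine rank_eq_of_equiv_equiv (starRingEnd ℂ)
    { toFun := fun w => ⟨reflect w.1, w.2⟩
      invFun := fun u => ⟨reflect u.1, by
        show reflect (reflect u.1) ∈ sol V α k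
        rw [reflect_reflect]; exact u.2⟩
      left_inv := fun w => Subtype.ext (reflect_reflect w.1)
      right_inv := fun u => Subtype.ext (reflect_reflect u.1)
      map_add' := fun w w' => Subtype.ext (reflect_add w.1 w'.1) }
    (Function.Involutive.bijective Complex.conj_conj)
    fun c w => Subtype.ext (reflect_smul c w.1)

theorem isTest_of_adjSol {V : Potential} {α k : ℂ} {w : Fin 2 → ℂ → ℂ} (hw : w ∈ adjSol V α k)
    (j : Fin 2) : IsTest (w j) := by
  have h : reflect w ∈ sol V α k := hw
  have e : w = reflect (reflect w) := (reflect_reflect w).symm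
  rw [e]
  fin_cases j
  · exact (h.1 1).comp_neg.conj
  · exact (h.1 0).comp_neg.conj

/-- Conjugation turns `2D_{z̄}` into `-2D_z`, and the point reflection supplies a second sign. -/
theorem twoDz_conj_comp_neg {f : ℂ → ℂ} (hf : IsTest f) (z : ℂ) :
    twoDz (fun w => conj (f (-w))) z = conj (twoDzbar f (-z)) := by
  rw [conj_twoDz_conj (hf.comp_neg.differentiable z)]
  have h := twoDzbar_comp_const_mul (f := f) (c := -1) (z := z) (hf.differentiable _)
  simp only [neg_one_mul, map_neg, map_one] at h
  rw [h, map_neg, neg_neg]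

theorem solvesDSadj_of_adjSol {V : Potential} {α k : ℂ} {w : Fin 2 → ℂ → ℂ}
    (hw : w ∈ adjSol V α k) :
    SolvesDSadj V α k (isTest_of_adjSol hw 0).toClass (isTest_of_adjSol hw 1).toClass := by
  have h : reflect w ∈ sol V α k := hw
  have t := isTest_of_adjSol hw
  have e : w = reflect (reflect w) := (reflect_reflect w).symm
  have d0 (z : ℂ) : twoDz (w 0) z + conj k * w 0 z = -(conj α) * w 1 z := by
    have e0 : w 0 = fun z => conj (reflect w 1 (-z)) := congrFun e 0
    have e1 : w 1 = fun z => conj (reflect w 0 (-z)) := congrFun e 1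
    have h2 := congrArg conj (h.2.2 (-z))
    rw [e0, e1, twoDz_conj_comp_neg (h.1 1)]
    simpa using h2
  have d1 (z : ℂ) : twoDz (w 1) z + conj k * w 1 z = -(conj α * conj (V z)) * w 0 z := by
    have e0 : w 0 = fun z => conj (reflect w 1 (-z)) := congrFun e 0
    have e1 : w 1 = fun z => conj (reflect w 0 (-z)) := congrFun e 1
    have h2 := congrArg conj (h.2.1 (-z))
    rw [e0, e1, twoDz_conj_comp_neg (h.1 0), V.even z]
    simpa using h2
  refine ⟨((t 0).weakEq_twoDz d0).congr (t 0).coe_toClass ?_,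
    ((t 1).weakEq_twoDz d1).congr (t 1).coe_toClass ?_⟩
  · filter_upwards [(t 1).coe_toClass] with z hz using by rw [hz]
  · filter_upwards [(t 0).coe_toClass] with z hz using by rw [hz]

theorem WeakEq.conj_twoDz {k : ℂ} {f g : ℂ → ℂ} (h : WeakEq twoDz (conj k) f g) :
    WeakEq twoDzbar (-k) (fun z => conj (f z)) (fun z => -conj (g z)) := by
  intro φ hφ
  have hφ' : IsTest φ := hφ
  have h1 := congrArg conj (h _ hφ'.conj)
  rw [← integral_conj, ← integral_conj] at h1
  have e1 (z : ℂ) : conj (f z) * (-k * φ z - twoDzbar φ z) =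
      -conj (f z * (conj k * conj (φ z) - twoDz (fun w => conj (φ w)) z)) := by
    rw [conj_twoDz_conj (hφ'.differentiable z)]
    simp
    ring
  have e2 (z : ℂ) : -conj (g z) * φ z = -conj (g z * conj (φ z)) := by simp
  simp only [e1, e2]
  rw [integral_neg, integral_neg, h1]

/-- The point reflection changes the sign of `2D_{z̄}`, the sign on the second component restores
that of the off-diagonal terms, and `V` is even; the net effect is `-k ↦ k`. -/
theorem sol_reflect_neg {V : Potential} {α k : ℂ} {s : Fin 2 → ℂ → ℂ} (hs : s ∈ sol V α (-k)) :
    ![fun z => s 0 (-z), fun z => -s 1 (-z)] ∈ sol V α k := by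
  have h (j) (z) : twoDzbar (fun w => s j (-w)) z = -twoDzbar (s j) (-z) := by
    have h := twoDzbar_comp_const_mul (f := s j) (c := -1) (z := z) ((hs.1 j).differentiable _)
    simpa using h
  have h' (z) : twoDzbar (fun w => -s 1 (-w)) z = twoDzbar (s 1) (-z) := by
    have := twoDzbar_const_mul (-1) (z := z) ((hs.1 1).comp_neg.differentiable z)
    rw [h] at this
    simpa using this
  refine ⟨fun j => ?_, fun z => ?_, fun z => ?_⟩
  · fin_cases j
    · exact (hs.1 0).comp_neg
    · exact (hs.1 1).comp_neg.neg
  · have := hs.2.1 (-z)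
    rw [← V.even] at this
    simp only [Matrix.cons_val_zero, Matrix.cons_val_one, h]
    linear_combination -this
  · have := hs.2.2 (-z)
    simp only [Matrix.cons_val_zero, Matrix.cons_val_one, h']
    linear_combination this

theorem memLp_conj {f : ℂ → ℂ} (hf : MemLp f 2 (volume.restrict cell)) :
    MemLp (fun z => conj (f z)) 2 (volume.restrict cell) := hf.star

/-- On weak solutions only the conjugation is performed, which needs no change of variables in the
cell and leads to the parameter `-k`. The reflection is applied afterwards, to the smooth
representatives. -/
theorem exists_adjSol_of_solvesDSadj {V : Potential} {α k : ℂ} {W₁ W₂ : FunClass} (h₁ : W₁ ∈ H1)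
    (h₂ : W₂ ∈ H1) (h : SolvesDSadj V α k W₁ W₂) :
    ∃ w ∈ adjSol V α k, ⇑W₁ =ᵐ[volume] w 0 ∧ ⇑W₂ =ᵐ[volume] w 1 := by
  have m₁ := memLp_conj (H1_le_L2 h₁).2
  have m₂ := memLp_conj (H1_le_L2 h₂).2
  have p {U : FunClass} (hU : U ∈ H1) : AEPeriodic fun z => conj (U z) := fun γ hγ => by
    filter_upwards [(H1_le_L2 hU).1 γ hγ] with z hz using by rw [hz]
  have w₂ : WeakEq twoDzbar (-k) (fun z => conj (W₂ z))
      (fun z => -(α * V z) * (-1 * conj (W₁ z))) := by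
    refine h.2.conj_twoDz.congr EventuallyEq.rfl (Eventually.of_forall fun z => ?_)
    simp
  have w₁ : WeakEq twoDzbar (-k) (fun z => -1 * conj (W₁ z)) (fun z => -α * conj (W₂ z)) := by
    refine (h.1.conj_twoDz.smul (-1)).congr EventuallyEq.rfl (Eventually.of_forall fun z => ?_)
    simp
  obtain ⟨s, hs, e₁, e₂⟩ := exists_sol_of_weakEq m₂ (m₁.const_mul (-1)) (p h₂)
    (fun γ hγ => by filter_upwards [p h₁ γ hγ] with z hz using by rw [hz]) w₂ w₁
  refine ⟨![fun z => -conj (s 1 z), fun z => conj (s 0 z)], ?_, ?_, ?_⟩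
  · show reflect _ ∈ sol V α k
    convert! sol_reflect_neg hs using 1
    ext j z
    fin_cases j <;> simp [reflect]
  · filter_upwards [e₂] with z hz
    simp [← hz]
  · filter_upwards [e₁] with z hz
    simp [← hz]

/-! ### Dimensions -/

theorem eq_zero_of_toClass_eq_zero {f : ℂ → ℂ} (hf : IsTest f) (h : hf.toClass = 0) : f = 0 := by
  have h1 := hf.toClass_eq_iff.1 h
  exact Measure.eq_of_ae_eq (h1.symm.trans AEEqFun.coeFn_zero) hf.continuous continuous_const

/-- Smooth solutions and the kernel in `H¹`. -/
def solEquivKerDS (V : Potential) (α k : ℂ) : sol V α k ≃ₗ[ℂ] kerDS V α k :=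
  LinearEquiv.ofBijective
    { toFun := fun u => ⟨fun j => (u.2.1 j).toClass, mem_kerDS_of_sol u.2⟩
      map_add' := fun u v => rfl
      map_smul' := fun c u => rfl } (by
    constructor
    · refine (injective_iff_map_eq_zero _).2 fun u hu => ?_
      ext j : 2
      exact eq_zero_of_toClass_eq_zero (u.2.1 j) (congrFun (congrArg Subtype.val hu) j)
    · rintro ⟨U, hU⟩
      obtain ⟨u, hu, e₀, e₁⟩ := exists_sol_of_solvesDS (hU.1 0) (hU.1 1) hU.2
      refine ⟨⟨u, hu⟩, Subtype.ext (funext fun j => ?_)⟩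
      show (hu.1 j).toClass = U j
      rw [IsTest.toClass_eq_iff]
      fin_cases j
      · exact e₀
      · exact e₁)

/-- The element of `ker H(α,k)` given by two smooth solutions. -/
def kerHOfSol {V : Potential} {α k : ℂ} (p : adjSol V α k × sol V α k) : kerH V α k :=
  ⟨![(isTest_of_adjSol p.1.2 0).toClass, (isTest_of_adjSol p.1.2 1).toClass,
    (p.2.2.1 0).toClass, (p.2.2.1 1).toClass], by
      refine ⟨fun j => ?_, (mem_kerDS_of_sol p.2.2).2, solvesDSadj_of_adjSol p.1.2⟩
      fin_cases j
      · exact (isTest_of_adjSol p.1.2 0).toClass_mem_H1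
      · exact (isTest_of_adjSol p.1.2 1).toClass_mem_H1
      · exact (p.2.2.1 0).toClass_mem_H1
      · exact (p.2.2.1 1).toClass_mem_H1⟩

/-- Smooth solutions and the kernel of `H(α,k)`. -/
def solEquivKerH (V : Potential) (α k : ℂ) :
    (adjSol V α k × sol V α k) ≃ₗ[ℂ] kerH V α k :=
  LinearEquiv.ofBijective
    { toFun := kerHOfSol
      map_add' := fun p q => by
        refine Subtype.ext (funext fun j => ?_)
        fin_cases j <;> rfl
      map_smul' := fun c p => by
        refine Subtype.ext (funext fun j => ?_)
        fin_cases j <;> rfl } (by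
    constructor
    · refine (injective_iff_map_eq_zero _).2 fun p hp => ?_
      have h (j) := congrFun (congrArg Subtype.val hp) j
      refine Prod.ext (Subtype.ext (funext fun j => ?_)) (Subtype.ext (funext fun j => ?_))
      · fin_cases j
        · exact eq_zero_of_toClass_eq_zero (isTest_of_adjSol p.1.2 0) (h 0)
        · exact eq_zero_of_toClass_eq_zero (isTest_of_adjSol p.1.2 1) (h 1)
      · fin_cases j
        · exact eq_zero_of_toClass_eq_zero (p.2.2.1 0) (h 2)
        · exact eq_zero_of_toClass_eq_zero (p.2.2.1 1) (h 3)
    · rintro ⟨U, hU⟩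
      obtain ⟨u, hu, e₀, e₁⟩ := exists_sol_of_solvesDS (hU.1 2) (hU.1 3) hU.2.1
      obtain ⟨w, hw, e₂, e₃⟩ := exists_adjSol_of_solvesDSadj (hU.1 0) (hU.1 1) hU.2.2
      refine ⟨(⟨w, hw⟩, ⟨u, hu⟩), Subtype.ext (funext fun j => ?_)⟩
      fin_cases j
      · exact (isTest_of_adjSol hw 0).toClass_eq_iff.2 e₂
      · exact (isTest_of_adjSol hw 1).toClass_eq_iff.2 e₃
      · exact (hu.1 0).toClass_eq_iff.2 e₀
      · exact (hu.1 1).toClass_eq_iff.2 e₁)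

/-- The kernel of the block operator splits as adjoint kernel plus kernel, and the two have equal
dimension by reflection. -/
theorem finrank_kerH (V : Potential) (α k : ℂ) :
    Module.finrank ℂ (kerH V α k) = 2 * Module.finrank ℂ (sol V α k) := by
  have hr := rank_adjSol V α k
  have : FiniteDimensional ℂ (adjSol V α k) := by
    rw [FiniteDimensional, ← Module.rank_lt_aleph0_iff, hr, Module.rank_lt_aleph0_iff]
    infer_instance
  rw [← (solEquivKerH V α k).finrank_eq, Module.finrank_prod, two_mul,
    Module.finrank, hr, Module.finrank]

theorem multiplicityTwo_iff (V : Potential) (α : ℂ) :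
    MultiplicityTwo V α ↔ ∀ k, Module.finrank ℂ (sol V α k) = 2 := by
  refine forall_congr' fun k => ?_
  rw [finrank_kerH]
  omega

/-! ### The scalar kernel and protected states -/

/-- The second order equation is a first order system for the pair `(w, u)` with coefficients `α²V`
and `1`, so the regularity of systems applies. -/
theorem exists_smooth_of_kerP {V : Potential} {α k : ℂ} {U : FunClass} (hU : U ∈ kerP V α k) :
    ∃ s t, IsTest s ∧ IsTest t ∧ ⇑U =ᵐ[volume] s ∧ (∀ z, twoDzbar s z + k * s z = t z) ∧
      ∀ z, twoDzbar t z + k * t z = α ^ 2 * V z * s z := by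
  obtain ⟨hU2, w, hw, h1, h2⟩ := hU
  have hUL : U ∈ L2 := hU2.1
  have hwL : w ∈ L2 := H1_le_L2 hw
  obtain ⟨t, s, ht, hs, -, es, d₁, d₂⟩ := exists_smooth_of_weakEq (V.isTest.const_mul (α ^ 2))
    (isTest_const 1) hwL.2 hUL.2 hwL.1 hUL.1 h2
    (h1.congr EventuallyEq.rfl (Eventually.of_forall fun z => one_mul _))
  exact ⟨s, t, hs, ht, es, fun z => by rw [d₂, one_mul], d₁⟩

/-- Real parts of dual lattice points lie in `2πℤ`. The number `1` serves throughout as a concrete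
nonresonant parameter. -/
theorem one_not_mem_dual (n : ℤ × ℤ) : freq n + 1 ≠ 0 := by
  intro h
  have h3 := congrArg Complex.re h
  have e : (freq n).re = 2 * Real.pi * n.1 := by
    have : freq n = ((2 * Real.pi * n.1 : ℝ) : ℂ) +
        ((2 * Real.pi * ((n.1 + 2 * n.2) / Real.sqrt 3) : ℝ) : ℂ) * Complex.I := by
      rw [freq]; push_cast; ring
    rw [this, ← Complex.mk_eq_add_mul_I]
  rw [Complex.add_re, e, Complex.one_re, Complex.zero_re] at h3
  have hpi := Real.pi_gt_three
  rcases le_or_gt 0 n.1 with h4 | h4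
  · have : (0 : ℝ) ≤ n.1 := by exact_mod_cast h4
    nlinarith
  · have : (n.1 : ℝ) ≤ -1 := by exact_mod_cast (by omega : n.1 ≤ -1)
    nlinarith

/-- For `α = 0` the operator is `(2D_{z̄} + k)²`, which is injective at the nonresonant value `k =
1`. -/
theorem ne_zero_of_magic {V : Potential} {α : ℂ} (hα : α ∈ magic V) : α ≠ 0 := by
  rintro rfl
  obtain ⟨U, hU, hU0⟩ := hα 1
  obtain ⟨s, t, hs, ht, es, d₁, d₂⟩ := exists_smooth_of_kerP hU
  have t0 := eq_zero_of_twoDzbar ht (k := 1) (fun z => by rw [d₂]; ring) one_not_mem_dual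
  have s0 := eq_zero_of_twoDzbar hs (k := 1) (fun z => by rw [d₁, t0]) one_not_mem_dual
  exact hU0 (AEEqFun.ext (es.trans (by rw [s0]; exact AEEqFun.coeFn_zero.symm)))

theorem mem_sol_of_scalar {V : Potential} {α k : ℂ} (hα : α ≠ 0) {s t : ℂ → ℂ} (hs : IsTest s)
    (ht : IsTest t) (h₁ : ∀ z, twoDzbar s z + k * s z = t z)
    (h₂ : ∀ z, twoDzbar t z + k * t z = α ^ 2 * V z * s z) :
    ![fun z => α⁻¹ * t z, fun z => -s z] ∈ sol V α k := by
  refine ⟨fun j => ?_, fun z => ?_, fun z => ?_⟩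
  · fin_cases j
    · exact ht.const_mul _
    · exact hs.neg
  · simp only [Matrix.cons_val_zero, Matrix.cons_val_one]
    rw [twoDzbar_const_mul _ (ht.differentiable z)]
    have := h₂ z
    field_simp
    linear_combination this
  · simp only [Matrix.cons_val_zero, Matrix.cons_val_one]
    have e : twoDzbar (fun w => -s w) z = -twoDzbar s z := by
      simpa using twoDzbar_const_mul (-1) (hs.differentiable z)
    have := h₁ z
    rw [e]
    field_simp
    linear_combination -this

theorem exists_sol_ne_zero {V : Potential} {α : ℂ} (hα : α ∈ magic V) (k : ℂ) :
    ∃ u ∈ sol V α k, u ≠ 0 := by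
  obtain ⟨U, hU, hU0⟩ := hα k
  obtain ⟨s, t, hs, ht, es, d₁, d₂⟩ := exists_smooth_of_kerP hU
  refine ⟨_, mem_sol_of_scalar (ne_zero_of_magic hα) hs ht d₁ d₂, fun h => hU0 ?_⟩
  have s0 : s = fun _ => 0 := by
    have h1 := congrFun h 1
    ext z
    have := congrFun h1 z
    simpa using this
  exact AEEqFun.ext (es.trans (by rw [s0]; exact AEEqFun.coeFn_zero.symm))

theorem quasiMeasurePreserving_mul_tau :
    Measure.QuasiMeasurePreserving (fun z : ℂ => τ * z) volume volume := by
  have hτ : τ ≠ 0 := Complex.exp_ne_zero _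
  refine ⟨(continuous_const.mul continuous_id).measurable, ?_⟩
  let L : ℂ ≃L[ℝ] ℂ := (ContinuousLinearEquiv.unitsEquivAut ℂ (Units.mk0 τ hτ)).restrictScalars ℝ
  have hL : (fun z : ℂ => τ * z) = L := by ext z; simp [L, mul_comm]
  have : (Measure.map L (volume : Measure ℂ)).IsAddHaarMeasure := L.isAddHaarMeasure_map _
  rw [hL, Measure.isAddLeftInvariant_eq_smul (Measure.map L volume) volume]
  exact Measure.AbsolutelyContinuous.rfl.smul_left _

theorem IsProtectedState.smooth {V : Potential} {α : ℂ} {u : ℂ → ℂ}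
    (hu : IsProtectedState V α u) : IsTest u ∧ u ≠ 0 ∧ (∀ z, u (τ * z) = u z) ∧
      ∀ z, twoDzbar (twoDzbar u) z = α ^ 2 * V z * u z := by
  obtain ⟨hc, h0, U, hU, hsym, hUu⟩ := hu
  obtain ⟨s, t, hs, ht, es, d₁, d₂⟩ := exists_smooth_of_kerP hU
  have e : u = s := Measure.eq_of_ae_eq (hUu.symm.trans es) hc.continuous hs.continuous
  subst e
  have e1 : twoDzbar u = t := funext fun z => by simpa using d₁ z
  refine ⟨hs, h0, fun z => ?_, fun z => by rw [e1]; simpa using d₂ z⟩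
  have h2 : (fun z => u (τ * z)) =ᵐ[volume] u := by
    filter_upwards [hsym.2, hUu, quasiMeasurePreserving_mul_tau.ae hUu] with z h3 h4 h5
    rw [← h4, ← h5, h3, zpow_zero, one_mul]
  exact congrFun (Measure.eq_of_ae_eq h2 (hc.continuous.comp (continuous_const.mul continuous_id))
    hc.continuous) z

theorem IsProtectedState.bold_mem {V : Potential} {α : ℂ} (hα : α ≠ 0) {u : ℂ → ℂ}
    (hu : IsProtectedState V α u) : bold α u ∈ sol V α 0 := by
  obtain ⟨h1, -, -, h2⟩ := hu.smooth
  exact mem_sol_of_scalar hα h1 h1.twoDzbar (fun z => by simp) fun z => by rw [h2]; ring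

theorem isProtectedState_of_smooth {V : Potential} {α : ℂ} {u : ℂ → ℂ} (hu : IsTest u)
    (h0 : u ≠ 0) (hτ : ∀ z, u (τ * z) = u z)
    (h : ∀ z, twoDzbar (twoDzbar u) z = α ^ 2 * V z * u z) : IsProtectedState V α u := by
  refine ⟨hu.1, h0, hu.toClass, ⟨hu.toClass_mem_H2, hu.twoDzbar.toClass,
    hu.twoDzbar.toClass_mem_H1, ?_, ?_⟩, ⟨hu.toClass_mem_L2, ?_⟩, hu.coe_toClass⟩
  · exact (hu.weakEq_twoDzbar fun z => by simp).congr hu.coe_toClass hu.twoDzbar.coe_toClass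
  · refine (hu.twoDzbar.weakEq_twoDzbar (g := fun z => α ^ 2 * V z * u z) fun z => by
      rw [h]; ring).congr hu.twoDzbar.coe_toClass ?_
    filter_upwards [hu.coe_toClass] with z hz using by rw [hz]
  · filter_upwards [hu.coe_toClass, quasiMeasurePreserving_mul_tau.ae hu.coe_toClass] with z h3 h4
    rw [h3, h4, hτ, zpow_zero, one_mul]

/-! ### Rotation of the Fourier coefficients -/

theorem tau_mul_conj : conj τ * τ = 1 := by
  have h : ‖τ‖ = 1 := by
    rw [τ, show -(Real.pi * Complex.I / 3 : ℂ) = ((-(Real.pi / 3) : ℝ) : ℂ) * Complex.I by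
      push_cast; ring, Complex.norm_exp_ofReal_mul_I]
  rw [mul_comm, Complex.mul_conj, Complex.normSq_eq_norm_sq, h]
  simp

theorem tau_ne_zero : τ ≠ 0 := Complex.exp_ne_zero _

theorem Potential.apply_tau (V : Potential) (z : ℂ) : V (τ * z) = τ ^ 2 * V z := by
  rw [tau_eq, V.even, neg_mul, neg_neg, V.rot, neg_sq]

/-- The action of the rotation by `τ` on the dual lattice. -/
def rotIdx : (ℤ × ℤ) ≃ (ℤ × ℤ) where
  toFun n := (-n.2, n.1 + n.2)
  invFun n := (n.1 + n.2, -n.1)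
  left_inv n := by ext <;> simp
  right_inv n := by ext <;> simp

theorem rotIdx_sub (n m : ℤ × ℤ) : rotIdx (n - m) = rotIdx n - rotIdx m := by
  ext <;> simp [rotIdx]; ring
  ring

theorem rotIdx_zero : rotIdx 0 = 0 := by simp [rotIdx]

theorem expo_tau_mul (n : ℤ × ℤ) (z : ℂ) : expo n (τ * z) = expo (rotIdx n) z := by
  have h : τ * z = par ((par.symm z).2, (par.symm z).2 - (par.symm z).1) := by
    conv_lhs => rw [← par.apply_symm_apply z]
    rw [par_apply, par_apply, tau_eq]
    push_cast
    linear_combination (-((par.symm z).2 : ℂ)) * omega_sq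
  rw [expo, expo, h, phase_par]
  conv_rhs => rw [← par.apply_symm_apply z, phase_par]
  congr 1
  simp [rotIdx]
  ring

/-- Both sides are eigenvalues of `2D_{z̄}` on the same rotated character, one of them computed by
the chain rule. -/
theorem freq_rotIdx (n : ℤ × ℤ) : freq (rotIdx n) = conj τ * freq n := by
  have h1 := twoDzbar_expo (rotIdx n) 0
  rw [show expo (rotIdx n) = fun z => expo n (τ * z) from
    funext fun z => (expo_tau_mul n z).symm,
    twoDzbar_comp_const_mul ((isTest_expo n).differentiable _), twoDzbar_expo] at h1
  have h2 := expo_ne_zero n (τ * 0)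
  rw [← mul_assoc] at h1
  exact (mul_right_cancel₀ h2 h1).symm

theorem series_comp_tau (a : ℤ × ℤ → ℂ) (z : ℂ) :
    series a (τ * z) = series (fun n => a (rotIdx.symm n)) z := by
  simp only [series, expo_tau_mul]
  refine Eq.trans ?_ (rotIdx.tsum_eq fun n => a (rotIdx.symm n) * expo n z)
  exact tsum_congr fun n => by rw [Equiv.symm_apply_apply]

theorem IsTest.coef_comp_tau {f : ℂ → ℂ} (h : IsTest f) (n : ℤ × ℤ) :
    coef (fun z => f (τ * z)) (rotIdx n) = coef f n := by
  have hs : Summable fun n => ‖coef f (rotIdx.symm n)‖ :=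
    (Equiv.summable_iff rotIdx.symm).2 h.rapid.summable
  have e : (fun z => f (τ * z)) = series (fun n => coef f (rotIdx.symm n)) := by
    ext z
    rw [← series_comp_tau, h.series_coef]
  rw [e, coef_series hs, Equiv.symm_apply_apply]

theorem Potential.coef_rotIdx (V : Potential) (n : ℤ × ℤ) :
    τ ^ 2 * coef V (rotIdx n) = coef V n := by
  rw [← V.isTest.coef_comp_tau n, ← coef_const_mul]
  simp only [V.apply_tau]

/-! ### Compactness of the resolvent composed with the potential -/

/-- Bounded sequences on the dual lattice. -/
abbrev BddSeq : Type := BoundedContinuousFunction (ℤ × ℤ) ℂ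

/-- Convolution with a summable sequence. -/
def conv (v : ℤ × ℤ → ℂ) (hv : Summable fun n => ‖v n‖) : BddSeq →L[ℂ] BddSeq :=
  have hle (a : BddSeq) (n m : ℤ × ℤ) : ‖v m * a (n - m)‖ ≤ ‖v m‖ * ‖a‖ := by
    rw [norm_mul]
    gcongr
    exact a.norm_coe_le_norm _
  have hs (a : BddSeq) (n : ℤ × ℤ) : Summable fun m => v m * a (n - m) :=
    Summable.of_norm_bounded (hv.mul_right _) (hle a n)
  have hb (a : BddSeq) (n : ℤ × ℤ) : ‖∑' m, v m * a (n - m)‖ ≤ (∑' m, ‖v m‖) * ‖a‖ :=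
    tsum_of_norm_bounded (hv.hasSum.mul_right _) (hle a n)
  LinearMap.mkContinuous
    { toFun := fun a => BoundedContinuousFunction.ofNormedAddCommGroupDiscrete
        (fun n => ∑' m, v m * a (n - m)) _ (hb a)
      map_add' := fun a b => by
        ext n
        simp only [BoundedContinuousFunction.coe_ofNormedAddCommGroupDiscrete,
          BoundedContinuousFunction.coe_add, Pi.add_apply, mul_add]
        exact (hs a n).tsum_add (hs b n)
      map_smul' := fun c a => by
        ext n
        simp only [BoundedContinuousFunction.coe_ofNormedAddCommGroupDiscrete,
          BoundedContinuousFunction.coe_smul, RingHom.id_apply, smul_eq_mul]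
        rw [← tsum_mul_left]
        exact tsum_congr fun m => by ring }
    (∑' m, ‖v m‖) fun a => (BoundedContinuousFunction.norm_le (by
      exact mul_nonneg (tsum_nonneg fun m => norm_nonneg (v m)) (norm_nonneg a))).2 fun n => hb a n

theorem conv_apply (v : ℤ × ℤ → ℂ) (hv : Summable fun n => ‖v n‖) (a : BddSeq) (n : ℤ × ℤ) :
    conv v hv a n = ∑' m, v m * a (n - m) := rfl

/-- Multiplication by a sequence tending to zero is compact. -/
theorem isCompactOperator_mul (m : BddSeq) (hm : ∀ ε > 0, {n | ε ≤ ‖m n‖}.Finite) :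
    IsCompactOperator (ContinuousLinearMap.mul ℂ BddSeq m) := by
  classical
  let δ (n : ℤ × ℤ) : BddSeq := BoundedContinuousFunction.ofNormedAddCommGroupDiscrete
    (fun k => if k = n then 1 else 0) 1 fun k => by split_ifs <;> simp
  have hδ (n k : ℤ × ℤ) : δ n k = if k = n then 1 else 0 := rfl
  -- Multiplication by a sequence supported at one index factors through evaluation there, hence has
  -- rank at most one.
  have h1 (n : ℤ × ℤ) : IsCompactOperator (ContinuousLinearMap.mul ℂ BddSeq (m n • δ n)) := by
    have hc : IsCompactOperator (ContinuousLinearMap.toSpanSingleton ℂ (m n • δ n)) :=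
      isCompactOperator_of_locallyCompactSpace_rng _
    replace hc := hc.comp_clm (BoundedContinuousFunction.evalCLM ℂ n)
    convert! hc using 1
    ext a k
    by_cases hk : k = n
    · simp [hδ, hk, mul_comm]
    · simp [hδ, hk]
  -- Decay of `m` means that its finite truncations converge in the supremum norm, so the operator
  -- is a norm limit of finite rank operators.
  have h2 : Tendsto (fun s : Finset (ℤ × ℤ) => ∑ n ∈ s, m n • δ n) atTop (𝓝 m) := by
    rw [Metric.tendsto_atTop]
    intro ε hε
    refine ⟨(hm (ε / 2) (by positivity)).toFinset, fun s hs => ?_⟩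
    rw [dist_eq_norm]
    refine lt_of_le_of_lt ((BoundedContinuousFunction.norm_le (by positivity)).2 fun k => ?_)
      (half_lt_self hε)
    have e : (∑ n ∈ s, m n • δ n) k = if k ∈ s then m k else 0 := by
      rw [BoundedContinuousFunction.coe_sum, Finset.sum_apply]
      simp [hδ]
    rw [BoundedContinuousFunction.coe_sub, Pi.sub_apply, e]
    split_ifs with hk
    · simp; positivity
    · rw [zero_sub, norm_neg]
      by_contra hc
      exact hk (hs ((hm (ε / 2) (by positivity)).mem_toFinset.2 (not_le.1 hc).le))
  refine isCompactOperator_of_tendsto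
    (((ContinuousLinearMap.mul ℂ BddSeq).continuous.tendsto m).comp h2)
    (Eventually.of_forall fun s => ?_)
  simp only [Function.comp_apply, map_sum]
  exact (compactOperator (RingHom.id ℂ) BddSeq BddSeq).sum_mem fun n _ => h1 n

/-- The symbol `α² ξ⁻²`. -/
def symbol (α : ℂ) : BddSeq := BoundedContinuousFunction.ofNormedAddCommGroupDiscrete
  (fun n => α ^ 2 * (freq n ^ 2)⁻¹) (‖α ^ 2‖ * 4) fun n => by
    rw [norm_mul]
    gcongr
    -- At zero frequency the inverse is `0` by convention, so the symbol projects out the constants.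
    by_cases hn : n = 0
    · simp [hn, freq]
    · have h1 := wt_le_norm_freq n
      have h2 : 1 ≤ |(n.1 : ℝ)| + |(n.2 : ℝ)| := by
        have : 1 ≤ |n.1| + |n.2| := by
          by_contra hc
          have h3 := abs_nonneg n.1
          have h4 := abs_nonneg n.2
          exact hn (Prod.ext (abs_eq_zero.1 (by omega)) (abs_eq_zero.1 (by omega)))
        exact_mod_cast this
      rw [wt] at h1
      have h3 : 1 ≤ ‖freq n‖ := by linarith
      rw [norm_inv, norm_pow]
      exact (inv_le_one_of_one_le₀ (one_le_pow₀ h3)).trans (by norm_num)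

theorem symbol_apply (α : ℂ) (n : ℤ × ℤ) : symbol α n = α ^ 2 * (freq n ^ 2)⁻¹ := rfl

theorem finite_le_symbol (α : ℂ) (ε : ℝ) (hε : 0 < ε) : {n | ε ≤ ‖symbol α n‖}.Finite := by
  refine (finite_wt_le (2 + ‖α ^ 2‖ / ε)).subset fun n hn => ?_
  have hn' : ε ≤ ‖symbol α n‖ := hn
  have h1 := wt_le_norm_freq n
  show wt n ≤ _
  rw [symbol_apply, norm_mul, norm_inv, norm_pow (freq n)] at hn'
  by_contra hc
  have h2 : 0 ≤ ‖α ^ 2‖ / ε := by positivity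
  have h3 : 1 + ‖α ^ 2‖ / ε < ‖freq n‖ := by linarith [not_le.1 hc]
  have h4 : ‖α ^ 2‖ / ε < ‖freq n‖ ^ 2 := by nlinarith
  have h5 : 0 < ‖freq n‖ ^ 2 := lt_of_le_of_lt h2 h4
  rw [div_lt_iff₀ hε] at h4
  rw [← div_eq_mul_inv, le_div_iff₀ h5] at hn'
  linarith

/-- Rotation invariant bounded sequences. -/
def invSeq : Submodule ℂ BddSeq where
  carrier := {a | ∀ n, a (rotIdx n) = a n}
  zero_mem' := fun _ => rfl
  add_mem' := fun ha hb n => by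
    simp only [BoundedContinuousFunction.coe_add, Pi.add_apply, ha n, hb n]
  smul_mem' := fun c a ha n => by
    simp only [BoundedContinuousFunction.coe_smul, ha n]

theorem isClosed_invSeq : IsClosed (invSeq : Set BddSeq) := by
  have : (invSeq : Set BddSeq) = ⋂ n, {a : BddSeq | a (rotIdx n) = a n} := by
    ext a; simp [invSeq]
  rw [this]
  exact isClosed_iInter fun n => isClosed_eq
    (BoundedContinuousFunction.evalCLM ℂ (rotIdx n)).continuous
    (BoundedContinuousFunction.evalCLM ℂ n).continuous

/-- Convolution with the coefficients of `V` takes invariant sequences to weight `τ⁻²`; the weight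
`τ²` of the symbol in `symbol_rotIdx` compensates, so the product preserves `invSeq`. -/
theorem conv_rotIdx (V : Potential) {a : BddSeq} (ha : a ∈ invSeq) (n : ℤ × ℤ) :
    τ ^ 2 * conv (coef V) V.isTest.rapid.summable a (rotIdx n) =
      conv (coef V) V.isTest.rapid.summable a n := by
  rw [conv_apply, conv_apply, ← tsum_mul_left, ← rotIdx.tsum_eq]
  refine tsum_congr fun m => ?_
  rw [← rotIdx_sub, ha, ← V.coef_rotIdx m]
  ring

theorem tau_sq_ne_one : τ ^ 2 ≠ 1 := by
  rw [tau_eq, neg_sq, omega_sq]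
  intro h
  have := congrArg Complex.im h
  simp [omega_im] at this

theorem symbol_rotIdx (α : ℂ) (n : ℤ × ℤ) : symbol α (rotIdx n) = τ ^ 2 * symbol α n := by
  have h := tau_mul_conj
  have h0 := tau_ne_zero
  have e : conj τ = τ⁻¹ := eq_inv_of_mul_eq_one_left h
  rw [symbol_apply, symbol_apply, freq_rotIdx, e, mul_pow, mul_inv, inv_pow, inv_inv]
  ring

/-- Fredholm alternative for the compact operator `K` (symbol times convolution) on invariant
sequences. Constants are invariant while the product with `V` has another weight and no constant
term, so a solution of `a - K a = c δ₀` solves the equation at every frequency, whatever `c` is. -/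
theorem exists_invSeq (V : Potential) (α : ℂ) : ∃ a ∈ invSeq, a ≠ 0 ∧
    ∀ n, freq n ^ 2 * a n = α ^ 2 * conv (coef V) V.isTest.rapid.summable a n := by
  classical
  set C := conv (coef V) V.isTest.rapid.summable with hC
  let K : BddSeq →L[ℂ] BddSeq := (ContinuousLinearMap.mul ℂ BddSeq (symbol α)).comp C
  have hK (a : BddSeq) (n : ℤ × ℤ) : K a n = symbol α n * C a n := rfl
  have hKc : IsCompactOperator K := (isCompactOperator_mul _ (finite_le_symbol α)).comp_clm C
  have hinv (a : BddSeq) (ha : a ∈ invSeq) : K a ∈ invSeq := fun n => by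
    rw [hK, hK, symbol_rotIdx, hC, ← conv_rotIdx V ha n]
    ring
  let T : invSeq →L[ℂ] invSeq := (K.comp invSeq.subtypeL).codRestrict invSeq
    fun a => hinv a.1 a.2
  have hT : IsCompactOperator T :=
    (hKc.comp_clm invSeq.subtypeL).codRestrict (fun a => hinv a.1 a.2) isClosed_invSeq
  have : CompleteSpace invSeq := isClosed_invSeq.completeSpace_coe
  let δ₀ : BddSeq := BoundedContinuousFunction.ofNormedAddCommGroupDiscrete
    (fun k => if k = 0 then 1 else 0) 1 fun k => by split_ifs <;> simp
  have hδ (k : ℤ × ℤ) : δ₀ k = if k = 0 then 1 else 0 := rfl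
  have hδm : δ₀ ∈ invSeq := fun n => by
    have : rotIdx n = 0 ↔ n = 0 := by
      conv_lhs => rw [← rotIdx_zero]
      exact rotIdx.injective.eq_iff
    simp only [hδ, this]
  -- If `1` is an eigenvalue take an eigenvector and `c = 0`; otherwise `1 - K` is bijective and
  -- `δ₀` has a preimage, giving `c = 1`.
  have key : ∃ a : invSeq, a ≠ 0 ∧ ∃ c : ℂ, ∀ n, a.1 n = c * δ₀ n + K a.1 n := by
    rcases hT.hasEigenvalue_or_mem_resolventSet one_ne_zero with h | h
    · obtain ⟨a, ha⟩ := h.exists_hasEigenvector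
      refine ⟨a, ha.2, 0, fun n => ?_⟩
      have h1 : T a = a := by simpa using ha.apply_eq_smul
      have h2 := congrArg (fun b : invSeq => b.1 n) h1
      rw [zero_mul, zero_add]
      exact h2.symm
    · rw [spectrum.mem_resolventSet_iff, ContinuousLinearMap.isUnit_iff_bijective] at h
      obtain ⟨a, ha⟩ := h.2 ⟨δ₀, hδm⟩
      have h1 (n) : a.1 n - K a.1 n = δ₀ n := by
        have h2 := congrArg (fun b : invSeq => b.1 n) ha
        simp only [map_one, _root_.sub_apply, one_apply_eq_self] at h2
        exact h2
      refine ⟨a, ?_, 1, fun n => by rw [← h1 n]; ring⟩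
      rintro rfl
      have h2 := h1 0
      simp [hδ] at h2
  obtain ⟨⟨a, ha⟩, h0, c, hc⟩ := key
  refine ⟨a, ha, fun h => h0 (Subtype.ext h), fun n => ?_⟩
  -- The index `0` is fixed by the rotation, so the convolution there equals `τ²` times itself and
  -- vanishes; the left side vanishes since `freq 0 = 0`.
  by_cases hn : n = 0
  · subst hn
    have h1 := conv_rotIdx V ha 0
    rw [rotIdx_zero] at h1
    have h2 : C a 0 = 0 := by
      have h3 : (τ ^ 2 - 1) * C a 0 = 0 := by rw [hC]; linear_combination h1
      exact (mul_eq_zero.1 h3).resolve_left (sub_ne_zero.2 tau_sq_ne_one)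
    rw [h2]
    simp [freq]
  · have h1 : freq n ≠ 0 := fun h => hn (freq_eq_zero h)
    have h2 := hc n
    rw [hδ, if_neg hn, hK, symbol_apply] at h2
    show freq n ^ 2 * a n = _
    rw [h2]
    field_simp
    ring

theorem exists_isProtectedState (V : Potential) (α : ℂ) : ∃ u, IsProtectedState V α u := by
  obtain ⟨a, ha, h0, h⟩ := exists_invSeq V α
  have hV := V.isTest.rapid
  -- Bootstrap from boundedness to rapid decay; of the two powers gained by inverting `freq n ^ 2`
  -- only one is used.
  have hr (N : ℕ) : ∃ C, ∀ n, wt n ^ N * ‖a n‖ ≤ C := by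
    induction N with
    | zero => exact ⟨‖a‖, fun n => by rw [pow_zero, one_mul]; exact a.norm_coe_le_norm n⟩
    | succ N ih =>
      obtain ⟨C₁, hC₁⟩ := hV.bounded_conv N ih
      obtain ⟨C₀, hC₀⟩ := ih
      refine ⟨2 * C₀ + ‖α ^ 2‖ * C₁, fun n => ?_⟩
      have h1 : wt n ≤ 2 + ‖freq n‖ ^ 2 := by
        have := wt_le_norm_freq n
        nlinarith [sq_nonneg (‖freq n‖ - 1 / 2)]
      have h2 : ‖freq n‖ ^ 2 * ‖a n‖ = ‖α ^ 2‖ * ‖∑' m, coef V m * a (n - m)‖ := by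
        rw [← norm_pow, ← norm_mul, h, norm_mul, conv_apply]
      have h3 := wt_pos n
      calc wt n ^ (N + 1) * ‖a n‖ = wt n ^ N * (wt n * ‖a n‖) := by ring
        _ ≤ wt n ^ N * ((2 + ‖freq n‖ ^ 2) * ‖a n‖) := by gcongr
        _ = 2 * (wt n ^ N * ‖a n‖) + wt n ^ N * (‖freq n‖ ^ 2 * ‖a n‖) := by ring
        _ = 2 * (wt n ^ N * ‖a n‖) +
            ‖α ^ 2‖ * (wt n ^ N * ‖∑' m, coef V m * a (n - m)‖) := by rw [h2]; ring
        _ ≤ _ := by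
          have := hC₀ n
          have := hC₁ n
          gcongr
  have hR : Rapid a := hr
  have hs := isTest_series hR
  have hco (n) := coef_series hR.summable n
  refine ⟨series a, isProtectedState_of_smooth hs ?_ ?_ ?_⟩
  · intro hz
    refine h0 (BoundedContinuousFunction.ext fun n => ?_)
    rw [← hco, hz]
    exact coef_zero n
  · intro z
    rw [series_comp_tau]
    congr 1
    ext n
    have := ha (rotIdx.symm n)
    rw [Equiv.apply_symm_apply] at this
    exact this.symm
  · have e := eq_of_coef_eq (f := twoDzbar (twoDzbar (series a)))
      (g := fun z => V z * (α ^ 2 * series a z)) hs.twoDzbar.twoDzbar.continuous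
      (V.isTest.mul (hs.const_mul _)).continuous hs.twoDzbar.twoDzbar.periodic
      (V.isTest.mul (hs.const_mul _)).periodic fun n => by
        have e1 := coef_twoDzbar hs.twoDzbar 0 n
        have e2 := coef_twoDzbar hs 0 n
        simp only [zero_mul, add_zero, zero_add] at e1 e2
        rw [V.isTest.coef_mul (integrableOn_cell_of_continuous (hs.const_mul _).continuous),
          show coef (twoDzbar (twoDzbar (series a))) n = _ from e1,
          show coef (twoDzbar (series a)) n = _ from e2, hco, ← mul_assoc, ← sq, h, conv_apply,
          ← tsum_mul_left]
        refine tsum_congr fun m => ?_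
        rw [coef_const_mul, hco]
        ring
    intro z
    rw [e]
    ring

/-! ### Complex derivatives -/

/-- The Cauchy–Riemann equation at a single point makes the real differential complex linear; no
neighbourhood is needed, which is essential at zeros of solutions. -/
theorem hasDerivAt_of_twoDzbar_eq_zero {f : ℂ → ℂ} {z : ℂ} (hf : DifferentiableAt ℝ f z)
    (h : twoDzbar f z = 0) : HasDerivAt f (dz f z) z := by
  have hI := Complex.I_ne_zero
  have h1 : dx1 f z + Complex.I * dx2 f z = 0 := by
    rw [twoDzbar] at h
    exact (mul_eq_zero.1 h).resolve_left (by simp)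
  have h2 : dz f z = fderiv ℝ f z 1 := by
    rw [dz]
    simp only [dx1, dx2] at h1 ⊢
    linear_combination (-1 / 2 : ℂ) * h1
  have h3 : fderiv ℝ f z Complex.I = Complex.I * fderiv ℝ f z 1 := by
    simp only [dx1, dx2] at h1
    linear_combination (-Complex.I) * h1 + fderiv ℝ f z Complex.I * Complex.I_sq
  rw [hasDerivAt_iff_hasFDerivAt]
  refine hasFDerivAt_of_restrictScalars ℝ hf.hasFDerivAt ?_
  ext v
  have h4 : fderiv ℝ f z v = v.re * fderiv ℝ f z 1 + v.im * fderiv ℝ f z Complex.I := by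
    have e : v = v.re • (1 : ℂ) + v.im • Complex.I := by simp
    conv_lhs => rw [e]
    rw [map_add, map_smul, map_smul]
    simp
  have h5 : v = v.re + v.im * Complex.I := (Complex.re_add_im v).symm
  simp only [ContinuousLinearMap.coe_restrictScalars', ContinuousLinearMap.toSpanSingleton_apply,
    smul_eq_mul]
  rw [h4, h2, h3]
  conv_lhs => rw [h5]
  ring

theorem twoDzbar_of_hasDerivAt {f : ℂ → ℂ} {f' z : ℂ} (hf : HasDerivAt f f' z) :
    twoDzbar f z = 0 := by
  have h := (hf.hasFDerivAt.restrictScalars ℝ).fderiv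
  simp only [twoDzbar, dx1, dx2]
  rw [h]
  simp
  linear_combination f' * Complex.I_mul_I

theorem twoDzbar_congr {f g : ℂ → ℂ} {z : ℂ} (h : f =ᶠ[𝓝 z] g) : twoDzbar f z = twoDzbar g z := by
  simp only [twoDzbar, dx1, dx2, h.fderiv_eq]

theorem twoDzbar_comp_sub {f : ℂ → ℂ} (a z : ℂ) :
    twoDzbar (fun w => f (w - a)) z = twoDzbar f (z - a) := by
  simp only [twoDzbar, dx1, dx2, fderiv_comp_sub]

/-- A smooth function with vanishing value and vanishing `∂̄` derivative can be divided by the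
coordinate. -/
theorem tendsto_div_sub {f : ℂ → ℂ} {p : ℂ} (hf : DifferentiableAt ℝ f p) (h0 : f p = 0)
    (h : twoDzbar f p = 0) : Tendsto (fun z => f z / (z - p)) (𝓝[≠] p) (𝓝 (dz f p)) := by
  have := hasDerivAt_iff_tendsto_slope.1 (hasDerivAt_of_twoDzbar_eq_zero hf h)
  refine this.congr fun z => ?_
  rw [slope_def_field, h0, sub_zero]

/-! ### Reduction modulo the lattice -/

/-- The lattice point with the nearest coordinates. -/
def nearLat (z : ℂ) : ℂ := (round (par.symm z).1 : ℂ) + (round (par.symm z).2 : ℂ) * ω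

theorem nearLat_mem (z : ℂ) : nearLat z ∈ lattice := ⟨_, _, rfl⟩

/-- The representative modulo the lattice with coordinates in `[-1/2, 1/2]`. -/
def red (z : ℂ) : ℂ := z - nearLat z

theorem par_symm_add_lattice (z : ℂ) (m n : ℤ) :
    par.symm (z + (m + n * ω)) = par.symm z + ((m : ℝ), (n : ℝ)) := by
  rw [map_add]
  congr 1
  apply par.injective
  rw [par.apply_symm_apply]
  simp [par_apply]

theorem red_periodic {γ : ℂ} (hγ : γ ∈ lattice) (z : ℂ) : red (z + γ) = red z := by
  obtain ⟨m, n, rfl⟩ := hγ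
  rw [red, red, nearLat, nearLat, par_symm_add_lattice]
  simp only [Prod.fst_add, Prod.snd_add, round_add_intCast]
  push_cast
  ring

theorem par_symm_lattice (m n : ℤ) : par.symm (m + n * ω) = ((m : ℝ), (n : ℝ)) := by
  apply par.injective
  rw [par.apply_symm_apply]
  simp [par_apply]

theorem nearLat_of_mem {γ : ℂ} (hγ : γ ∈ lattice) : nearLat γ = γ := by
  obtain ⟨m, n, rfl⟩ := hγ
  rw [nearLat, par_symm_lattice]
  simp

theorem red_eq_zero_iff {z : ℂ} : red z = 0 ↔ z ∈ lattice := by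
  constructor
  · intro h
    rw [red, sub_eq_zero] at h
    rw [h]; exact nearLat_mem z
  · intro h
    rw [red, nearLat_of_mem h, sub_self]

theorem abs_par_symm_le (w : ℂ) :
    |(par.symm w).1| ≤ 2 * ‖w‖ ∧ |(par.symm w).2| ≤ 2 * ‖w‖ := by
  have h3 : (1 : ℝ) < Real.sqrt 3 := by
    rw [Real.lt_sqrt (by norm_num)]; norm_num
  have h1 := Complex.abs_re_le_norm w
  have h2 := Complex.abs_im_le_norm w
  have e2 : (par.symm w).2 * Real.sqrt 3 = 2 * w.im := by
    rw [par_symm_apply, omega_im]; field_simp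
  have e1 : (par.symm w).1 = w.re + (par.symm w).2 / 2 := by
    rw [par_symm_apply, omega_re]; ring
  have b2 : |(par.symm w).2| ≤ 2 * ‖w‖ := by
    have h4 : |(par.symm w).2| * Real.sqrt 3 = 2 * |w.im| := by
      rw [← abs_of_pos (one_pos.trans h3), ← abs_mul, e2, abs_mul, abs_two]
    nlinarith [abs_nonneg (par.symm w).2]
  refine ⟨?_, b2⟩
  have h5 := abs_add_le w.re ((par.symm w).2 / 2)
  rw [← e1, abs_div, abs_two] at h5
  linarith

theorem round_eq_of_abs_sub_lt {x : ℝ} {m : ℤ} (h : |x - m| < 1 / 2) : round x = m := by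
  have h1 := abs_sub_round x
  have h2 := abs_sub_le (round x : ℝ) x m
  rw [abs_sub_comm (round x : ℝ) x] at h2
  have h3 : |((round x - m : ℤ) : ℝ)| < 1 := by push_cast; linarith
  have h4 : |round x - m| < 1 := by exact_mod_cast h3
  rw [Int.abs_lt_one_iff] at h4
  omega

theorem par_symm_sub_lattice (z : ℂ) (m n : ℤ) :
    par.symm (z - (m + n * ω)) = ((par.symm z).1 - m, (par.symm z).2 - n) := by
  rw [map_sub, par_symm_lattice]; rfl

theorem nearLat_eq_of_norm_lt {z : ℂ} {γ : ℂ} (hγ : γ ∈ lattice) (h : ‖z - γ‖ < 1 / 8) :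
    nearLat z = γ := by
  obtain ⟨m, n, rfl⟩ := hγ
  have h1 := abs_par_symm_le (z - (m + n * ω))
  rw [par_symm_sub_lattice] at h1
  rw [nearLat, round_eq_of_abs_sub_lt (m := m) (by linarith [h1.1]),
    round_eq_of_abs_sub_lt (m := n) (by linarith [h1.2])]

/-- Functions supported near the origin, extended periodically, locally are translates. -/
theorem eventually_comp_red {b : ℂ → ℂ} (hb : ∀ w, 1 / 8 ≤ ‖w‖ → b w = 0) (z₀ : ℂ) :
    ∀ᶠ z in 𝓝 z₀, b (red z) = b (z - nearLat z₀) := by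
  have hc : Continuous par.symm := par.symm.continuous
  have e1 : ∀ᶠ z in 𝓝 z₀, |(par.symm z).1 - (par.symm z₀).1| < 1 / 8 := by
    have h : Tendsto (fun z => |(par.symm z).1 - (par.symm z₀).1|) (𝓝 z₀) (𝓝 0) := by
      have : Continuous fun z => |(par.symm z).1 - (par.symm z₀).1| := by fun_prop
      simpa using this.tendsto z₀
    exact h.eventually (gt_mem_nhds (by norm_num))
  have e2 : ∀ᶠ z in 𝓝 z₀, |(par.symm z).2 - (par.symm z₀).2| < 1 / 8 := by
    have h : Tendsto (fun z => |(par.symm z).2 - (par.symm z₀).2|) (𝓝 z₀) (𝓝 0) := by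
      have : Continuous fun z => |(par.symm z).2 - (par.symm z₀).2| := by fun_prop
      simpa using this.tendsto z₀
    exact h.eventually (gt_mem_nhds (by norm_num))
  filter_upwards [e1, e2] with z h1 h2
  by_cases hz : ‖red z‖ < 1 / 8
  · have h3 := abs_par_symm_le (red z)
    rw [red, nearLat, par_symm_sub_lattice] at h3
    dsimp only at h3
    rw [red, nearLat] at hz
    have a1 := abs_sub_le (par.symm z₀).1 (par.symm z).1 (round (par.symm z).1 : ℝ)
    have a2 := abs_sub_le (par.symm z₀).2 (par.symm z).2 (round (par.symm z).2 : ℝ)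
    rw [abs_sub_comm (par.symm z₀).1 (par.symm z).1] at a1
    rw [abs_sub_comm (par.symm z₀).2 (par.symm z).2] at a2
    have r1 : round (par.symm z₀).1 = round (par.symm z).1 :=
      round_eq_of_abs_sub_lt (by linarith [h3.1])
    have r2 : round (par.symm z₀).2 = round (par.symm z).2 :=
      round_eq_of_abs_sub_lt (by linarith [h3.2])
    rw [red, nearLat, nearLat, r1, r2]
  · rw [hb _ (not_lt.1 hz), hb]
    by_contra hc
    have h3 := nearLat_eq_of_norm_lt (nearLat_mem z₀) (not_le.1 hc)
    rw [red, h3] at hz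
    exact hz (not_le.1 hc)

theorem eventually_notMem_lattice (z₀ : ℂ) : ∀ᶠ z in 𝓝[≠] z₀, z ∉ lattice := by
  classical
  have h := eventually_comp_red (b := fun w => if w = 0 then 1 else 0) (fun w hw => by
    rw [if_neg]
    rintro rfl
    rw [norm_zero] at hw
    norm_num at hw) z₀
  have h1 : ∀ᶠ z in 𝓝[≠] z₀, z ≠ nearLat z₀ := by
    by_cases h0 : nearLat z₀ = z₀
    · rw [h0]; exact eventually_mem_nhdsWithin
    · exact eventually_nhdsWithin_of_eventually_nhds
        ((continuous_id.tendsto z₀).eventually_ne (Ne.symm h0))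
  filter_upwards [eventually_nhdsWithin_of_eventually_nhds h, h1] with z h2 h3 h4
  rw [if_pos (red_eq_zero_iff.2 h4), if_neg (sub_ne_zero.2 h3)] at h2
  exact one_ne_zero h2

/-- The translate `p + Λ`. -/
def orbit (p : ℂ) : Set ℂ := {z | z - p ∈ lattice}

theorem mem_orbit {p z : ℂ} : z ∈ orbit p ↔ z - p ∈ lattice := Iff.rfl

theorem self_mem_orbit (p : ℂ) : p ∈ orbit p := by
  rw [mem_orbit, sub_self]; exact lattice.zero_mem

theorem add_mem_orbit {p z γ : ℂ} (hγ : γ ∈ lattice) : z + γ ∈ orbit p ↔ z ∈ orbit p := by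
  rw [mem_orbit, mem_orbit, add_sub_right_comm]
  exact lattice.add_mem_cancel_right hγ

theorem countable_orbit (p : ℂ) : (orbit p).Countable :=
  countable_lattice.preimage (sub_left_injective (b := p))

theorem tendsto_sub_punctured (p z₀ : ℂ) : Tendsto (fun z => z - p) (𝓝[≠] z₀) (𝓝[≠] (z₀ - p)) := by
  refine tendsto_nhdsWithin_iff.2 ⟨?_, ?_⟩
  · exact ((continuous_id.sub continuous_const).tendsto z₀).mono_left nhdsWithin_le_nhds
  · filter_upwards [eventually_mem_nhdsWithin] with z hz h
    exact hz (sub_left_injective h)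

theorem eventually_notMem_orbit (p z₀ : ℂ) : ∀ᶠ z in 𝓝[≠] z₀, z ∉ orbit p :=
  (tendsto_sub_punctured p z₀).eventually (eventually_notMem_lattice (z₀ - p))

/-! ### The local model of a simple pole -/

/-- A radial cut-off function in the variable `|w|²`. -/
def cutoff (x : ℝ) : ℝ := Real.smoothTransition (2 - 128 * x)

theorem contDiff_cutoff : ContDiff ℝ (⊤ : ℕ∞) cutoff :=
  Real.smoothTransition.contDiff.comp (contDiff_const.sub (contDiff_const.mul contDiff_id))

theorem cutoff_of_le {x : ℝ} (h : x ≤ 1 / 128) : cutoff x = 1 :=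
  Real.smoothTransition.one_of_one_le (by linarith)

theorem cutoff_of_ge {x : ℝ} (h : 1 / 64 ≤ x) : cutoff x = 0 :=
  Real.smoothTransition.zero_of_nonpos (by linarith)

theorem normSq_ge {w : ℂ} (h : 1 / 8 ≤ ‖w‖) : 1 / 64 ≤ Complex.normSq w := by
  rw [Complex.normSq_eq_norm_sq]
  nlinarith

/-- The radial cut-off function. -/
def bump (w : ℂ) : ℂ := (cutoff (Complex.normSq w) : ℝ)

theorem contDiff_normSq : ContDiff ℝ (⊤ : ℕ∞) Complex.normSq := by
  have : (Complex.normSq : ℂ → ℝ) = fun z => Complex.reCLM z * Complex.reCLM z +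
      Complex.imCLM z * Complex.imCLM z := by
    ext z; simp [Complex.normSq_apply]
  rw [this]
  exact (Complex.reCLM.contDiff.mul Complex.reCLM.contDiff).add
    (Complex.imCLM.contDiff.mul Complex.imCLM.contDiff)

theorem contDiff_bump : ContDiff ℝ (⊤ : ℕ∞) bump :=
  Complex.ofRealCLM.contDiff.comp (contDiff_cutoff.comp contDiff_normSq)

theorem bump_zero : bump 0 = 1 := by
  rw [bump, cutoff_of_le (by simp)]; simp

theorem bump_of_ge {w : ℂ} (h : 1 / 8 ≤ ‖w‖) : bump w = 0 := by
  rw [bump, cutoff_of_ge (normSq_ge h)]; simp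

/-- Because the cut-off is radial, its `∂̄` derivative carries a factor `w`, which cancels the pole
of the local model and makes `poleSource` smooth. -/
theorem twoDzbar_bump (w : ℂ) :
    twoDzbar bump w = -2 * Complex.I * (deriv cutoff (Complex.normSq w) : ℝ) * w := by
  have h1 : HasFDerivAt Complex.normSq
      ((2 * w.re) • Complex.reCLM + (2 * w.im) • Complex.imCLM) w := by
    have e : (Complex.normSq : ℂ → ℝ) = fun z => Complex.reCLM z * Complex.reCLM z +
        Complex.imCLM z * Complex.imCLM z := by
      ext z; simp [Complex.normSq_apply]
    rw [e]
    have h2 := (Complex.reCLM.hasFDerivAt (x := w))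
    have h3 := (Complex.imCLM.hasFDerivAt (x := w))
    convert! (h2.mul h2).add (h3.mul h3) using 1
    ext v
    simp
    ring
  have h4 : HasDerivAt cutoff (deriv cutoff (Complex.normSq w)) (Complex.normSq w) :=
    (contDiff_cutoff.differentiable (by simp) _).hasDerivAt
  have h5 := (Complex.ofRealCLM.hasFDerivAt (x := cutoff (Complex.normSq w))).comp w
    (h4.comp_hasFDerivAt w h1)
  have e : bump = Complex.ofRealCLM ∘ cutoff ∘ Complex.normSq := rfl
  simp only [twoDzbar, dx1, dx2]
  rw [e, h5.fderiv]
  have h6 : w = w.re + w.im * Complex.I := (Complex.re_add_im w).symm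
  generalize deriv cutoff (Complex.normSq w) = d
  simp
  linear_combination (-2 * Complex.I * d) * h6

/-- The exponential factor `exp (κ w̄ / 2i)`. -/
def twist (κ w : ℂ) : ℂ := Complex.exp (κ / (2 * Complex.I) * conj w)

theorem contDiff_twist (κ : ℂ) : ContDiff ℝ (⊤ : ℕ∞) (twist κ) :=
  (contDiff_const.mul Complex.conjCLE.contDiff).cexp

theorem twist_zero (κ : ℂ) : twist κ 0 = 1 := by simp [twist]

theorem twoDzbar_twist (κ w : ℂ) : twoDzbar (twist κ) w = -κ * twist κ w := by
  have h := ((Complex.conjCLE.toContinuousLinearMap.hasFDerivAt (x := w)).const_mul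
    (κ / (2 * Complex.I))).cexp
  have e : twist κ = fun w => Complex.exp (κ / (2 * Complex.I) *
      Complex.conjCLE.toContinuousLinearMap w) := by
    ext z; simp [twist]
  simp only [twoDzbar, dx1, dx2]
  rw [e, h.fderiv]
  have hI := Complex.I_ne_zero
  simp
  field_simp
  rw [Complex.I_sq]
  ring

/-- The numerator of the local model. -/
def poleNum (κ w : ℂ) : ℂ := bump w * twist κ w

theorem contDiff_poleNum (κ : ℂ) : ContDiff ℝ (⊤ : ℕ∞) (poleNum κ) :=
  contDiff_bump.mul (contDiff_twist κ)

theorem poleNum_zero (κ : ℂ) : poleNum κ 0 = 1 := by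
  rw [poleNum, bump_zero, twist_zero, mul_one]

/-- The local model of a simple pole. -/
def poleModel (κ w : ℂ) : ℂ := poleNum κ w / w

/-- The image of the local model under `2D_{z̄} + κ`. -/
def poleSource (κ w : ℂ) : ℂ :=
  -2 * Complex.I * (deriv cutoff (Complex.normSq w) : ℝ) * twist κ w

theorem contDiff_poleSource (κ : ℂ) : ContDiff ℝ (⊤ : ℕ∞) (poleSource κ) := by
  have h : ContDiff ℝ (⊤ : ℕ∞) (deriv cutoff) := contDiff_infty_iff_deriv.1 contDiff_cutoff |>.2
  exact (contDiff_const.mul (Complex.ofRealCLM.contDiff.comp (h.comp contDiff_normSq))).mul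
    (contDiff_twist κ)

theorem poleModel_of_ge {κ w : ℂ} (h : 1 / 8 ≤ ‖w‖) : poleModel κ w = 0 := by
  rw [poleModel, poleNum, bump_of_ge h]; simp

/-- The fixed sign is what makes the mean of the source nonzero in `coef_periodicSource_ne_zero`. -/
theorem deriv_cutoff_nonpos (x : ℝ) : deriv cutoff x ≤ 0 := by
  have : Antitone cutoff := fun x y h => Real.smoothTransition.monotone (by linarith)
  exact this.deriv_nonpos

theorem poleSource_of_ge {κ w : ℂ} (h : 1 / 8 ≤ ‖w‖) : poleSource κ w = 0 := by
  have h1 : deriv cutoff (Complex.normSq w) = 0 := by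
    refine IsLocalMin.deriv_eq_zero (Eventually.of_forall fun y => ?_)
    rw [cutoff_of_ge (normSq_ge h)]
    exact Real.smoothTransition.nonneg _
  rw [poleSource, h1]; simp

theorem contDiffAt_poleModel {κ w : ℂ} (hw : w ≠ 0) : ContDiffAt ℝ (⊤ : ℕ∞) (poleModel κ) w :=
  ((contDiff_poleNum κ).contDiffAt.mul (contDiffAt_id.inv hw)).congr_of_eventuallyEq
    (Eventually.of_forall fun _ => div_eq_mul_inv _ _)

theorem twoDzbar_poleNum (κ w : ℂ) :
    twoDzbar (poleNum κ) w + κ * poleNum κ w = poleSource κ w * w := by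
  have e : poleNum κ = fun w => bump w * twist κ w := rfl
  rw [e, twoDzbar_mul (contDiff_bump.differentiable (by simp) w)
    ((contDiff_twist κ).differentiable (by simp) w), twoDzbar_bump, twoDzbar_twist, poleSource]
  ring

theorem twoDzbar_div_sub {f : ℂ → ℂ} {p z : ℂ} (hz : z ≠ p) (hf : DifferentiableAt ℝ f z) :
    twoDzbar (fun w => f w / (w - p)) z = twoDzbar f z / (z - p) := by
  have h0 : z - p ≠ 0 := sub_ne_zero.2 hz
  have hd : HasDerivAt (fun w : ℂ => (w - p)⁻¹) (-1 / (z - p) ^ 2) z :=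
    ((hasDerivAt_id z).sub_const p).inv h0
  simp only [div_eq_mul_inv]
  rw [twoDzbar_mul hf (hd.hasFDerivAt.restrictScalars ℝ).differentiableAt,
    twoDzbar_of_hasDerivAt hd, mul_zero, add_zero]

theorem twoDzbar_poleModel {κ w : ℂ} (hw : w ≠ 0) :
    twoDzbar (poleModel κ) w + κ * poleModel κ w = poleSource κ w := by
  have e : poleModel κ = fun w => poleNum κ w / (w - 0) := by ext w; rw [sub_zero]; rfl
  rw [e, twoDzbar_div_sub hw ((contDiff_poleNum κ).differentiable (by simp) w), sub_zero]
  have := twoDzbar_poleNum κ w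
  simp only [sub_zero]
  field_simp
  linear_combination this

/-! ### Periodic functions with simple poles -/

/-- `Φ` is periodic, smooth with `(2D_{z̄} + κ) Φ = 0` off the discrete set `P`, and has simple
poles with residue `r p` at the points `p` of `P`. -/
structure HasPoles (κ : ℂ) (P : Set ℂ) (r Φ : ℂ → ℂ) : Prop where
  countable : P.Countable
  discrete : ∀ z, ∀ᶠ w in 𝓝[≠] z, w ∉ P
  set_periodic : ∀ γ ∈ lattice, ∀ z, z + γ ∈ P ↔ z ∈ P
  periodic : Periodic Φ
  smooth : ∀ z ∉ P, ContDiffAt ℝ (⊤ : ℕ∞) Φ z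
  eqn : ∀ z ∉ P, twoDzbar Φ z + κ * Φ z = 0
  pole : ∀ p ∈ P, ∃ s : ℂ → ℂ, ContDiffAt ℝ (⊤ : ℕ∞) s p ∧ s p = r p ∧
    ∀ᶠ z in 𝓝[≠] p, Φ z = s z / (z - p)

/-- The periodized model of a simple pole at `p`. -/
def periodicPole (κ p z : ℂ) : ℂ := poleModel κ (red (z - p))

/-- The periodized source. -/
def periodicSource (κ p z : ℂ) : ℂ := poleSource κ (red (z - p))

theorem eventually_comp_red_sub {b : ℂ → ℂ} (hb : ∀ w, 1 / 8 ≤ ‖w‖ → b w = 0) (p z₀ : ℂ) :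
    ∀ᶠ z in 𝓝 z₀, b (red (z - p)) = b (z - (p + nearLat (z₀ - p))) := by
  have h := ((continuous_sub_right p).tendsto z₀).eventually
    (eventually_comp_red hb (z₀ - p))
  filter_upwards [h] with z hz
  rw [hz]
  congr 1
  ring

theorem isTest_periodicSource (κ p : ℂ) : IsTest (periodicSource κ p) := by
  refine ⟨contDiff_iff_contDiffAt.2 fun z₀ => ?_, fun γ hγ z => ?_⟩
  · have h := eventually_comp_red_sub (b := poleSource κ) (fun w => poleSource_of_ge) p z₀
    refine ContDiffAt.congr_of_eventuallyEq ?_ h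
    exact ((contDiff_poleSource κ).comp (contDiff_id.sub contDiff_const)).contDiffAt
  · rw [periodicSource, periodicSource, add_sub_right_comm, red_periodic hγ]

theorem periodicPole_periodic (κ p : ℂ) : Periodic (periodicPole κ p) := fun γ hγ z => by
  rw [periodicPole, periodicPole, add_sub_right_comm, red_periodic hγ]

theorem sub_nearLat_ne_zero {p z : ℂ} (hz : z ∉ orbit p) : z - (p + nearLat (z - p)) ≠ 0 := by
  intro h
  apply hz
  rw [mem_orbit, ← red_eq_zero_iff, red, ← h]
  ring

theorem contDiffAt_periodicPole {κ p z : ℂ} (hz : z ∉ orbit p) :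
    ContDiffAt ℝ (⊤ : ℕ∞) (periodicPole κ p) z := by
  have h := eventually_comp_red_sub (b := poleModel κ) (fun w => poleModel_of_ge) p z
  refine ContDiffAt.congr_of_eventuallyEq ?_ h
  exact ContDiffAt.comp z (contDiffAt_poleModel (sub_nearLat_ne_zero hz))
    (contDiffAt_id.sub contDiffAt_const)

theorem twoDzbar_periodicPole {κ p z : ℂ} (hz : z ∉ orbit p) :
    twoDzbar (periodicPole κ p) z + κ * periodicPole κ p z = periodicSource κ p z := by
  have h := eventually_comp_red_sub (b := poleModel κ) (fun w => poleModel_of_ge) p z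
  have h' := (eventually_comp_red_sub (b := poleSource κ) (fun w => poleSource_of_ge) p z).self_of_nhds
  have e : twoDzbar (periodicPole κ p) z = _ := twoDzbar_congr h
  have e1 : periodicPole κ p z = _ := h.self_of_nhds
  have e2 : periodicSource κ p z = _ := h'
  rw [e, e1, e2, twoDzbar_comp_sub, twoDzbar_poleModel (sub_nearLat_ne_zero hz)]

theorem eventually_periodicPole {κ p q : ℂ} (hq : q ∈ orbit p) :
    ∀ᶠ z in 𝓝 q, periodicPole κ p z = poleNum κ (z - q) / (z - q) := by
  have h := eventually_comp_red_sub (b := poleModel κ) (fun w => poleModel_of_ge) p q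
  rw [nearLat_of_mem hq] at h
  filter_upwards [h] with z hz
  rw [periodicPole, hz, poleModel]
  congr 2 <;> ring

theorem contDiff_poleNum_sub (κ q : ℂ) : ContDiff ℝ (⊤ : ℕ∞) fun z => poleNum κ (z - q) :=
  (contDiff_poleNum κ).comp (contDiff_id.sub contDiff_const)

/-- For `κ` off the dual lattice there is a function with a single simple pole. -/
theorem exists_simplePole {κ : ℂ} (hκ : ∀ n, freq n + κ ≠ 0) (p : ℂ) :
    ∃ Φ, HasPoles κ (orbit p) (fun _ => 1) Φ := by
  -- A smooth correction removes the source of the periodized model; off the dual lattice its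
  -- solvability condition is vacuous.
  obtain ⟨g, hg, he⟩ := (isTest_periodicSource κ p).neg.exists_solution κ
    fun n hn => absurd hn (hκ n)
  refine ⟨fun z => periodicPole κ p z + g z, countable_orbit p, eventually_notMem_orbit p,
    fun γ hγ z => add_mem_orbit hγ,
    fun γ hγ z => by rw [periodicPole_periodic κ p γ hγ, hg.2 γ hγ],
    fun z hz => (contDiffAt_periodicPole hz).add hg.1.contDiffAt, fun z hz => ?_, fun q hq => ?_⟩
  · rw [twoDzbar_add ((contDiffAt_periodicPole hz).differentiableAt (by simp))
      (hg.differentiable z)]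
    linear_combination twoDzbar_periodicPole (κ := κ) hz + he z
  · refine ⟨fun z => poleNum κ (z - q) + (z - q) * g z, ?_, ?_, ?_⟩
    · exact ((contDiff_poleNum_sub κ q).add ((contDiff_id.sub contDiff_const).mul hg.1)).contDiffAt
    · simp [poleNum_zero]
    · filter_upwards [eventually_nhdsWithin_of_eventually_nhds (eventually_periodicPole (κ := κ) hq),
        eventually_mem_nhdsWithin] with z hz hzq
      have : z - q ≠ 0 := sub_ne_zero.2 hzq
      rw [hz]
      field_simp

/-- Moving the pole multiplies each Fourier coefficient by a phase, which is `1` at frequency zero.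
-/
theorem coef_periodicSource (κ p : ℂ) :
    coef (periodicSource κ p) 0 = coef (periodicSource κ 0) 0 := by
  have h := isTest_periodicSource κ 0
  have e : periodicSource κ p =
      series fun n => coef (periodicSource κ 0) n * expo n (-p) := by
    ext z
    have e1 : periodicSource κ p z = periodicSource κ 0 (z - p) := by
      rw [periodicSource, periodicSource, sub_zero]
    rw [e1, ← h.series_coef]
    simp only [series]
    rw [h.series_coef]
    refine tsum_congr fun n => ?_
    have : expo n (z - p) = expo n z * expo n (-p) := by
      rw [expo, expo, expo, ← Complex.exp_add]
      congr 1
      simp [phase]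
      ring
    rw [this]
    ring
  have hs : Summable fun n => ‖coef (periodicSource κ 0) n * expo n (-p)‖ := by
    simpa [norm_expo] using h.rapid.summable
  rw [e, coef_series hs, expo, phase]
  simp [freq1, freq2]

theorem orbit_disjoint {p q : ℂ} (hpq : p - q ∉ lattice) {z : ℂ} (hz : z ∈ orbit p) :
    z ∉ orbit q := fun h => hpq (by
  have := lattice.sub_mem h hz
  rwa [sub_sub_sub_cancel_left] at this)

/-- There is an elliptic function with simple poles at two given inequivalent points. -/
theorem exists_twoPoles {p q : ℂ} (hpq : p - q ∉ lattice) :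
    ∃ (r Φ : ℂ → ℂ), HasPoles 0 (orbit p ∪ orbit q) r Φ ∧ (∀ z ∈ orbit p, r z = 1) ∧
      ∀ z ∈ orbit q, r z = -1 := by
  classical
  have hqp : q - p ∉ lattice := fun h => hpq (by rw [← neg_sub]; exact lattice.neg_mem h)
  have hh := (isTest_periodicSource 0 q).sub (isTest_periodicSource 0 p)
  -- For `κ = 0` the only obstruction is the mean of the source, and the opposite residues make the
  -- two means cancel.
  obtain ⟨g, hg, he⟩ := hh.exists_solution 0 fun n hn => by
    rw [add_zero] at hn
    obtain rfl := freq_eq_zero hn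
    have e := coef_add (integrableOn_cell_of_continuous (isTest_periodicSource 0 q).continuous)
      (integrableOn_cell_of_continuous ((isTest_periodicSource 0 p).const_mul (-1)).continuous) 0
    rw [coef_const_mul, coef_periodicSource 0 q, coef_periodicSource 0 p] at e
    refine Eq.trans ?_ (e.trans (by ring))
    congr 1
    ext z
    ring
  have hrp {z : ℂ} (hz : z ∈ orbit p) : (if z ∈ orbit p then (1 : ℂ) else -1) = 1 := if_pos hz
  have hrq {z : ℂ} (hz : z ∈ orbit q) : (if z ∈ orbit p then (1 : ℂ) else -1) = -1 :=
    if_neg (orbit_disjoint hqp hz)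
  refine ⟨fun z => if z ∈ orbit p then 1 else -1,
    fun z => periodicPole 0 p z - periodicPole 0 q z + g z,
    ⟨(countable_orbit p).union (countable_orbit q), fun z => ?_, fun γ hγ z => ?_,
    fun γ hγ z => ?_, fun z hz => ?_, fun z hz => ?_, ?_⟩,
    fun z hz => hrp hz, fun z hz => hrq hz⟩
  · filter_upwards [eventually_notMem_orbit p z, eventually_notMem_orbit q z] with w h1 h2 h3
    exact h3.elim h1 h2
  · rw [mem_union, mem_union, add_mem_orbit hγ, add_mem_orbit hγ]
  · simp only [periodicPole_periodic 0 _ γ hγ, hg.2 γ hγ]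
  · rw [mem_union, not_or] at hz
    exact ((contDiffAt_periodicPole hz.1).sub (contDiffAt_periodicPole hz.2)).add hg.1.contDiffAt
  · rw [mem_union, not_or] at hz
    have d1 := (contDiffAt_periodicPole (κ := 0) hz.1).differentiableAt (by simp)
    have d2 := (contDiffAt_periodicPole (κ := 0) hz.2).differentiableAt (by simp)
    have d3 : DifferentiableAt ℝ (fun z => -1 * periodicPole 0 q z) z := d2.const_mul (-1)
    have d4 : DifferentiableAt ℝ (fun z => periodicPole 0 p z + -1 * periodicPole 0 q z) z :=
      d1.add d3
    have e1 : twoDzbar (fun z => periodicPole 0 p z - periodicPole 0 q z + g z) z =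
        twoDzbar (periodicPole 0 p) z - twoDzbar (periodicPole 0 q) z + twoDzbar g z := by
      have e2 : (fun z => periodicPole 0 p z - periodicPole 0 q z + g z) =
          fun z => (periodicPole 0 p z + -1 * periodicPole 0 q z) + g z := by ext z; ring
      rw [e2, twoDzbar_add d4 (hg.differentiable z),
        twoDzbar_add d1 d3, twoDzbar_const_mul _ d2]
      ring
    rw [e1]
    linear_combination twoDzbar_periodicPole (κ := 0) hz.1 - twoDzbar_periodicPole (κ := 0) hz.2 +
      he z
  · rintro t (ht | ht)
    · have hq := contDiffAt_periodicPole (κ := 0) (orbit_disjoint hpq ht)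
      refine ⟨fun z => poleNum 0 (z - t) + (z - t) * (-periodicPole 0 q z + g z), ?_, ?_, ?_⟩
      · exact (contDiff_poleNum_sub 0 t).contDiffAt.add
          ((contDiffAt_id.sub contDiffAt_const).mul (hq.neg.add hg.1.contDiffAt))
      · simp [poleNum_zero, hrp ht]
      · filter_upwards [eventually_nhdsWithin_of_eventually_nhds (eventually_periodicPole (κ := 0) ht),
          eventually_mem_nhdsWithin] with z hz hzq
        have : z - t ≠ 0 := sub_ne_zero.2 hzq
        rw [hz]
        field_simp
        ring
    · have hp := contDiffAt_periodicPole (κ := 0) (orbit_disjoint hqp ht)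
      refine ⟨fun z => -poleNum 0 (z - t) + (z - t) * (periodicPole 0 p z + g z), ?_, ?_, ?_⟩
      · exact (contDiff_poleNum_sub 0 t).neg.contDiffAt.add
          ((contDiffAt_id.sub contDiffAt_const).mul (hp.add hg.1.contDiffAt))
      · simp [poleNum_zero, hrq ht]
      · filter_upwards [eventually_nhdsWithin_of_eventually_nhds (eventually_periodicPole (κ := 0) ht),
          eventually_mem_nhdsWithin] with z hz hzq
        have : z - t ≠ 0 := sub_ne_zero.2 hzq
        rw [hz]
        field_simp
        ring

/-- This is the residue obstruction: no elliptic function has exactly one simple pole. The source is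
a constant times a function of one sign, so zero mean would make the cut-off constant. -/
theorem coef_periodicSource_ne_zero : coef (periodicSource 0 0) 0 ≠ 0 := by
  intro h
  have hT := isTest_periodicSource 0 0
  have e (z : ℂ) : periodicSource 0 0 z =
      -2 * Complex.I * (deriv cutoff (Complex.normSq (red z)) : ℝ) := by
    simp [periodicSource, poleSource, twist]
  rw [coef, mul_eq_zero, inv_eq_zero] at h
  have h1 := h.resolve_left integral_cell_one_ne_zero
  simp only [neg_zero, expo_zero, mul_one, e] at h1
  rw [integral_const_mul, mul_eq_zero] at h1
  have h2 := h1.resolve_left (by simp)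
  rw [integral_complex_ofReal] at h2
  set R : ℂ → ℝ := fun z => deriv cutoff (Complex.normSq (red z)) with hR
  have h3 : ∫ z in cell, R z = 0 := by exact_mod_cast h2
  have hRc : Continuous R := by
    have : R = fun z => (periodicSource 0 0 z * (Complex.I / 2)).re := by
      ext z
      rw [e]
      have : -2 * Complex.I * (R z : ℂ) * (Complex.I / 2) = (R z : ℂ) := by
        linear_combination (-(R z : ℂ)) * Complex.I_mul_I
      show R z = (-2 * Complex.I * (R z : ℂ) * (Complex.I / 2)).re
      rw [this, Complex.ofReal_re]
    rw [this]
    exact Complex.continuous_re.comp (hT.continuous.mul continuous_const)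
  have h4 : ∫ z in cell, -R z = 0 := by rw [integral_neg, h3, neg_zero]
  have hint : IntegrableOn (fun z => -R z) cell := by
    have h5 := (integrableOn_cell_of_continuous (f := fun z => ((-R z : ℝ) : ℂ))
      (Complex.continuous_ofReal.comp hRc.neg)).re
    have h7 : Integrable (fun z => RCLike.re ((-R z : ℝ) : ℂ)) (volume.restrict cell) := h5
    exact h7.congr (Eventually.of_forall fun z => Complex.ofReal_re _)
  have h6 := (integral_eq_zero_iff_of_nonneg (fun z => by
    have := deriv_cutoff_nonpos (Complex.normSq (red z))
    simp [hR, this]) hint).1 h4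
  have h7 : periodicSource 0 0 =ᵐ[volume.restrict cell] fun _ => 0 := by
    filter_upwards [h6] with z hz
    have : R z = 0 := by simpa using hz
    rw [e, show deriv cutoff (Complex.normSq (red z)) = 0 from this]
    simp
  have h8 := Measure.eq_of_ae_eq (hT.periodic.aePeriodic.ae_eq (fun _ _ => by simp) h7)
    hT.continuous continuous_const
  -- The real points `√x` lie in the ball where the reduction modulo `Λ` is the identity, so they
  -- detect the derivative at each such `x`. The mean value theorem then contradicts the drop of
  -- `cutoff` from `1` to `0`.
  have h9 : ∀ x ∈ Ioo (0 : ℝ) (1 / 64), deriv cutoff x = 0 := by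
    intro x hx
    have hs : 0 ≤ Real.sqrt x := Real.sqrt_nonneg x
    have hs2 : Real.sqrt x ^ 2 = x := Real.sq_sqrt hx.1.le
    have hn : ‖((Real.sqrt x : ℝ) : ℂ) - 0‖ < 1 / 8 := by
      rw [sub_zero, Complex.norm_real, Real.norm_eq_abs, abs_of_nonneg hs]
      nlinarith [hx.2]
    have hz := congrFun h8 ((Real.sqrt x : ℝ) : ℂ)
    rw [e, red, nearLat_eq_of_norm_lt lattice.zero_mem hn, sub_zero, Complex.normSq_ofReal,
      ← sq, hs2] at hz
    simpa using hz
  have h10 := exists_deriv_eq_slope cutoff (show (0 : ℝ) < 1 / 64 by norm_num)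
    contDiff_cutoff.continuous.continuousOn (contDiff_cutoff.differentiable (by simp)).differentiableOn
  obtain ⟨x, hx, hd⟩ := h10
  rw [h9 x hx, cutoff_of_ge le_rfl, cutoff_of_le (by norm_num)] at hd
  norm_num at hd

/-! ### Removable singularities on the torus -/

/-- Countable discrete sets that are invariant under the lattice. -/
structure IsSingularSet (N : Set ℂ) : Prop where
  countable : N.Countable
  discrete : ∀ z, ∀ᶠ w in 𝓝[≠] z, w ∉ N
  periodic : ∀ γ ∈ lattice, ∀ z, z + γ ∈ N ↔ z ∈ N

theorem HasPoles.isSingularSet {κ : ℂ} {P : Set ℂ} {r Φ : ℂ → ℂ} (h : HasPoles κ P r Φ) :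
    IsSingularSet P := ⟨h.countable, h.discrete, h.set_periodic⟩

theorem isSingularSet_orbit (p : ℂ) : IsSingularSet (orbit p) :=
  ⟨countable_orbit p, eventually_notMem_orbit p, fun _ hγ _ => add_mem_orbit hγ⟩

theorem IsSingularSet.union {N M : Set ℂ} (hN : IsSingularSet N) (hM : IsSingularSet M) :
    IsSingularSet (N ∪ M) := by
  refine ⟨hN.countable.union hM.countable, fun z => ?_, fun γ hγ z => ?_⟩
  · filter_upwards [hN.discrete z, hM.discrete z] with w h1 h2 h3
    exact h3.elim h1 h2
  · rw [mem_union, mem_union, hN.periodic γ hγ, hM.periodic γ hγ]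

theorem IsSingularSet.eventually_notMem {N : Set ℂ} (hN : IsSingularSet N) {z : ℂ} (hz : z ∉ N) :
    ∀ᶠ w in 𝓝 z, w ∉ N := by
  have h := hN.discrete z
  rw [eventually_nhdsWithin_iff] at h
  filter_upwards [h] with w hw
  by_cases e : w = z
  · rwa [e]
  · exact hw e

theorem IsSingularSet.dense_compl {N : Set ℂ} (hN : IsSingularSet N) : Dense Nᶜ :=
  hN.countable.dense_compl ℝ

theorem Periodic.tendsto_add {f : ℂ → ℂ} (hp : Periodic f) {p l γ : ℂ} (hγ : γ ∈ lattice)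
    (h : Tendsto f (𝓝[≠] (p + γ)) (𝓝 l)) : Tendsto f (𝓝[≠] p) (𝓝 l) := by
  have h1 := tendsto_sub_punctured (-γ) p
  rw [sub_neg_eq_add] at h1
  refine (h.comp h1).congr fun z => ?_
  rw [Function.comp_apply, sub_neg_eq_add, hp γ hγ]

theorem exists_continuous_extension {N : Set ℂ} (hN : IsSingularSet N) {f L : ℂ → ℂ}
    (hp : Periodic f) (hc : ∀ z ∉ N, ContinuousAt f z)
    (hL : ∀ p ∈ N, Tendsto f (𝓝[≠] p) (𝓝 (L p))) :
    ∃ W, Continuous W ∧ Periodic W ∧ (∀ z ∉ N, W z = f z) ∧ ∀ p ∈ N, W p = L p := by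
  classical
  refine ⟨fun z => if z ∈ N then L z else f z, ?_, fun γ hγ z => ?_, fun z hz => if_neg hz,
    fun z hz => if_pos hz⟩
  · refine continuous_iff_continuousAt.2 fun z => ?_
    by_cases hz : z ∈ N
    · rw [continuousAt_iff_punctured_nhds, if_pos hz]
      refine (hL z hz).congr' ?_
      filter_upwards [hN.discrete z] with w hw
      rw [if_neg hw]
    · refine (hc z hz).congr ?_
      filter_upwards [hN.eventually_notMem hz] with w hw
      rw [if_neg hw]
  · simp only [hN.periodic γ hγ, hp γ hγ]
    split_ifs with hz
    · exact tendsto_nhds_unique (hp.tendsto_add hγ (hL _ ((hN.periodic γ hγ z).2 hz))) (hL z hz)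
    · rfl

/-- A continuous extension across a countable set contributes nothing singular to the divergence
theorem, so the equation holds weakly on the whole torus. -/
theorem weakEq_of_eqOn {N : Set ℂ} (hN : IsSingularSet N) {f W h : ℂ → ℂ} {κ : ℂ}
    (hW : Continuous W) (hp : Periodic W) (hWf : ∀ z ∉ N, W z = f z)
    (hd : ∀ z ∉ N, DifferentiableAt ℝ f z) (hh : Continuous h)
    (he : ∀ z ∉ N, twoDzbar f z + κ * f z = h z) : WeakEq twoDzbar κ W h := by
  have hev {z : ℂ} (hz : z ∉ N) : W =ᶠ[𝓝 z] f := by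
    filter_upwards [hN.eventually_notMem hz] with w hw using hWf w hw
  rw [twoDzbar_eq_firstOrder]
  refine weakEq_of_pointwise hN.countable hW hp
    (fun z hz => (hd z hz).congr_of_eventuallyEq (hev hz)) hh fun z hz => ?_
  rw [← twoDzbar_eq_firstOrder, twoDzbar_congr (hev hz), hWf z hz, he z hz]

/-- A periodic solution of `(2D_{z̄} + κ) f = 0` off a singular set with removable singularities
vanishes unless `-κ` is in the dual lattice. -/
theorem eq_zero_of_tendsto {N : Set ℂ} (hN : IsSingularSet N) {f : ℂ → ℂ} {κ : ℂ}
    (hκ : ∀ n, freq n + κ ≠ 0) (hp : Periodic f) (hd : ∀ z ∉ N, DifferentiableAt ℝ f z)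
    (he : ∀ z ∉ N, twoDzbar f z + κ * f z = 0)
    (hL : ∀ p ∈ N, ∃ l, Tendsto f (𝓝[≠] p) (𝓝 l)) : ∀ z ∉ N, f z = 0 := by
  choose! L hL using hL
  obtain ⟨W, hW, hWp, hWf, -⟩ := exists_continuous_extension hN hp
    (fun z hz => (hd z hz).continuousAt) hL
  have hw := weakEq_of_eqOn hN hW hWp hWf hd continuous_const he
  have h0 : W = fun _ => 0 := eq_of_coef_eq hW continuous_const hWp (fun _ _ _ => rfl) fun n => by
    have h := coef_of_weakEq_twoDzbar hw n
    rw [coef_zero] at h ⊢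
    refine (mul_eq_zero.1 h).resolve_left ?_
    rw [add_comm]
    exact hκ n
  intro z hz
  rw [← hWf z hz, h0]

/-- A periodic solution of `2D_{z̄} f = 0` off a singular set, with at most a single simple pole
in the torus, is constant. -/
theorem eq_const_of_tendsto {N : Set ℂ} (hN : IsSingularSet N) {f : ℂ → ℂ} {q r : ℂ}
    (hp : Periodic f) (hd : ∀ z ∉ N, DifferentiableAt ℝ f z) (he : ∀ z ∉ N, twoDzbar f z = 0)
    (hL : ∀ p ∈ N, p ∉ orbit q → ∃ l, Tendsto f (𝓝[≠] p) (𝓝 l))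
    (hq : Tendsto (fun z => (z - q) * f z) (𝓝[≠] q) (𝓝 r)) : ∃ c, ∀ z ∉ N, f z = c := by
  have hM := hN.union (isSingularSet_orbit q)
  -- Subtracting the model pole leaves only removable singularities, at the price of a smooth source
  -- proportional to `r`.
  set g : ℂ → ℂ := fun z => f z + -r * periodicPole 0 q z with hg
  have hgp : Periodic g := fun γ hγ z => by simp only [hg, hp γ hγ, periodicPole_periodic 0 q γ hγ]
  have hβ {z : ℂ} (hz : z ∉ N ∪ orbit q) : DifferentiableAt ℝ (periodicPole 0 q) z :=
    (contDiffAt_periodicPole fun h => hz (Or.inr h)).differentiableAt (by simp)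
  have hgd : ∀ z ∉ N ∪ orbit q, DifferentiableAt ℝ g z := fun z hz =>
    (hd z fun h => hz (Or.inl h)).add ((hβ hz).const_mul _)
  have hge : ∀ z ∉ N ∪ orbit q, twoDzbar g z + 0 * g z = -r * periodicSource 0 q z := by
    intro z hz
    have d3 : DifferentiableAt ℝ (fun z => -r * periodicPole 0 q z) z := (hβ hz).const_mul _
    rw [hg, twoDzbar_add (hd z fun h => hz (Or.inl h)) d3, twoDzbar_const_mul _ (hβ hz),
      he z fun h => hz (Or.inl h),
      ← twoDzbar_periodicPole (κ := 0) (fun h => hz (Or.inr h))]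
    ring
  -- The function `(z - q) f` extends holomorphically. Subtracting `r` times the model numerator
  -- leaves a function `b` with `b(q) = 0` and `∂̄b(q) = 0`, so `b / (z - q)` has a limit.
  have hgq : ∃ l, Tendsto g (𝓝[≠] q) (𝓝 l) := by
    classical
    set h : ℂ → ℂ := Function.update (fun z => (z - q) * f z) q r with hh
    have hc : ContinuousAt h q := continuousAt_update_same.2 hq
    have hd1 : ∀ᶠ z in 𝓝[≠] q, DifferentiableAt ℂ h z := by
      filter_upwards [hN.discrete q, eventually_mem_nhdsWithin] with z hz hzq
      have h1 : DifferentiableAt ℂ (fun z => (z - q) * f z) z :=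
        (differentiableAt_id.sub_const q).mul
          (hasDerivAt_of_twoDzbar_eq_zero (hd z hz) (he z hz)).differentiableAt
      refine h1.congr_of_eventuallyEq ?_
      filter_upwards [isOpen_ne.mem_nhds hzq] with w hw
      rw [hh, Function.update_of_ne hw]
    have hd2 : DifferentiableAt ℂ h q :=
      (Complex.analyticAt_of_differentiable_on_punctured_nhds_of_continuousAt hd1 hc).differentiableAt
    set b : ℂ → ℂ := fun z => h z + -r * poleNum 0 (z - q) with hb
    have hr : DifferentiableAt ℝ h q := hd2.restrictScalars ℝ
    have hpn : DifferentiableAt ℝ (fun z => poleNum 0 (z - q)) q :=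
      (contDiff_poleNum_sub 0 q).contDiffAt.differentiableAt (by simp)
    have hpc : DifferentiableAt ℝ (fun z => -r * poleNum 0 (z - q)) q := hpn.const_mul _
    have hbd : DifferentiableAt ℝ b q := hr.add hpc
    have hb0 : b q = 0 := by simp [hb, hh, poleNum_zero]
    have hbz : twoDzbar b q = 0 := by
      rw [hb, twoDzbar_add hr hpc, twoDzbar_of_hasDerivAt hd2.hasDerivAt,
        twoDzbar_const_mul _ hpn, twoDzbar_comp_sub, sub_self]
      have := twoDzbar_poleNum 0 0
      simp only [zero_mul, add_zero, mul_zero] at this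
      rw [this, mul_zero, add_zero]
    refine ⟨_, (tendsto_div_sub hbd hb0 hbz).congr' ?_⟩
    filter_upwards [eventually_nhdsWithin_of_eventually_nhds
      (eventually_periodicPole (κ := 0) (self_mem_orbit q)), eventually_mem_nhdsWithin] with z hz hzq
    have : z - q ≠ 0 := sub_ne_zero.2 hzq
    simp only [hb, hg, hz, hh, Function.update_of_ne hzq]
    field_simp
  have hgL : ∀ p ∈ N ∪ orbit q, ∃ l, Tendsto g (𝓝[≠] p) (𝓝 l) := by
    intro p hpN
    by_cases hpq : p ∈ orbit q
    · obtain ⟨l, hl⟩ := hgq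
      refine ⟨l, hgp.tendsto_add (γ := q - p) ?_ (by rwa [add_sub_cancel])⟩
      rw [← neg_sub]
      exact lattice.neg_mem hpq
    · obtain ⟨l, hl⟩ := hL p (hpN.resolve_right hpq) hpq
      refine ⟨_, hl.add (((contDiffAt_periodicPole (κ := 0) hpq).continuousAt.tendsto.mono_left
        nhdsWithin_le_nhds).const_mul (-r))⟩
  choose! L hL' using hgL
  obtain ⟨W, hW, hWp, hWf, -⟩ := exists_continuous_extension hM hgp
    (fun z hz => (hgd z hz).continuousAt) hL'
  have hw := weakEq_of_eqOn hM hW hWp hWf hgd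
    ((isTest_periodicSource 0 q).const_mul (-r)).continuous hge
  have h0 : freq 0 = 0 := by simp [freq]
  -- The zero Fourier mode of the equation for `W` forces the mean of the source, hence the residue,
  -- to vanish.
  have hr : r = 0 := by
    have h := coef_of_weakEq_twoDzbar hw 0
    rw [h0, add_zero, zero_mul, coef_const_mul, coef_periodicSource] at h
    exact neg_eq_zero.1 ((mul_eq_zero.1 h.symm).resolve_right coef_periodicSource_ne_zero)
  have hWc : W = fun _ => coef W 0 * 1 := by
    refine eq_of_coef_eq hW continuous_const hWp (fun _ _ _ => rfl) fun n => ?_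
    rw [coef_const_mul, coef_one]
    split_ifs with hn
    · rw [hn, mul_one]
    · have h := coef_of_weakEq_twoDzbar hw n
      rw [hr, neg_zero, coef_const_mul, zero_mul, zero_add] at h
      rw [mul_zero]
      exact (mul_eq_zero.1 h).resolve_left fun h => hn (freq_eq_zero h)
  have hfM : ∀ z ∉ N ∪ orbit q, f z = coef W 0 * 1 := by
    intro z hz
    have h1 := hWf z hz
    rw [hg, hr, hWc] at h1
    simpa using h1.symm
  refine ⟨coef W 0 * 1, fun z hz => ?_⟩
  by_cases hzq : z ∈ orbit q
  · have h1 : Tendsto f (𝓝[≠] z) (𝓝 (f z)) :=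
      (hd z hz).continuousAt.tendsto.mono_left nhdsWithin_le_nhds
    refine tendsto_nhds_unique h1 (tendsto_const_nhds.congr' ?_)
    filter_upwards [hM.discrete z] with w hw using (hfM w hw).symm
  · exact hfM z fun h => h.elim hz hzq

/-! ### Multiplication of solutions by functions with poles -/

theorem HasPoles.tendsto {κ : ℂ} {P : Set ℂ} {r Φ : ℂ → ℂ} (h : HasPoles κ P r Φ) {p : ℂ}
    (hp : p ∈ P) : Tendsto (fun z => (z - p) * Φ z) (𝓝[≠] p) (𝓝 (r p)) := by
  obtain ⟨s, hs, h1, h2⟩ := h.pole p hp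
  rw [← h1]
  refine (hs.continuousAt.tendsto.mono_left nhdsWithin_le_nhds).congr' ?_
  filter_upwards [h2, eventually_mem_nhdsWithin] with z hz hzp
  have : z - p ≠ 0 := sub_ne_zero.2 hzp
  rw [hz]
  field_simp

/-- All other terms of the system are of order zero, so they disappear at a common zero. -/
theorem sol_twoDzbar_eq_zero {V : Potential} {α k : ℂ} {u : Fin 2 → ℂ → ℂ} (hu : u ∈ sol V α k)
    {p : ℂ} (h0 : VanishesAt u p) (j : Fin 2) : twoDzbar (u j) p = 0 := by
  obtain ⟨-, h1, h2⟩ := hu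
  have e1 := h1 p
  have e2 := h2 p
  rw [h0 0, h0 1] at e1 e2
  fin_cases j
  · simpa using e1
  · simpa using e2

/-- Dividing a solution by the coordinate at one of its zeros. -/
theorem sol_tendsto_div {V : Potential} {α k : ℂ} {u : Fin 2 → ℂ → ℂ} (hu : u ∈ sol V α k)
    {p : ℂ} (h0 : VanishesAt u p) (j : Fin 2) :
    Tendsto (fun z => u j z / (z - p)) (𝓝[≠] p) (𝓝 (dz (u j) p)) :=
  tendsto_div_sub ((hu.1 j).differentiable p) (h0 j) (sol_twoDzbar_eq_zero hu h0 j)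

/-- A solution vanishing at the poles of `Φ` can be multiplied by `Φ`. -/
theorem exists_mul_sol {V : Potential} {α k κ : ℂ} {u : Fin 2 → ℂ → ℂ} (hu : u ∈ sol V α k)
    {P : Set ℂ} {r Φ : ℂ → ℂ} (hΦ : HasPoles κ P r Φ) (h0 : ∀ p ∈ P, VanishesAt u p) :
    ∃ v ∈ sol V α (k + κ), (∀ z ∉ P, ∀ j, v j z = Φ z * u j z) ∧
      ∀ p ∈ P, ∀ j, v j p = r p * dz (u j) p := by
  have hP := hΦ.isSingularSet
  -- The product splits as `(z - p) Φ` times `u / (z - p)`, both of which have limits.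
  have hlim : ∀ p ∈ P, ∀ j, Tendsto (fun z => Φ z * u j z) (𝓝[≠] p) (𝓝 (r p * dz (u j) p)) := by
    intro p hp j
    refine ((hΦ.tendsto hp).mul (sol_tendsto_div hu (h0 p hp) j)).congr' ?_
    filter_upwards [eventually_mem_nhdsWithin] with z hz
    have : z - p ≠ 0 := sub_ne_zero.2 hz
    field_simp
  have hd : ∀ j, ∀ z ∉ P, DifferentiableAt ℝ (fun z => Φ z * u j z) z := fun j z hz =>
    ((hΦ.smooth z hz).differentiableAt (by simp)).mul ((hu.1 j).differentiable z)
  have hper : ∀ j, Periodic fun z => Φ z * u j z := fun j γ hγ z => by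
    simp only [hΦ.periodic γ hγ, (hu.1 j).2 γ hγ]
  have hext (j : Fin 2) := exists_continuous_extension hP (hper j)
    (fun z hz => (hd j z hz).continuousAt) (fun p hp => hlim p hp j)
  choose W hWc hWp hWf hWL using hext
  -- The scalar `Φ` commutes with the matrix terms and only shifts the parameter by `κ`.
  have heq : ∀ j, ∀ z ∉ P, twoDzbar (fun z => Φ z * u j z) z + (k + κ) * (Φ z * u j z) =
      Φ z * (twoDzbar (u j) z + k * u j z) := by
    intro j z hz
    rw [twoDzbar_mul ((hΦ.smooth z hz).differentiableAt (by simp)) ((hu.1 j).differentiable z)]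
    linear_combination u j z * hΦ.eqn z hz
  have hext2 {f g : ℂ → ℂ} (hf : Continuous f) (hg : Continuous g) (h : ∀ z ∉ P, f z = g z) (z : ℂ) :
      f z = g z := congrFun (hf.ext_on hP.dense_compl hg fun z hz => h z hz) z
  have hVc := V.continuous
  obtain ⟨v, hv, hv0, hv1⟩ := exists_sol_of_weakEq (V := V) (α := α) (k := k + κ)
    (memLp_cell_of_continuous (hWc 0)) (memLp_cell_of_continuous (hWc 1)) (hWp 0).aePeriodic
    (hWp 1).aePeriodic
    (weakEq_of_eqOn hP (hWc 0) (hWp 0) (hWf 0) (hd 0) (by have := hWc 1; fun_prop) fun z hz => by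
      rw [heq 0 z hz, hu.2.1, hWf 1 z hz]; ring)
    (weakEq_of_eqOn hP (hWc 1) (hWp 1) (hWf 1) (hd 1) (by have := hWc 0; fun_prop) fun z hz => by
      rw [heq 1 z hz, hu.2.2, hWf 0 z hz]; ring)
  have e : ∀ j, v j = W j := by
    intro j
    refine Measure.eq_of_ae_eq (μ := volume) ?_ (hv.1 j).continuous (hWc j)
    fin_cases j
    · exact hv0.symm
    · exact hv1.symm
  exact ⟨v, hv, fun z hz j => by rw [e, hWf j z hz], fun p hp j => by rw [e, hWL j p hp]⟩

/-! ### Avoiding the dual lattice -/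

theorem exists_notMem_dual (a b : ℂ) :
    ∃ k, (∀ n, freq n + (a + k) ≠ 0) ∧ ∀ n, freq n + (b + k) ≠ 0 := by
  have hc : (range (fun n => -freq n - a) ∪ range fun n => -freq n - b).Countable :=
    (countable_range _).union (countable_range _)
  obtain ⟨k, hk⟩ := (hc.dense_compl ℝ).nonempty
  simp only [mem_compl_iff, mem_union, mem_range, not_or, not_exists] at hk
  exact ⟨k, fun n h => hk.1 n (by linear_combination -h), fun n h => hk.2 n (by linear_combination -h)⟩

theorem neg_notMem_dual {κ : ℂ} (h : ∀ n, freq n + κ ≠ 0) (n : ℤ × ℤ) : freq n + -κ ≠ 0 :=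
  fun h0 => h (-n) (by rw [freq_neg]; linear_combination -h0)

/-! ### The Wronskian -/

/-- The Wronskian of two pairs. -/
def wronskian (u v : Fin 2 → ℂ → ℂ) (z : ℂ) : ℂ := u 0 z * v 1 z - u 1 z * v 0 z

theorem isTest_wronskian {u v : Fin 2 → ℂ → ℂ} (hu : ∀ j, IsTest (u j)) (hv : ∀ j, IsTest (v j)) :
    IsTest (wronskian u v) := ((hu 0).mul (hv 1)).sub ((hu 1).mul (hv 0))

/-- Liouville's formula: apart from the scalar parameters, the zero order matrix is off-diagonal and
has trace zero. -/
theorem twoDzbar_wronskian {V : Potential} {α k k' : ℂ} {u v : Fin 2 → ℂ → ℂ} (hu : u ∈ sol V α k)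
    (hv : v ∈ sol V α k') (z : ℂ) :
    twoDzbar (wronskian u v) z + (k + k') * wronskian u v z = 0 := by
  have du (j) := (hu.1 j).differentiable z
  have dv (j) := (hv.1 j).differentiable z
  have d1 : DifferentiableAt ℝ (fun z => u 0 z * v 1 z) z := (du 0).mul (dv 1)
  have d2 : DifferentiableAt ℝ (fun z => u 1 z * v 0 z) z := (du 1).mul (dv 0)
  have d3 : DifferentiableAt ℝ (fun z => -1 * (u 1 z * v 0 z)) z := d2.const_mul _
  have e : wronskian u v = fun z => u 0 z * v 1 z + -1 * (u 1 z * v 0 z) := by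
    ext z; rw [wronskian]; ring
  rw [e, twoDzbar_add d1 d3, twoDzbar_const_mul _ d2, twoDzbar_mul (du 0) (dv 1),
    twoDzbar_mul (du 1) (dv 0)]
  linear_combination v 1 z * hu.2.1 z + u 0 z * hv.2.2 z - v 0 z * hu.2.2 z - u 1 z * hv.2.1 z

theorem wronskian_eq_zero {V : Potential} {α k k' : ℂ} {u v : Fin 2 → ℂ → ℂ} (hu : u ∈ sol V α k)
    (hv : v ∈ sol V α k') (h : ∀ n, freq n + (k + k') ≠ 0) (z : ℂ) : wronskian u v z = 0 :=
  congrFun (eq_zero_of_twoDzbar (isTest_wronskian hu.1 hv.1) (twoDzbar_wronskian hu hv) h) z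

/-- A periodic solution of the scalar equation is zero or, at resonance, a multiple of one
character, which never vanishes. -/
theorem wronskian_eq_zero_or {V : Potential} {α k k' : ℂ} {u v : Fin 2 → ℂ → ℂ}
    (hu : u ∈ sol V α k) (hv : v ∈ sol V α k') :
    (∀ z, wronskian u v z = 0) ∨ ∀ z, wronskian u v z ≠ 0 := by
  by_cases h : ∀ n, freq n + (k + k') ≠ 0
  · exact Or.inl (wronskian_eq_zero hu hv h)
  · push Not at h
    obtain ⟨n, hn⟩ := h
    obtain ⟨c, hc⟩ := eq_expo_of_twoDzbar (isTest_wronskian hu.1 hv.1) (m := n) fun z => by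
      rw [← twoDzbar_wronskian hu hv z]
      linear_combination (-wronskian u v z) * hn
    rw [hc]
    by_cases h0 : c = 0
    · left; intro z; simp only [h0, zero_mul]
    · right; intro z; exact mul_ne_zero h0 (expo_ne_zero n z)

/-- At a magic parameter all solutions are pointwise parallel. -/
theorem wronskian_eq_zero_of_magic {V : Potential} {α : ℂ} (hα : α ∈ magic V) {k k' : ℂ}
    {u v : Fin 2 → ℂ → ℂ} (hu : u ∈ sol V α k) (hv : v ∈ sol V α k') (z : ℂ) :
    wronskian u v z = 0 := by
  refine (wronskian_eq_zero_or hu hv).resolve_right (fun h => ?_) z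
  -- For this generic `κ` a nonzero solution `w`, available because `α` is magic, has zero Wronskian
  -- with both `u` and `v`.
  obtain ⟨κ, h1, h2⟩ := exists_notMem_dual k k'
  obtain ⟨w, hw, hw0⟩ := exists_sol_ne_zero hα κ
  apply hw0
  ext j z
  have e1 := wronskian_eq_zero hu hw h1 z
  have e2 := wronskian_eq_zero hv hw h2 z
  have e3 := h z
  simp only [wronskian] at e1 e2 e3
  -- Cramer's rule: a vector parallel to both members of a basis is zero.
  refine (mul_eq_zero.1 ?_).resolve_left e3
  fin_cases j
  · simp only [Fin.zero_eta]
    linear_combination v 0 z * e1 - u 0 z * e2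
  · simp only [Fin.mk_one]
    linear_combination v 1 z * e1 - u 1 z * e2

/-! ### The ratio of parallel solutions -/

/-- The factor `f` with `v = f u`, when `u` and `v` are parallel and `u ≠ 0`. -/
def ratio (u v : Fin 2 → ℂ → ℂ) (z : ℂ) : ℂ :=
  (conj (u 0 z) * v 0 z + conj (u 1 z) * v 1 z) / (conj (u 0 z) * u 0 z + conj (u 1 z) * u 1 z)

theorem hermitian_ne_zero {a b : ℂ} (h : ¬(a = 0 ∧ b = 0)) : conj a * a + conj b * b ≠ 0 := by
  intro h0
  apply h
  rw [← Complex.normSq_eq_conj_mul_self, ← Complex.normSq_eq_conj_mul_self] at h0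
  have h1 : Complex.normSq a + Complex.normSq b = 0 := by exact_mod_cast h0
  have ha := Complex.normSq_nonneg a
  have hb := Complex.normSq_nonneg b
  exact ⟨Complex.normSq_eq_zero.1 (by linarith), Complex.normSq_eq_zero.1 (by linarith)⟩

theorem vanishesAt_iff {u : Fin 2 → ℂ → ℂ} {z : ℂ} : VanishesAt u z ↔ u 0 z = 0 ∧ u 1 z = 0 := by
  rw [VanishesAt, Fin.forall_fin_two]

theorem ratio_mul {u v : Fin 2 → ℂ → ℂ} {z : ℂ} (hz : ¬VanishesAt u z) (h : wronskian u v z = 0)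
    (j : Fin 2) : v j z = ratio u v z * u j z := by
  rw [vanishesAt_iff] at hz
  have h1 := hermitian_ne_zero hz
  rw [wronskian] at h
  rw [ratio, div_mul_eq_mul_div, eq_div_iff h1]
  fin_cases j
  · simp only [Fin.zero_eta]
    linear_combination -conj (u 1 z) * h
  · simp only [Fin.mk_one]
    linear_combination conj (u 0 z) * h

theorem periodic_ratio {u v : Fin 2 → ℂ → ℂ} (hu : ∀ j, IsTest (u j)) (hv : ∀ j, IsTest (v j)) :
    Periodic (ratio u v) := fun γ hγ z => by
  simp only [ratio, (hu _).2 γ hγ, (hv _).2 γ hγ]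

theorem differentiableAt_ratio {u v : Fin 2 → ℂ → ℂ} (hu : ∀ j, IsTest (u j))
    (hv : ∀ j, IsTest (v j)) {z : ℂ} (hz : ¬VanishesAt u z) :
    DifferentiableAt ℝ (ratio u v) z := by
  have du (j) := (hu j).differentiable z
  have dv (j) := (hv j).differentiable z
  have dc (j) := (hu j).conj.differentiable z
  rw [vanishesAt_iff] at hz
  exact ((((dc 0).mul (dv 0)).add ((dc 1).mul (dv 1))).mul
    ((((dc 0).mul (du 0)).add ((dc 1).mul (du 1))).inv (hermitian_ne_zero hz))).congr_of_eventuallyEq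
    (Eventually.of_forall fun _ => div_eq_mul_inv _ _)

theorem eventually_not_vanishesAt {u : Fin 2 → ℂ → ℂ} (hu : ∀ j, IsTest (u j)) {z : ℂ}
    (hz : ¬VanishesAt u z) : ∀ᶠ w in 𝓝 z, ¬VanishesAt u w := by
  rw [VanishesAt, not_forall] at hz
  obtain ⟨j, hj⟩ := hz
  filter_upwards [(hu j).continuous.continuousAt.eventually_ne hj] with w hw h using hw (h j)

/-- Insert `v = f u` into the system for `v`, subtract `f` times the system for `u`, and divide by a
component of `u` that is nonzero at the point. -/
theorem twoDzbar_ratio {V : Potential} {α k k' : ℂ} {u v : Fin 2 → ℂ → ℂ} (hu : u ∈ sol V α k)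
    (hv : v ∈ sol V α k') (h : ∀ z, wronskian u v z = 0) {z : ℂ} (hz : ¬VanishesAt u z) :
    twoDzbar (ratio u v) z + (k' - k) * ratio u v z = 0 := by
  have hd := differentiableAt_ratio hu.1 hv.1 hz
  have e (j) : v j =ᶠ[𝓝 z] fun z => ratio u v z * u j z := by
    filter_upwards [eventually_not_vanishesAt hu.1 hz] with w hw using ratio_mul hw (h w) j
  have e1 (j) : twoDzbar (v j) z = twoDzbar (ratio u v) z * u j z +
      ratio u v z * twoDzbar (u j) z := by
    rw [twoDzbar_congr (e j), twoDzbar_mul hd ((hu.1 j).differentiable z)]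
  have e2 (j) := ratio_mul hz (h z) j
  rw [VanishesAt, not_forall] at hz
  obtain ⟨j, hj⟩ := hz
  refine (mul_eq_zero.1 ?_).resolve_right hj
  have h1 := hv.2.1 z
  have h2 := hv.2.2 z
  rw [e1, e2 0, e2 1] at h1 h2
  fin_cases j
  · simp only [Fin.zero_eta]
    linear_combination h1 - ratio u v z * hu.2.1 z
  · simp only [Fin.mk_one]
    linear_combination h2 - ratio u v z * hu.2.2 z

/-- The ratio has at most simple poles at the simple zeros of the denominator. -/
theorem exists_tendsto_mul_ratio {V : Potential} {α k k' : ℂ} {u v : Fin 2 → ℂ → ℂ}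
    (hu : u ∈ sol V α k) (hv : v ∈ sol V α k') {p : ℂ} (hp : SimpleZeroAt u p) :
    ∃ l, Tendsto (fun z => (z - p) * ratio u v z) (𝓝[≠] p) (𝓝 l) := by
  have hφ (j) := sol_tendsto_div hu hp.1 j
  have hc (j) := (Complex.continuous_conj.tendsto _).comp (hφ j)
  have hvc (j) : Tendsto (v j) (𝓝[≠] p) (𝓝 (v j p)) :=
    (hv.1 j).continuous.continuousAt.tendsto.mono_left nhdsWithin_le_nhds
  have h0 : ¬(dz (u 0) p = 0 ∧ dz (u 1) p = 0) := fun h => by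
    obtain ⟨j, hj⟩ := hp.2
    fin_cases j
    exacts [hj h.1, hj h.2]
  -- Divide the numerator by `conj (z - p)` and the denominator by `|z - p|²`; the latter quotient
  -- tends to `|∂_z u(p)|² ≠ 0`.
  refine ⟨_, ((((hc 0).mul (hvc 0)).add ((hc 1).mul (hvc 1))).div
    (((hc 0).mul (hφ 0)).add ((hc 1).mul (hφ 1))) (hermitian_ne_zero h0)).congr' ?_⟩
  filter_upwards [eventually_mem_nhdsWithin] with z hz
  have h1 : z - p ≠ 0 := sub_ne_zero.2 hz
  have h2 : conj (z - p) ≠ 0 := (map_ne_zero _).2 h1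
  simp only [Function.comp_apply, Pi.div_apply, map_div₀, ratio]
  have e1 : conj (u 0 z) / conj (z - p) * v 0 z + conj (u 1 z) / conj (z - p) * v 1 z =
    (conj (u 0 z) * v 0 z + conj (u 1 z) * v 1 z) / conj (z - p) := by ring
  have e2 : conj (u 0 z) / conj (z - p) * (u 0 z / (z - p)) +
      conj (u 1 z) / conj (z - p) * (u 1 z / (z - p)) =
    (conj (u 0 z) * u 0 z + conj (u 1 z) * u 1 z) / (conj (z - p) * (z - p)) := by
    rw [div_mul_div_comm, div_mul_div_comm, ← add_div]
  rw [e1, e2, div_div_div_eq, mul_left_comm, mul_div_mul_left _ _ h2]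
  ring

/-- The ratio is bounded at the simple zeros of the denominator that are zeros of the numerator. -/
theorem exists_tendsto_ratio {V : Potential} {α k k' : ℂ} {u v : Fin 2 → ℂ → ℂ}
    (hu : u ∈ sol V α k) (hv : v ∈ sol V α k') {p : ℂ} (hp : SimpleZeroAt u p)
    (hvp : VanishesAt v p) : ∃ l, Tendsto (ratio u v) (𝓝[≠] p) (𝓝 l) := by
  have hφ (j) := sol_tendsto_div hu hp.1 j
  have hψ (j) := sol_tendsto_div hv hvp j
  have hc (j) := (Complex.continuous_conj.tendsto _).comp (hφ j)
  have h0 : ¬(dz (u 0) p = 0 ∧ dz (u 1) p = 0) := fun h => by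
    obtain ⟨j, hj⟩ := hp.2
    fin_cases j
    exacts [hj h.1, hj h.2]
  refine ⟨_, ((((hc 0).mul (hψ 0)).add ((hc 1).mul (hψ 1))).div
    (((hc 0).mul (hφ 0)).add ((hc 1).mul (hφ 1))) (hermitian_ne_zero h0)).congr' ?_⟩
  filter_upwards [eventually_mem_nhdsWithin] with z hz
  have h1 : z - p ≠ 0 := sub_ne_zero.2 hz
  have h2 : conj (z - p) ≠ 0 := (map_ne_zero _).2 h1
  simp only [Function.comp_apply, Pi.div_apply, map_div₀, ratio]
  rw [div_mul_div_comm, div_mul_div_comm, ← add_div, div_mul_div_comm, div_mul_div_comm, ← add_div,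
    div_div_div_cancel_right₀ (mul_ne_zero h2 h1)]

/-- At a magic parameter every solution has a zero. -/
theorem exists_vanishesAt {V : Potential} {α : ℂ} (hα : α ∈ magic V) {u : Fin 2 → ℂ → ℂ}
    (hu : u ∈ sol V α 0) : ∃ z, VanishesAt u z := by
  by_contra! h
  -- If `u` had no zero, the ratio `v / u` would be a global periodic solution of `(2D_{z̄} + 1) f =
  -- 0`, hence zero.
  obtain ⟨v, hv, hv0⟩ := exists_sol_ne_zero hα 1
  have hw := wronskian_eq_zero_of_magic hα hu hv
  have hN : IsSingularSet ∅ := ⟨countable_empty, fun _ => by simp, fun _ _ _ => by simp⟩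
  have h0 := eq_zero_of_tendsto hN (κ := 1 - 0) (by simpa using one_not_mem_dual)
    (periodic_ratio hu.1 hv.1) (fun z _ => differentiableAt_ratio hu.1 hv.1 (h z))
    (fun z _ => twoDzbar_ratio hu hv hw (h z)) (fun p hp => absurd hp (notMem_empty p))
  apply hv0
  ext j z
  rw [ratio_mul (h z) (hw z) j, h0 z (notMem_empty z), zero_mul]
  rfl

/-! ### Counting solutions by zeros -/

/-- The identity theorem for holomorphic functions; the complement of a countable set in the plane
is connected. -/
theorem eq_zero_of_eventually_eq_zero {N : Set ℂ} (hN : IsSingularSet N) {f : ℂ → ℂ}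
    (hd : ∀ z ∉ N, DifferentiableAt ℝ f z) (he : ∀ z ∉ N, twoDzbar f z = 0) {z₀ : ℂ}
    (hz₀ : z₀ ∉ N) (h : ∀ᶠ z in 𝓝 z₀, f z = 0) : ∀ z ∉ N, f z = 0 := by
  have ho : IsOpen Nᶜ := isOpen_iff_mem_nhds.2 fun z hz => hN.eventually_notMem hz
  have hc : IsPreconnected Nᶜ :=
    (hN.countable.isPathConnected_compl_of_one_lt_rank
      (by rw [Complex.rank_real_complex]; norm_num)).isConnected.isPreconnected
  have ha : AnalyticOnNhd ℂ f Nᶜ := DifferentiableOn.analyticOnNhd (fun z hz =>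
    (hasDerivAt_of_twoDzbar_eq_zero (hd z hz)
      (he z hz)).differentiableAt.differentiableWithinAt) ho
  exact fun z hz => ha.eqOn_zero_of_preconnected_of_eventuallyEq_zero hc hz₀ h hz

/-- A criterion for the linear independence of `u`, `Φ u` and `Ψ u`, by growth at two points. -/
theorem three_le_finrank {V : Potential} {α k : ℂ} {u v w : Fin 2 → ℂ → ℂ} (hu : u ∈ sol V α k)
    (hv : v ∈ sol V α k) (hw : w ∈ sol V α k) (hu0 : u ≠ 0) {N : Set ℂ} (hN : IsSingularSet N)
    {Φ Ψ : ℂ → ℂ} (hvΦ : ∀ z ∉ N, ∀ j, v j z = Φ z * u j z) (hwΨ : ∀ z ∉ N, ∀ j, w j z = Ψ z * u j z)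
    (dΦ : ∀ z ∉ N, DifferentiableAt ℝ Φ z) (dΨ : ∀ z ∉ N, DifferentiableAt ℝ Ψ z)
    (eΦ : ∀ z ∉ N, twoDzbar Φ z = 0) (eΨ : ∀ z ∉ N, twoDzbar Ψ z = 0)
    {p q c d : ℂ} {m n : ℂ → ℂ} (hc : c ≠ 0) (hd : d ≠ 0)
    (hm : Tendsto m (𝓝[≠] p) (𝓝 0)) (hmΦ : Tendsto (fun z => m z * Φ z) (𝓝[≠] p) (𝓝 c))
    (hmΨ : Tendsto (fun z => m z * Ψ z) (𝓝[≠] p) (𝓝 0))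
    (hn : Tendsto n (𝓝[≠] q) (𝓝 0)) (hnΨ : Tendsto (fun z => n z * Ψ z) (𝓝[≠] q) (𝓝 d)) :
    3 ≤ Module.finrank ℂ (sol V α k) := by
  obtain ⟨z₀, hz₀N, hz₀⟩ : ∃ z ∉ N, ¬VanishesAt u z := by
    by_contra! h
    apply hu0
    ext j z
    exact congrFun ((hu.1 j).continuous.ext_on hN.dense_compl continuous_const
      fun z hz => h z hz j) z
  have hli : LinearIndependent ℂ ![(⟨u, hu⟩ : sol V α k), ⟨v, hv⟩, ⟨w, hw⟩] := by
    rw [Fintype.linearIndependent_iff]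
    intro g hg
    rw [Fin.sum_univ_three] at hg
    have h1 : ∀ j z, g 0 * u j z + g 1 * v j z + g 2 * w j z = 0 := fun j z =>
      congrFun (congrFun (congrArg Subtype.val hg) j) z
    set G : ℂ → ℂ := fun z => g 0 + (g 1 * Φ z + g 2 * Ψ z) with hG
    have d1 : ∀ z ∉ N, DifferentiableAt ℝ (fun z => g 1 * Φ z) z := fun z hz => (dΦ z hz).const_mul _
    have d2 : ∀ z ∉ N, DifferentiableAt ℝ (fun z => g 2 * Ψ z) z := fun z hz => (dΨ z hz).const_mul _
    have d3 : ∀ z ∉ N, DifferentiableAt ℝ (fun z => g 1 * Φ z + g 2 * Ψ z) z :=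
      fun z hz => (d1 z hz).add (d2 z hz)
    -- A linear relation makes `G u = 0`, hence `G = 0` near a point where `u ≠ 0`, and holomorphy
    -- propagates this past other zeros of `u`.
    have hG0 : ∀ z ∉ N, G z = 0 := by
      refine eq_zero_of_eventually_eq_zero hN (fun z hz => (differentiableAt_const _).add (d3 z hz))
        (fun z hz => ?_) hz₀N ?_
      · rw [hG, twoDzbar_add (differentiableAt_const _) (d3 z hz), twoDzbar_add (d1 z hz) (d2 z hz),
          twoDzbar_const_mul _ (dΦ z hz), twoDzbar_const_mul _ (dΨ z hz), twoDzbar_const, eΦ z hz,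
          eΨ z hz]
        ring
      · filter_upwards [eventually_not_vanishesAt hu.1 hz₀, hN.eventually_notMem hz₀N] with z hz hzN
        rw [VanishesAt, not_forall] at hz
        obtain ⟨j, hj⟩ := hz
        refine (mul_eq_zero.1 ?_).resolve_right hj
        have := h1 j z
        rw [hvΦ z hzN, hwΨ z hzN] at this
        rw [hG]
        linear_combination this
    -- The factor `m` sees only the dominant singularity of `Φ` at `p`; once `g 1 = 0`, the factor
    -- `n` isolates `Ψ` at `q`.
    have t1 : Tendsto (fun z => m z * G z) (𝓝[≠] p) (𝓝 (g 0 * 0 + (g 1 * c + g 2 * 0))) :=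
      ((hm.const_mul _).add ((hmΦ.const_mul _).add (hmΨ.const_mul _))).congr fun z => by
        simp only [hG]; ring
    have t2 : Tendsto (fun z => m z * G z) (𝓝[≠] p) (𝓝 0) := tendsto_const_nhds.congr' (by
      filter_upwards [hN.discrete p] with z hz
      rw [hG0 z hz, mul_zero])
    have h2 : g 1 = 0 := by simpa [hc] using tendsto_nhds_unique t1 t2
    have t3 : Tendsto (fun z => n z * G z) (𝓝[≠] q) (𝓝 (g 0 * 0 + g 2 * d)) :=
      ((hn.const_mul _).add (hnΨ.const_mul _)).congr fun z => by
        simp only [hG, h2]; ring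
    have t4 : Tendsto (fun z => n z * G z) (𝓝[≠] q) (𝓝 0) := tendsto_const_nhds.congr' (by
      filter_upwards [hN.discrete q] with z hz
      rw [hG0 z hz, mul_zero])
    have h3 : g 2 = 0 := by simpa [hd] using tendsto_nhds_unique t3 t4
    have h4 := hG0 z₀ hz₀N
    rw [hG] at h4
    simp only [h2, h3] at h4
    intro i
    fin_cases i
    · simpa using h4
    · exact h2
    · exact h3
  simpa using hli.fintype_card_le_finrank

/-! ### Zeros of solutions -/

theorem dz_periodic {f : ℂ → ℂ} (h : Periodic f) {γ : ℂ} (hγ : γ ∈ lattice) (z : ℂ) :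
    dz f (z + γ) = dz f z := by
  simp only [dz, dx1, dx2, fderiv_periodic h hγ]

theorem eq_of_mem_orbit {f : ℂ → ℂ} (h : Periodic f) {p z : ℂ} (hz : z ∈ orbit p) : f z = f p := by
  have := h _ hz p
  rwa [add_sub_cancel] at this

theorem VanishesAt.of_mem_orbit {u : Fin 2 → ℂ → ℂ} (hu : ∀ j, IsTest (u j)) {p : ℂ}
    (h : VanishesAt u p) {z : ℂ} (hz : z ∈ orbit p) : VanishesAt u z := fun j => by
  rw [eq_of_mem_orbit (hu j).periodic hz, h j]

theorem dz_eq_of_mem_orbit {f : ℂ → ℂ} (h : Periodic f) {p z : ℂ} (hz : z ∈ orbit p) :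
    dz f z = dz f p :=
  eq_of_mem_orbit (f := dz f) (fun _ hγ w => dz_periodic h hγ w) hz

theorem SimpleZeroAt.of_mem_orbit {u : Fin 2 → ℂ → ℂ} (hu : ∀ j, IsTest (u j)) {p : ℂ}
    (h : SimpleZeroAt u p) {z : ℂ} (hz : z ∈ orbit p) : SimpleZeroAt u z := by
  obtain ⟨h1, j, hj⟩ := h
  exact ⟨h1.of_mem_orbit hu hz, j, by rwa [dz_eq_of_mem_orbit (hu j).periodic hz]⟩

theorem HasPoles.differentiableAt {κ : ℂ} {P : Set ℂ} {r Φ : ℂ → ℂ} (h : HasPoles κ P r Φ) {z : ℂ}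
    (hz : z ∉ P) : DifferentiableAt ℝ Φ z := (h.smooth z hz).differentiableAt (by simp)

theorem tendsto_sub_self (p : ℂ) : Tendsto (fun z => z - p) (𝓝[≠] p) (𝓝 0) := by
  have := ((continuous_sub_right p).tendsto p).mono_left (nhdsWithin_le_nhds (s := {p}ᶜ))
  rwa [sub_self] at this

theorem notMem_lattice_comm {p q : ℂ} (h : p - q ∉ lattice) : q - p ∉ lattice := fun h0 => h (by
  rw [← neg_sub]; exact lattice.neg_mem h0)

/-- The multipliers are `1`, an elliptic function with poles at `p, q`, and one with poles at `p,
r`; they are told apart by their poles at `q` and `r`. -/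
theorem three_le_finrank_of_three_zeros {V : Potential} {α k : ℂ} {u : Fin 2 → ℂ → ℂ}
    (hu : u ∈ sol V α k) (hu0 : u ≠ 0) {p q r : ℂ} (hpq : p - q ∉ lattice) (hpr : p - r ∉ lattice)
    (hqr : q - r ∉ lattice) (hp : VanishesAt u p) (hq : VanishesAt u q) (hr : VanishesAt u r) :
    3 ≤ Module.finrank ℂ (sol V α k) := by
  obtain ⟨s, Φ, hΦ, -, hs⟩ := exists_twoPoles hpq
  obtain ⟨t, Ψ, hΨ, -, ht⟩ := exists_twoPoles hpr
  obtain ⟨v, hv, hvΦ, -⟩ := exists_mul_sol hu hΦ fun z hz =>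
    hz.elim (hp.of_mem_orbit hu.1) (hq.of_mem_orbit hu.1)
  obtain ⟨w, hw, hwΨ, -⟩ := exists_mul_sol hu hΨ fun z hz =>
    hz.elim (hp.of_mem_orbit hu.1) (hr.of_mem_orbit hu.1)
  rw [add_zero] at hv hw
  have tΦ := hΦ.tendsto (Or.inr (self_mem_orbit q))
  have tΨ := hΨ.tendsto (Or.inr (self_mem_orbit r))
  rw [hs q (self_mem_orbit q)] at tΦ
  rw [ht r (self_mem_orbit r)] at tΨ
  have hqN : q ∉ orbit p ∪ orbit r := fun h => h.elim (notMem_lattice_comm hpq) hqr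
  have tΨ0 := (tendsto_sub_self q).mul
    ((hΨ.differentiableAt hqN).continuousAt.tendsto.mono_left nhdsWithin_le_nhds)
  rw [zero_mul] at tΨ0
  refine three_le_finrank hu hv hw hu0 (hΦ.isSingularSet.union hΨ.isSingularSet)
    (fun z hz => hvΦ z fun h => hz (Or.inl h)) (fun z hz => hwΨ z fun h => hz (Or.inr h))
    (fun z hz => hΦ.differentiableAt fun h => hz (Or.inl h))
    (fun z hz => hΨ.differentiableAt fun h => hz (Or.inr h))
    (fun z hz => ?_) (fun z hz => ?_) (neg_ne_zero.2 one_ne_zero) (neg_ne_zero.2 one_ne_zero)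
    (tendsto_sub_self q) tΦ tΨ0 (tendsto_sub_self r) tΨ
  · simpa using hΦ.eqn z fun h => hz (Or.inl h)
  · simpa using hΨ.eqn z fun h => hz (Or.inr h)

theorem HasPoles.eqn_mul {κ κ' : ℂ} {P : Set ℂ} {r Φ Φ' : ℂ → ℂ} (h : HasPoles κ P r Φ)
    {z : ℂ} (hz : z ∉ P) (hd : DifferentiableAt ℝ Φ' z) (he : twoDzbar Φ' z + κ' * Φ' z = 0) :
    twoDzbar (fun z => Φ z * Φ' z) z + (κ + κ') * (Φ z * Φ' z) = 0 := by
  rw [twoDzbar_mul (h.differentiableAt hz) hd]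
  linear_combination Φ' z * h.eqn z hz + Φ z * he

/-- Dividing a solution by a simple zero. -/
theorem exists_mul_simplePole {V : Potential} {α k κ : ℂ} {u : Fin 2 → ℂ → ℂ} (hu : u ∈ sol V α k)
    {p : ℂ} {F : ℂ → ℂ} (hF : HasPoles κ (orbit p) (fun _ => 1) F) (hp : VanishesAt u p) :
    ∃ v ∈ sol V α (k + κ), (∀ z ∉ orbit p, ∀ j, v j z = F z * u j z) ∧ ∀ j, v j p = dz (u j) p := by
  obtain ⟨v, hv, h1, h2⟩ := exists_mul_sol hu hF fun z hz => hp.of_mem_orbit hu.1 hz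
  exact ⟨v, hv, h1, fun j => by rw [h2 p (self_mem_orbit p), one_mul]⟩

/-- A function with a double pole at `p` is the product of simple pole functions with parameters `1`
and `-1`. After division by the first, the solution takes the value `∂_z u(p) = 0` at `p`, so it can
be divided again. -/
theorem three_le_finrank_of_double_zero {V : Potential} {α k : ℂ} {u : Fin 2 → ℂ → ℂ}
    (hu : u ∈ sol V α k) (hu0 : u ≠ 0) {p q : ℂ} (hpq : p - q ∉ lattice)
    (hp : VanishesAt u p) (hq : VanishesAt u q) (hdz : ∀ j, dz (u j) p = 0) :
    3 ≤ Module.finrank ℂ (sol V α k) := by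
  obtain ⟨t, Ψ, hΨ, ht, -⟩ := exists_twoPoles hpq
  obtain ⟨w, hw, hwΨ, -⟩ := exists_mul_sol hu hΨ fun z hz =>
    hz.elim (hp.of_mem_orbit hu.1) (hq.of_mem_orbit hu.1)
  obtain ⟨F, hF⟩ := exists_simplePole one_not_mem_dual p
  obtain ⟨G, hG⟩ := exists_simplePole (neg_notMem_dual one_not_mem_dual) p
  obtain ⟨v, hv, hvF, hvp⟩ := exists_mul_simplePole hu hF hp
  obtain ⟨v', hv', hvG, -⟩ := exists_mul_simplePole hv hG fun j => by rw [hvp, hdz]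
  rw [add_neg_cancel_right] at hv'
  rw [add_zero] at hw
  have tF := hF.tendsto (self_mem_orbit p)
  have tG := hG.tendsto (self_mem_orbit p)
  have tΨ := hΨ.tendsto (Or.inl (self_mem_orbit p))
  rw [ht p (self_mem_orbit p)] at tΨ
  have t0 := tendsto_sub_self p
  refine three_le_finrank hu hv' hw hu0 (hF.isSingularSet.union hΨ.isSingularSet)
    (Φ := fun z => G z * F z) (Ψ := Ψ) (p := p) (q := p) (c := 1) (d := 1)
    (m := fun z => (z - p) * (z - p)) (n := fun z => z - p)
    (fun z hz j => by
      rw [hvG z fun h => hz (Or.inl h), hvF z fun h => hz (Or.inl h), mul_assoc])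
    (fun z hz => hwΨ z fun h => hz (Or.inr h))
    (fun z hz => (hG.differentiableAt fun h => hz (Or.inl h)).mul
      (hF.differentiableAt fun h => hz (Or.inl h)))
    (fun z hz => hΨ.differentiableAt fun h => hz (Or.inr h))
    (fun z hz => ?_) (fun z hz => ?_) one_ne_zero one_ne_zero ?_ ?_ ?_ t0 tΨ
  · have hz' : z ∉ orbit p := fun h => hz (Or.inl h)
    simpa using hG.eqn_mul hz' (hF.differentiableAt hz') (hF.eqn z hz')
  · simpa using hΨ.eqn z fun h => hz (Or.inr h)
  · simpa using t0.mul t0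
  · have := tG.mul tF
    rw [one_mul] at this
    exact this.congr fun z => by ring
  · have := t0.mul tΨ
    rw [zero_mul] at this
    exact this.congr fun z => by ring

/-- The multipliers have poles of orders `0`, `2` and `3` at `p`, built from simple pole functions
whose parameters sum to zero. -/
theorem three_le_finrank_of_triple_zero {V : Potential} {α k : ℂ} {u : Fin 2 → ℂ → ℂ}
    (hu : u ∈ sol V α k) (hu0 : u ≠ 0) {p : ℂ} (hp : VanishesAt u p) (hdz : ∀ j, dz (u j) p = 0)
    (h2 : ∀ j, Tendsto (fun z => u j z / (z - p) ^ 2) (𝓝[≠] p) (𝓝 0)) :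
    3 ≤ Module.finrank ℂ (sol V α k) := by
  -- The three factors of the triple pole have parameters `1`, `κ` and `-(1 + κ)`, all of which must
  -- avoid the dual lattice.
  obtain ⟨κ, hκ, hκ'⟩ := exists_notMem_dual 0 1
  simp only [zero_add] at hκ
  obtain ⟨F, hF⟩ := exists_simplePole one_not_mem_dual p
  obtain ⟨G, hG⟩ := exists_simplePole (neg_notMem_dual one_not_mem_dual) p
  obtain ⟨G₁, hG₁⟩ := exists_simplePole hκ p
  obtain ⟨G₂, hG₂⟩ := exists_simplePole (neg_notMem_dual hκ') p
  obtain ⟨v, hv, hvF, hvp⟩ := exists_mul_simplePole hu hF hp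
  have hvp0 : VanishesAt v p := fun j => by rw [hvp, hdz]
  have tF := hF.tendsto (self_mem_orbit p)
  have tG := hG.tendsto (self_mem_orbit p)
  have tG₁ := hG₁.tendsto (self_mem_orbit p)
  have tG₂ := hG₂.tendsto (self_mem_orbit p)
  have t0 := tendsto_sub_self p
  -- Here `v / (z - p)` equals `(z - p) F` times `u / (z - p)²`, so the vanishing second order
  -- quotient gives a second zero derivative.
  have hvd : ∀ j, dz (v j) p = 0 := by
    intro j
    have h3 := tF.mul (h2 j)
    rw [mul_zero] at h3
    refine tendsto_nhds_unique (sol_tendsto_div hv hvp0 j) (h3.congr' ?_)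
    filter_upwards [eventually_mem_nhdsWithin, hF.discrete p] with z hz hzo
    have : z - p ≠ 0 := sub_ne_zero.2 hz
    rw [hvF z hzo]
    field_simp
  obtain ⟨w, hw, hwG, -⟩ := exists_mul_simplePole hv hG hvp0
  obtain ⟨v₁, hv₁, hv₁G, hv₁p⟩ := exists_mul_simplePole hv hG₁ hvp0
  obtain ⟨v₂, hv₂, hv₂G, -⟩ := exists_mul_simplePole hv₁ hG₂ fun j => by rw [hv₁p, hvd]
  rw [add_neg_cancel_right] at hw
  rw [add_assoc k, add_neg_cancel_right] at hv₂
  refine three_le_finrank hu hv₂ hw hu0 hF.isSingularSet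
    (Φ := fun z => G₂ z * (G₁ z * F z)) (Ψ := fun z => G z * F z) (p := p) (q := p) (c := 1) (d := 1)
    (m := fun z => (z - p) * ((z - p) * (z - p))) (n := fun z => (z - p) * (z - p))
    (fun z hz j => by rw [hv₂G z hz, hv₁G z hz, hvF z hz]; ring)
    (fun z hz j => by rw [hwG z hz, hvF z hz]; ring)
    (fun z hz => (hG₂.differentiableAt hz).mul ((hG₁.differentiableAt hz).mul
      (hF.differentiableAt hz)))
    (fun z hz => (hG.differentiableAt hz).mul (hF.differentiableAt hz))
    (fun z hz => ?_) (fun z hz => ?_) one_ne_zero one_ne_zero ?_ ?_ ?_ ?_ ?_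
  · have h3 := hG₁.eqn_mul hz (hF.differentiableAt hz) (hF.eqn z hz)
    have h4 := hG₂.eqn_mul hz ((hG₁.differentiableAt hz).mul (hF.differentiableAt hz)) h3
    rw [add_comm κ 1, neg_add_cancel, zero_mul, add_zero] at h4
    exact h4
  · simpa using hG.eqn_mul hz (hF.differentiableAt hz) (hF.eqn z hz)
  · simpa using t0.mul (t0.mul t0)
  · have := tG₂.mul (tG₁.mul tF)
    simp only [one_mul] at this
    exact this.congr fun z => by ring
  · have := t0.mul (tG.mul tF)
    rw [zero_mul] at this
    exact this.congr fun z => by ring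
  · simpa using t0.mul t0
  · have := tG.mul tF
    rw [one_mul] at this
    exact this.congr fun z => by ring

/-! ### The stacking points -/

theorem zS_eq : 3 * zS = 1 + 2 * ω := by
  have h3 := sqrt3_ne
  have h := sqrt3_sq
  rw [zS, omega_eq]
  have e : (⟨-1 / 2, Real.sqrt 3 / 2⟩ : ℂ) = -1 / 2 + (Real.sqrt 3 : ℝ) / 2 * Complex.I := by
    apply Complex.ext <;> simp
  rw [e]
  field_simp
  linear_combination (-Complex.I) * h

theorem lattice_coords {a b c d : ℝ} (h : (a + b * ω : ℂ) = c + d * ω) : a = c ∧ b = d := by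
  have h1 := par.injective (a₁ := (a, b)) (a₂ := (c, d)) (by simpa [par_apply] using h)
  exact ⟨congrArg Prod.fst h1, congrArg Prod.snd h1⟩

theorem zS_sub_neg_notMem : zS - -zS ∉ lattice := by
  rintro ⟨m, n, h⟩
  have h1 : ((2 : ℝ) + (4 : ℝ) * ω : ℂ) = ((3 * m : ℝ) : ℂ) + ((3 * n : ℝ) : ℂ) * ω := by
    push_cast
    linear_combination 3 * h - 2 * zS_eq
  have h2 : (2 : ℝ) = 3 * m := (lattice_coords h1).1
  have h3 : (2 : ℤ) = 3 * m := by exact_mod_cast h2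
  omega

/-- Rotation by `τ` exchanges the two stacking points modulo `Λ`. -/
theorem tau_mul_zS_add : τ * zS + zS ∈ lattice := by
  refine ⟨1, 1, ?_⟩
  rw [tau_eq]
  push_cast
  linear_combination ((1 - ω) / 3) * zS_eq - (2 / 3) * omega_sq

theorem tau_mul_neg_zS_sub : τ * -zS - zS ∈ lattice := by
  have := lattice.neg_mem tau_mul_zS_add
  rwa [neg_add, ← mul_neg, ← sub_eq_add_neg] at this

/-- The points of the torus fixed by `τ²`. -/
theorem fixed_points {z : ℂ} (h : τ ^ 2 * z - z ∈ lattice) :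
    z ∈ lattice ∨ z - zS ∈ lattice ∨ z + zS ∈ lattice := by
  obtain ⟨m, n, h⟩ := h
  rw [tau_eq] at h
  -- Multiply by `ω - 1`, since `(ω - 1)(ω² - 1) = 3`. The residue of `m + n` modulo `3` then
  -- selects the class of `z`.
  have h1 : 3 * z = -(m + n) + (m - 2 * n) * ω := by
    linear_combination (ω - 1) * h + (-z * ω + 2 * z + n) * omega_sq
  obtain ⟨a, e, hae, he⟩ : ∃ a e : ℤ, m + n = 3 * a + e ∧ (e = 0 ∨ e = 1 ∨ e = 2) :=
    ⟨(m + n) / 3, (m + n) % 3, by omega, by omega⟩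
  have h2 : (m : ℂ) = 3 * a + e - n := by
    have : ((m + n : ℤ) : ℂ) = ((3 * a + e : ℤ) : ℂ) := by rw [hae]
    push_cast at this
    linear_combination this
  have h3 := zS_eq
  rw [h2] at h1
  obtain rfl | rfl | rfl := he
  · left
    refine ⟨-a, a - n, ?_⟩
    push_cast at h1 ⊢
    linear_combination h1 / 3
  · right; right
    refine ⟨-a, a - n + 1, ?_⟩
    push_cast at h1 ⊢
    linear_combination h1 / 3 + h3 / 3
  · right; left
    refine ⟨-a - 1, a - n, ?_⟩
    push_cast at h1 ⊢
    linear_combination h1 / 3 - h3 / 3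

/-- An additional zero, or multiplicity at a stacking point, would produce a third independent
solution. -/
theorem zerosExactlyStacking_of_finrank_le {V : Potential} {α : ℂ} {u : Fin 2 → ℂ → ℂ}
    (hu : u ∈ sol V α 0) (hu0 : u ≠ 0) (hf : Module.finrank ℂ (sol V α 0) ≤ 2)
    (h1 : VanishesAt u zS) (h2 : VanishesAt u (-zS)) : ZerosExactlyStacking u := by
  refine ⟨⟨h1, ?_⟩, ⟨h2, ?_⟩, fun z hz => ?_⟩
  · by_contra! h
    have := three_le_finrank_of_double_zero hu hu0 zS_sub_neg_notMem h1 h2 h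
    omega
  · by_contra! h
    have := three_le_finrank_of_double_zero hu hu0 (notMem_lattice_comm zS_sub_neg_notMem) h2 h1 h
    omega
  · by_contra! h
    rw [← sub_neg_eq_add] at h
    have := three_le_finrank_of_three_zeros hu hu0 zS_sub_neg_notMem (notMem_lattice_comm h.1)
      (notMem_lattice_comm h.2) h1 h2 hz
    omega

/-! ### Solutions determined by their zeros -/

theorem sol_ext {u v : Fin 2 → ℂ → ℂ} (hu : ∀ j, IsTest (u j)) (hv : ∀ j, IsTest (v j))
    {N : Set ℂ} (hN : IsSingularSet N) (h : ∀ z ∉ N, ∀ j, u j z = v j z) : u = v := by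
  ext j z
  exact congrFun ((hu j).continuous.ext_on hN.dense_compl (hv j).continuous fun z hz => h z hz j) z

/-- The ratio is elliptic with at most one simple pole modulo `Λ`, at `q`, hence constant. -/
theorem exists_smul_of_simple_zeros {V : Potential} {α k : ℂ} {u v : Fin 2 → ℂ → ℂ}
    (hu : u ∈ sol V α k) (hv : v ∈ sol V α k) (hw : ∀ z, wronskian u v z = 0) {N : Set ℂ}
    (hN : IsSingularSet N) (hz : ∀ z ∉ N, ¬VanishesAt u z) (hs : ∀ z ∈ N, SimpleZeroAt u z)
    {q : ℂ} (hq : q ∈ N) (hvN : ∀ z ∈ N, z ∉ orbit q → VanishesAt v z) : ∃ c : ℂ, v = c • u := by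
  obtain ⟨r, hr⟩ := exists_tendsto_mul_ratio hu hv (hs q hq)
  obtain ⟨c, hc⟩ := eq_const_of_tendsto hN (periodic_ratio hu.1 hv.1)
    (fun z hzN => differentiableAt_ratio hu.1 hv.1 (hz z hzN))
    (fun z hzN => by simpa using twoDzbar_ratio hu hv hw (hz z hzN))
    (fun p hp hpq => exists_tendsto_ratio hu hv (hs p hp) (hvN p hp hpq)) hr
  refine ⟨c, sol_ext hv.1 ((sol V α k).smul_mem c hu).1 hN fun z hzN j => ?_⟩
  rw [ratio_mul (hz z hzN) (hw z) j, hc z hzN]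
  rfl

/-- All singularities of the ratio are removable, and the nonresonant equation then leaves only
zero. -/
theorem eq_zero_of_simple_zeros {V : Potential} {α k κ : ℂ} {u v : Fin 2 → ℂ → ℂ}
    (hu : u ∈ sol V α k) (hv : v ∈ sol V α κ) (hκ : ∀ n, freq n + (κ - k) ≠ 0)
    (hw : ∀ z, wronskian u v z = 0) {N : Set ℂ}
    (hN : IsSingularSet N) (hz : ∀ z ∉ N, ¬VanishesAt u z) (hs : ∀ z ∈ N, SimpleZeroAt u z)
    (hvN : ∀ z ∈ N, VanishesAt v z) : v = 0 := by
  have h0 := eq_zero_of_tendsto hN hκ (periodic_ratio hu.1 hv.1)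
    (fun z hzN => differentiableAt_ratio hu.1 hv.1 (hz z hzN))
    (fun z hzN => twoDzbar_ratio hu hv hw (hz z hzN))
    (fun p hp => exists_tendsto_ratio hu hv (hs p hp) (hvN p hp))
  refine sol_ext hv.1 (fun _ => isTest_const 0) hN fun z hzN j => ?_
  rw [ratio_mul (hz z hzN) (hw z) j, h0 z hzN, zero_mul]
  rfl

/-- Dividing the Wronskian by `z - p` and passing to the limit shows that `v(p)` is parallel to `∂_z
u(p)`. So one scalar evaluation detects the vanishing of `v` at `p`. -/
theorem vanishesAt_of_apply_eq_zero {V : Potential} {α k k' : ℂ} {u v : Fin 2 → ℂ → ℂ}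
    (hu : u ∈ sol V α k) (hv : v ∈ sol V α k') (hw : ∀ z, wronskian u v z = 0) {p : ℂ}
    (hp : VanishesAt u p) {j : Fin 2} (hj : dz (u j) p ≠ 0) (hvj : v j p = 0) :
    VanishesAt v p := by
  have hφ (j) := sol_tendsto_div hu hp j
  have hvc (j) : Tendsto (v j) (𝓝[≠] p) (𝓝 (v j p)) :=
    (hv.1 j).continuous.continuousAt.tendsto.mono_left nhdsWithin_le_nhds
  have h1 := ((hφ 0).mul (hvc 1)).sub ((hφ 1).mul (hvc 0))
  have h2 : dz (u 0) p * v 1 p - dz (u 1) p * v 0 p = 0 := by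
    refine tendsto_nhds_unique h1 (tendsto_const_nhds.congr fun z => ?_)
    have := hw z
    rw [wronskian] at this
    rw [div_mul_eq_mul_div, div_mul_eq_mul_div, ← sub_div, this, zero_div]
  rw [vanishesAt_iff]
  fin_cases j
  · simp only [Fin.zero_eta] at hj hvj
    rw [hvj, mul_zero, sub_zero] at h2
    exact ⟨hvj, (mul_eq_zero.1 h2).resolve_left hj⟩
  · simp only [Fin.mk_one] at hj hvj
    rw [hvj, mul_zero, zero_sub, neg_eq_zero] at h2
    exact ⟨(mul_eq_zero.1 h2).resolve_left hj, hvj⟩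

/-- Evaluation of a component at a point. -/
def evalAt (V : Potential) (α k : ℂ) (j : Fin 2) (p : ℂ) : sol V α k →ₗ[ℂ] ℂ where
  toFun v := v.1 j p
  map_add' _ _ := rfl
  map_smul' _ _ := rfl

theorem finrank_le_one_of_forall_smul {E : Type*} [AddCommGroup E] [Module ℂ E] {S : Submodule ℂ E}
    {u : E} (h : ∀ v ∈ S, ∃ c : ℂ, v = c • u) : Module.finrank ℂ S ≤ 1 := by
  have hle : S ≤ Submodule.span ℂ {u} := fun v hv => by
    obtain ⟨c, rfl⟩ := h v hv
    exact Submodule.smul_mem _ _ (Submodule.mem_span_singleton_self u)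
  refine (Submodule.finrank_mono hle).trans ?_
  simpa using finrank_span_le_card (R := ℂ) ({u} : Set E)

/-! ### Multiplication by characters -/

theorem finrank_sol_le_shift (V : Potential) (α k : ℂ) (m : ℤ × ℤ) :
    Module.finrank ℂ (sol V α k) ≤ Module.finrank ℂ (sol V α (k - freq m)) := by
  let L : sol V α k →ₗ[ℂ] sol V α (k - freq m) :=
    { toFun := fun v => ⟨fun j z => expo m z * v.1 j z, fun j => (isTest_expo m).mul (v.2.1 j),
        fun z => by
          rw [twoDzbar_mul ((isTest_expo m).differentiable z) ((v.2.1 0).differentiable z),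
            twoDzbar_expo]
          linear_combination expo m z * v.2.2.1 z,
        fun z => by
          rw [twoDzbar_mul ((isTest_expo m).differentiable z) ((v.2.1 1).differentiable z),
            twoDzbar_expo]
          linear_combination expo m z * v.2.2.2 z⟩
      map_add' := fun v w => Subtype.ext (by ext j z; exact mul_add _ _ _)
      map_smul' := fun c v => Subtype.ext (by ext j z; exact mul_left_comm _ _ _) }
  refine LinearMap.finrank_le_finrank_of_injective (f := L) ((injective_iff_map_eq_zero _).2 fun v hv => ?_)
  ext j z
  have h : expo m z * v.1 j z = 0 := congrFun (congrFun (congrArg Subtype.val hv) j) z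
  exact (mul_eq_zero.1 h).resolve_left (expo_ne_zero m z)

/-! ### Solutions with simple zeros at the stacking points -/

/-- The stacking points. -/
def stacking : Set ℂ := orbit zS ∪ orbit (-zS)

theorem isSingularSet_stacking : IsSingularSet stacking :=
  (isSingularSet_orbit _).union (isSingularSet_orbit _)

theorem ZerosExactlyStacking.not_vanishesAt {u : Fin 2 → ℂ → ℂ} (h : ZerosExactlyStacking u) {z : ℂ}
    (hz : z ∉ stacking) : ¬VanishesAt u z := fun h0 => hz (by
  rcases h.2.2 z h0 with h1 | h1
  · exact Or.inl h1
  · right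
    rwa [mem_orbit, sub_neg_eq_add])

theorem ZerosExactlyStacking.simpleZeroAt {u : Fin 2 → ℂ → ℂ} (h : ZerosExactlyStacking u)
    (hu : ∀ j, IsTest (u j)) {z : ℂ} (hz : z ∈ stacking) : SimpleZeroAt u z :=
  hz.elim (h.1.of_mem_orbit hu) (h.2.1.of_mem_orbit hu)

theorem vanishesAt_stacking {u : Fin 2 → ℂ → ℂ} (hu : ∀ j, IsTest (u j)) (h1 : VanishesAt u zS)
    (h2 : VanishesAt u (-zS)) {z : ℂ} (hz : z ∈ stacking) : VanishesAt u z :=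
  hz.elim (h1.of_mem_orbit hu) (h2.of_mem_orbit hu)

theorem linearIndependent_of_eval {V : Potential} {α k : ℂ} {v w : Fin 2 → ℂ → ℂ}
    (hv : v ∈ sol V α k) (hw : w ∈ sol V α k) {i : Fin 2} {p : ℂ} (hvp : v i p = 0)
    (hwp : w i p ≠ 0) (hv0 : v ≠ 0) :
    LinearIndependent ℂ ![(⟨v, hv⟩ : sol V α k), ⟨w, hw⟩] := by
  rw [LinearIndependent.pair_iff]
  intro s t hst
  have h1 : ∀ j z, s * v j z + t * w j z = 0 := fun j z =>
    congrFun (congrFun (congrArg Subtype.val hst) j) z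
  have ht : t = 0 := by
    have := h1 i p
    rw [hvp, mul_zero, zero_add] at this
    exact (mul_eq_zero.1 this).resolve_right hwp
  refine ⟨?_, ht⟩
  by_contra hs
  apply hv0
  ext j z
  have := h1 j z
  rw [ht, zero_mul, add_zero] at this
  exact (mul_eq_zero.1 this).resolve_left hs

theorem two_le_finrank_of_eval {V : Potential} {α k : ℂ} {v w : Fin 2 → ℂ → ℂ}
    (hv : v ∈ sol V α k) (hw : w ∈ sol V α k) {i : Fin 2} {p : ℂ} (hvp : v i p = 0)
    (hwp : w i p ≠ 0) (hv0 : v ≠ 0) : 2 ≤ Module.finrank ℂ (sol V α k) := by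
  simpa using (linearIndependent_of_eval hv hw hvp hwp hv0).fintype_card_le_finrank

/-- The second solution, with opposite values at the stacking points. -/
theorem exists_second_sol {V : Potential} {α : ℂ} {u : Fin 2 → ℂ → ℂ} (hu : u ∈ sol V α 0)
    (h1 : VanishesAt u zS) (h2 : VanishesAt u (-zS)) :
    ∃ w ∈ sol V α 0, (∀ j, w j zS = dz (u j) zS) ∧ ∀ j, w j (-zS) = -dz (u j) (-zS) := by
  obtain ⟨r, Φ, hΦ, hr, hr'⟩ := exists_twoPoles zS_sub_neg_notMem
  obtain ⟨w, hw, -, hw2⟩ := exists_mul_sol hu hΦ fun z hz => vanishesAt_stacking hu.1 h1 h2 hz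
  rw [add_zero] at hw
  refine ⟨w, hw, fun j => ?_, fun j => ?_⟩
  · rw [hw2 zS (Or.inl (self_mem_orbit _)), hr zS (self_mem_orbit _), one_mul]
  · rw [hw2 (-zS) (Or.inr (self_mem_orbit _)), hr' (-zS) (self_mem_orbit _), neg_one_mul]

theorem ZerosExactlyStacking.ne_zero {u : Fin 2 → ℂ → ℂ} (h : ZerosExactlyStacking u) : u ≠ 0 := by
  rintro rfl
  obtain ⟨j, hj⟩ := h.1.2
  apply hj
  have : ((0 : Fin 2 → ℂ → ℂ) j) = fun _ => 0 := rfl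
  rw [this]
  simp [dz, dx1, dx2]

/-- A solution vanishing at one of the stacking points is a multiple of `u`. -/
theorem ZerosExactlyStacking.exists_smul {V : Potential} {α : ℂ} (hα : α ∈ magic V)
    {u v : Fin 2 → ℂ → ℂ} (h : ZerosExactlyStacking u) (hu : u ∈ sol V α 0) (hv : v ∈ sol V α 0)
    (hvz : VanishesAt v zS) : ∃ c : ℂ, v = c • u :=
  exists_smul_of_simple_zeros hu hv (wronskian_eq_zero_of_magic hα hu hv) isSingularSet_stacking
    (fun _ hz => h.not_vanishesAt hz) (fun _ hz => h.simpleZeroAt hu.1 hz) (q := -zS)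
    (Or.inr (self_mem_orbit _))
    fun _ hz hzq => hvz.of_mem_orbit hv.1 (hz.resolve_right hzq)

/-- Evaluation of one component at `z_S` has rank at most one, and its kernel consists of multiples
of `u`; the second solution gives the lower bound. -/
theorem finrank_sol_zero_of_zeros {V : Potential} {α : ℂ} (hα : α ∈ magic V) {u : Fin 2 → ℂ → ℂ}
    (hu : u ∈ sol V α 0) (h : ZerosExactlyStacking u) : Module.finrank ℂ (sol V α 0) = 2 := by
  obtain ⟨j, hj⟩ := h.1.2
  obtain ⟨w, hw, hw1, -⟩ := exists_second_sol hu h.1.1 h.2.1.1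
  have hlow := two_le_finrank_of_eval hu hw (h.1.1 j) (by rwa [hw1]) h.ne_zero
  have hsum := (evalAt V α 0 j zS).finrank_range_add_finrank_ker
  have hr : Module.finrank ℂ (LinearMap.range (evalAt V α 0 j zS)) ≤ 1 := by
    simpa using Submodule.finrank_le (LinearMap.range (evalAt V α 0 j zS))
  have hk : Module.finrank ℂ (LinearMap.ker (evalAt V α 0 j zS)) ≤ 1 := by
    refine finrank_le_one_of_forall_smul (u := (⟨u, hu⟩ : sol V α 0)) fun v hv => ?_
    obtain ⟨c, hc⟩ := h.exists_smul hα hu v.2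
      (vanishesAt_of_apply_eq_zero hu v.2 (wronskian_eq_zero_of_magic hα hu v.2) h.1.1 hj hv)
    exact ⟨c, Subtype.ext hc⟩
  omega

theorem finrank_sol_of_zeros {V : Potential} {α : ℂ} (hα : α ∈ magic V) {u : Fin 2 → ℂ → ℂ}
    (hu : u ∈ sol V α 0) (h : ZerosExactlyStacking u) (k : ℂ) :
    Module.finrank ℂ (sol V α k) = 2 := by
  have h0 := finrank_sol_zero_of_zeros hα hu h
  by_cases hk : ∀ n, freq n + k ≠ 0
  · obtain ⟨i, hi⟩ := h.1.2
    obtain ⟨j, hj⟩ := h.2.1.2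
    obtain ⟨F, hF⟩ := exists_simplePole hk zS
    obtain ⟨G, hG⟩ := exists_simplePole hk (-zS)
    obtain ⟨v, hv, -, hv2⟩ := exists_mul_simplePole hu hF h.1.1
    obtain ⟨w, hw, hw1, hw2⟩ := exists_mul_simplePole hu hG h.2.1.1
    rw [zero_add] at hv hw
    have hwz : w i zS = 0 := by rw [hw1 zS zS_sub_neg_notMem, h.1.1 i, mul_zero]
    have hw0 : w ≠ 0 := by
      rintro rfl
      exact hj (hw2 j).symm
    refine le_antisymm ?_ (two_le_finrank_of_eval hw hv hwz (by rwa [hv2]) hw0)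
    -- A solution with zero image vanishes at both stacking points, so its ratio to `u` has no poles
    -- and is zero at the nonresonant `k`.
    let L := (evalAt V α k i zS).prod (evalAt V α k j (-zS))
    have hL : Function.Injective L := (injective_iff_map_eq_zero _).2 fun x hx => by
      have hW := wronskian_eq_zero_of_magic hα hu x.2
      have e1 : x.1 i zS = 0 := congrArg Prod.fst hx
      have e2 : x.1 j (-zS) = 0 := congrArg Prod.snd hx
      refine Subtype.ext (eq_zero_of_simple_zeros hu x.2 (by simpa using hk) hW
        isSingularSet_stacking (fun _ hz => h.not_vanishesAt hz)
        (fun _ hz => h.simpleZeroAt hu.1 hz) fun z hz => vanishesAt_stacking x.2.1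
          (vanishesAt_of_apply_eq_zero hu x.2 hW h.1.1 hi e1)
          (vanishesAt_of_apply_eq_zero hu x.2 hW h.2.1.1 hj e2) hz)
    simpa using LinearMap.finrank_le_finrank_of_injective hL
  -- At a resonant `k`, multiplication by characters in both directions identifies the dimension
  -- with that at `k = 0`.
  · push Not at hk
    obtain ⟨n, hn⟩ := hk
    have h1 := finrank_sol_le_shift V α k (-n)
    have h2 := finrank_sol_le_shift V α 0 n
    rw [freq_neg, show k - -freq n = 0 by linear_combination hn] at h1
    rw [show 0 - freq n = k by linear_combination -hn] at h2
    omega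

/-! ### The rotation -/

theorem tau_sq : τ ^ 2 = τ - 1 := by
  rw [tau_eq, neg_sq, omega_sq]; ring

theorem tau_cubed : τ ^ 3 = -1 := by
  linear_combination (τ + 1) * tau_sq

theorem tau_ne_one : τ ≠ 1 := fun h => tau_sq_ne_one (by rw [h, one_pow])

theorem conj_tau : conj τ = -τ ^ 2 := by
  have h := tau_mul_conj
  apply mul_right_cancel₀ tau_ne_zero
  linear_combination h + tau_cubed

theorem dz_comp_const_mul {f : ℂ → ℂ} {c z : ℂ} (hf : DifferentiableAt ℝ f (c * z)) :
    dz (fun w => f (c * w)) z = c * dz f (c * z) := by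
  simp only [dz, dx1, dx2]
  rw [fderiv_comp_const_mul hf, fderiv_comp_const_mul hf, fderiv_apply_eq f (c * z) (c * 1),
    fderiv_apply_eq f (c * z) (c * Complex.I)]
  have hc : c = c.re + c.im * Complex.I := (Complex.re_add_im c).symm
  generalize fderiv ℝ f (c * z) 1 = a
  generalize fderiv ℝ f (c * z) Complex.I = b
  conv_rhs => rw [hc]
  simp only [mul_one, Complex.mul_re, Complex.mul_im, Complex.I_re, Complex.I_im, mul_zero,
    zero_sub, Complex.ofReal_neg, add_zero]
  linear_combination (1 / 2 * (c.im : ℂ) * b) * Complex.I_sq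

theorem dz_const_mul (c : ℂ) {f : ℂ → ℂ} {z : ℂ} (hf : DifferentiableAt ℝ f z) :
    dz (fun w => c * f w) z = c * dz f z := by
  simp only [dz, dx1, dx2]
  rw [fderiv_const_mul hf]
  simp
  ring

/-- The rotation of pairs. -/
def rot (v : Fin 2 → ℂ → ℂ) : Fin 2 → ℂ → ℂ :=
  ![fun z => conj τ * v 0 (τ * z), fun z => v 1 (τ * z)]

theorem rot_mem {V : Potential} {α : ℂ} {v : Fin 2 → ℂ → ℂ} (hv : v ∈ sol V α 0) :
    rot v ∈ sol V α 0 := by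
  have hd (j) (z : ℂ) := (hv.1 j).differentiable z
  have hd' (j) (z : ℂ) : DifferentiableAt ℝ (fun z => v j (τ * z)) z :=
    (hv.1 j).comp_tau.differentiable z
  refine ⟨fun j => ?_, fun z => ?_, fun z => ?_⟩
  · fin_cases j
    · exact (hv.1 0).comp_tau.const_mul _
    · exact (hv.1 1).comp_tau
  · have h := hv.2.1 (τ * z)
    simp only [rot, Matrix.cons_val_zero, Matrix.cons_val_one]
    rw [twoDzbar_const_mul _ (hd' 0 z), twoDzbar_comp_const_mul (hd 0 _)]
    rw [V.apply_tau] at h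
    have h1 : conj τ * conj τ * τ ^ 2 = 1 := by
      linear_combination (conj τ * τ + 1) * tau_mul_conj
    linear_combination conj τ * conj τ * h - α * V z * v 1 (τ * z) * h1
  · have h := hv.2.2 (τ * z)
    simp only [rot, Matrix.cons_val_zero, Matrix.cons_val_one]
    rw [twoDzbar_comp_const_mul (hd 1 _)]
    linear_combination conj τ * h

theorem VanishesAt.tau_mul {u : Fin 2 → ℂ → ℂ} (hr : rot u = u) {z : ℂ} (h : VanishesAt u z) :
    VanishesAt u (τ * z) := by
  rw [← hr, vanishesAt_iff] at h
  have h1 : conj τ * u 0 (τ * z) = 0 := h.1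
  have h2 : u 1 (τ * z) = 0 := h.2
  have h3 : conj τ ≠ 0 := (map_ne_zero _).2 tau_ne_zero
  rw [vanishesAt_iff]
  exact ⟨(mul_eq_zero.1 h1).resolve_left h3, h2⟩

theorem rot_apply_zero {u : Fin 2 → ℂ → ℂ} (hr : rot u = u) (z : ℂ) :
    u 0 (τ * z) = τ * u 0 z := by
  have h : conj τ * u 0 (τ * z) = u 0 z := congrFun (congrFun hr 0) z
  linear_combination τ * h - u 0 (τ * z) * tau_mul_conj

theorem rot_apply_one {u : Fin 2 → ℂ → ℂ} (hr : rot u = u) (z : ℂ) : u 1 (τ * z) = u 1 z :=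
  congrFun (congrFun hr 1) z

/-- At a double zero at the origin, `u_j / z²` has a limit `L_j`. Rotation gives `L₀ = τ⁻¹ L₀` and
`L₁ = τ⁻² L₁`, so both limits vanish. -/
theorem tendsto_div_sq_zero {V : Potential} {α : ℂ} {u : Fin 2 → ℂ → ℂ} (hu : u ∈ sol V α 0)
    (hr : rot u = u) (h0 : VanishesAt u 0) (hdz : ∀ j, dz (u j) 0 = 0) (j : Fin 2) :
    Tendsto (fun z => u j z / (z - 0) ^ 2) (𝓝[≠] 0) (𝓝 0) := by
  obtain ⟨F, hF⟩ := exists_simplePole one_not_mem_dual 0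
  obtain ⟨v, hv, hvF, hvp⟩ := exists_mul_simplePole hu hF h0
  have tF := hF.tendsto (self_mem_orbit 0)
  have tv := sol_tendsto_div hv (fun j => by rw [hvp, hdz]) j
  have h1 : Tendsto (fun z => u j z / (z - 0) ^ 2) (𝓝[≠] 0) (𝓝 (dz (v j) 0)) := by
    have h2 := tv.div tF one_ne_zero
    rw [div_one] at h2
    refine h2.congr' ?_
    filter_upwards [eventually_mem_nhdsWithin, hF.discrete 0, tF.eventually_ne one_ne_zero]
      with z hz hzo hzF
    have h3 : z - 0 ≠ 0 := sub_ne_zero.2 hz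
    have h4 : F z ≠ 0 := right_ne_zero_of_mul hzF
    simp only [Pi.div_apply]
    rw [hvF z hzo]
    field_simp
  have hτ : Tendsto (fun z => τ * z) (𝓝[≠] 0) (𝓝[≠] 0) := by
    refine tendsto_nhdsWithin_iff.2 ⟨?_, ?_⟩
    · have := ((continuous_const_mul τ).tendsto 0).mono_left (nhdsWithin_le_nhds (s := {0}ᶜ))
      rwa [mul_zero] at this
    · filter_upwards [eventually_mem_nhdsWithin] with z hz
      exact mul_ne_zero tau_ne_zero hz
  have h2 := h1.comp hτ
  have h5 : dz (v j) 0 = 0 := by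
    fin_cases j
    · have h3 := (h1.const_mul τ⁻¹).congr (f₂ := (fun z => u 0 z / (z - 0) ^ 2) ∘ fun z => τ * z)
        fun z => by
          have := tau_ne_zero
          simp only [Function.comp_apply, sub_zero, rot_apply_zero hr, Fin.zero_eta]
          by_cases hz : z = 0
          · simp [hz]
          · field_simp
      have h4 := tendsto_nhds_unique h2 h3
      have h6 : (τ - 1) * dz (v 0) 0 = 0 := by
        have := tau_ne_zero
        simp only [Fin.zero_eta] at h4
        field_simp at h4
        linear_combination h4
      exact (mul_eq_zero.1 h6).resolve_left (sub_ne_zero.2 tau_ne_one)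
    · have h3 := (h1.const_mul (τ ^ 2)⁻¹).congr
        (f₂ := (fun z => u 1 z / (z - 0) ^ 2) ∘ fun z => τ * z)
        fun z => by
          have := tau_ne_zero
          simp only [Function.comp_apply, sub_zero, rot_apply_one hr, Fin.mk_one]
          by_cases hz : z = 0
          · simp [hz]
          · field_simp
      have h4 := tendsto_nhds_unique h2 h3
      have h6 : (τ ^ 2 - 1) * dz (v 1) 0 = 0 := by
        have := tau_ne_zero
        simp only [Fin.mk_one] at h4
        field_simp at h4
        linear_combination h4
      exact (mul_eq_zero.1 h6).resolve_left (sub_ne_zero.2 tau_sq_ne_one)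
  rwa [h5] at h1

/-- Rotation orbits of zeros have size at most two when the dimension is two. The only classes fixed
by `τ²` are those of `0` and `±z_S`, and zeros confined to `Λ` are incompatible with dimension two.
-/
theorem vanishesAt_zS {V : Potential} {α : ℂ} (hα : α ∈ magic V) {u : Fin 2 → ℂ → ℂ}
    (hu : u ∈ sol V α 0) (hu0 : u ≠ 0) (hr : rot u = u)
    (hf : Module.finrank ℂ (sol V α 0) = 2) : VanishesAt u zS ∧ VanishesAt u (-zS) := by
  by_cases h : ∃ z ∉ lattice, VanishesAt u z
  · obtain ⟨z, hz, hzu⟩ := h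
    by_cases hS : τ ^ 2 * z - z ∈ lattice
    · rcases fixed_points hS with h1 | h1 | h1
      · exact absurd h1 hz
      · have h2 : VanishesAt u zS := hzu.of_mem_orbit hu.1 (by
          rw [mem_orbit, ← neg_sub]; exact lattice.neg_mem h1)
        refine ⟨h2, (h2.tau_mul hr).of_mem_orbit hu.1 ?_⟩
        have := lattice.neg_mem tau_mul_zS_add
        rw [mem_orbit]
        convert this using 1
        ring
      · have h2 : VanishesAt u (-zS) := hzu.of_mem_orbit hu.1 (by
          rw [mem_orbit, ← neg_add', add_comm]; exact lattice.neg_mem h1)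
        refine ⟨(h2.tau_mul hr).of_mem_orbit hu.1 ?_, h2⟩
        rw [mem_orbit, ← neg_sub]
        exact lattice.neg_mem tau_mul_neg_zS_sub
    -- Since `τ(1 - τ) = 1`, congruence of `z` and `τz`, or of `τz` and `τ²z`, would put `z` in `Λ`;
    -- that of `z` and `τ²z` is the excluded case.
    · have h1 : z - τ * z ∉ lattice := fun h => hz (by
        have := mul_tau_mem_lattice h
        have e : τ * (z - τ * z) = z := by linear_combination (-z) * tau_sq
        rwa [e] at this)
      have h2 : τ * z - τ * (τ * z) ∉ lattice := fun h => hz (by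
        have e : τ * z - τ * (τ * z) = z := by linear_combination (-z) * tau_sq
        rwa [e] at h)
      have h3 : z - τ * (τ * z) ∉ lattice := fun h => hS (by
        have := lattice.neg_mem h
        have e : -(z - τ * (τ * z)) = τ ^ 2 * z - z := by ring
        rwa [e] at this)
      have := three_le_finrank_of_three_zeros hu hu0 h1 h3 h2 hzu (hzu.tau_mul hr)
        ((hzu.tau_mul hr).tau_mul hr)
      omega
  · exfalso
    push Not at h
    obtain ⟨z₀, hz₀⟩ := exists_vanishesAt hα hu
    have hz₀l : z₀ ∈ lattice := by
      by_contra h1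
      exact h z₀ h1 hz₀
    have h0 : VanishesAt u 0 := hz₀.of_mem_orbit hu.1 (by
      rw [mem_orbit, zero_sub]; exact lattice.neg_mem hz₀l)
    -- A single simple zero makes every solution a multiple of `u`; a higher zero is triple by
    -- symmetry. The dimensions are at most `1` and at least `3`.
    by_cases hd : ∃ j, dz (u j) 0 ≠ 0
    · have := finrank_le_one_of_forall_smul (S := sol V α 0) (u := u) fun v hv =>
        exists_smul_of_simple_zeros hu hv (wronskian_eq_zero_of_magic hα hu hv)
          (isSingularSet_orbit 0) (fun z hz => h z (by rwa [mem_orbit, sub_zero] at hz))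
          (fun z hz => SimpleZeroAt.of_mem_orbit hu.1 ⟨h0, hd⟩ hz) (self_mem_orbit 0)
          fun z hz hz' => absurd hz hz'
      omega
    · push Not at hd
      have := three_le_finrank_of_triple_zero hu hu0 h0 hd (tendsto_div_sq_zero hu hr h0 hd)
      omega

/-- The second solution can be chosen to be an eigenvector of the rotation. -/
theorem exists_rot_eigenvector {V : Potential} {α : ℂ} (hα : α ∈ magic V) {u : Fin 2 → ℂ → ℂ}
    (hu : u ∈ sol V α 0) (hr : rot u = u) (h : ZerosExactlyStacking u) :
    ∃ (w : Fin 2 → ℂ → ℂ) (hw : w ∈ sol V α 0), (∀ j z, rot w j z = τ ^ 2 * w j z) ∧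
      LinearIndependent ℂ ![(⟨u, hu⟩ : sol V α 0), ⟨w, hw⟩] := by
  obtain ⟨w, hw, hw1, hw2⟩ := exists_second_sol hu h.1.1 h.2.1.1
  have ho : τ * zS ∈ orbit (-zS) := by
    rw [mem_orbit, sub_neg_eq_add]; exact tau_mul_zS_add
  have hd (j) (z : ℂ) := (hu.1 j).differentiable z
  -- Differentiating the rotation relations of `u` compares its derivatives at `z_S` and at `τ z_S`,
  -- which is `-z_S` modulo `Λ`.
  have e0 : τ * dz (u 0) (τ * zS) = τ * dz (u 0) zS := by
    rw [← dz_comp_const_mul (hd 0 _), ← dz_const_mul _ (hd 0 _)]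
    simp only [rot_apply_zero hr]
  have e1 : τ * dz (u 1) (τ * zS) = dz (u 1) zS := by
    rw [← dz_comp_const_mul (hd 1 _)]
    simp only [rot_apply_one hr]
  -- The values of `w` at `±z_S` are `±∂_z u`; the sign between them and `τ³ = -1` produce the
  -- eigenvalue `τ²`.
  have hv : VanishesAt (rot w - τ ^ 2 • w) zS := by
    have a (j) : w j (τ * zS) = -dz (u j) (τ * zS) := by
      rw [eq_of_mem_orbit (hw.1 j).periodic ho, hw2, dz_eq_of_mem_orbit (hu.1 j).periodic ho]
    rw [vanishesAt_iff]
    constructor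
    · show conj τ * w 0 (τ * zS) - τ ^ 2 * w 0 zS = 0
      rw [a, hw1, mul_left_cancel₀ tau_ne_zero e0, conj_tau]
      ring
    · show w 1 (τ * zS) - τ ^ 2 * w 1 zS = 0
      rw [a, hw1, ← e1]
      linear_combination (-dz (u 1) (τ * zS)) * tau_cubed
  obtain ⟨c, hc⟩ := h.exists_smul hα hu
    ((sol V α 0).sub_mem (rot_mem hw) ((sol V α 0).smul_mem (τ ^ 2) hw)) hv
  have hτ : τ ^ 2 - 1 ≠ 0 := sub_ne_zero.2 tau_sq_ne_one
  -- The defect `rot w - τ² w = c u` is absorbed by a multiple of `u`, which has the different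
  -- eigenvalue `1`.
  have hW := (sol V α 0).add_mem hw ((sol V α 0).smul_mem (c / (τ ^ 2 - 1)) hu)
  obtain ⟨i, hi⟩ := h.1.2
  refine ⟨_, hW, fun j z => ?_, linearIndependent_of_eval hu hW (i := i) (p := zS) (h.1.1 i) ?_ h.ne_zero⟩
  · have e : rot (w + (c / (τ ^ 2 - 1)) • u) j z = rot w j z + c / (τ ^ 2 - 1) * rot u j z := by
      fin_cases j
      · show conj τ * (w 0 (τ * z) + c / (τ ^ 2 - 1) * u 0 (τ * z)) = conj τ * w 0 (τ * z) +
          c / (τ ^ 2 - 1) * (conj τ * u 0 (τ * z))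
        ring
      · rfl
    have e2 : rot w j z - τ ^ 2 * w j z = c * u j z := congrFun (congrFun hc j) z
    rw [e, hr]
    show _ = τ ^ 2 * (w j z + c / (τ ^ 2 - 1) * u j z)
    field_simp
    linear_combination (τ ^ 2 - 1) * e2
  · show w i zS + c / (τ ^ 2 - 1) * u i zS ≠ 0
    rw [h.1.1 i, mul_zero, add_zero, hw1]
    exact hi

/-! ### Symmetry of the protected state and return to function classes -/

theorem IsProtectedState.rot_bold {V : Potential} {α : ℂ} {u : ℂ → ℂ} (hu : IsProtectedState V α u) :
    rot (bold α u) = bold α u := by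
  obtain ⟨h1, -, h2, -⟩ := hu.smooth
  ext j z
  fin_cases j
  · show conj τ * (α⁻¹ * twoDzbar u (τ * z)) = α⁻¹ * twoDzbar u z
    have h3 := twoDzbar_comp_const_mul (c := τ) (z := z) (h1.differentiable (τ * z))
    simp only [h2] at h3
    rw [h3]
    ring
  · show -u (τ * z) = -u z
    rw [h2]

theorem IsProtectedState.bold_ne_zero {V : Potential} {α : ℂ} {u : ℂ → ℂ}
    (hu : IsProtectedState V α u) : bold α u ≠ 0 := fun h => hu.2.1 (by
  ext z
  have h1 : -u z = 0 := congrFun (congrFun h 1) z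
  exact neg_eq_zero.1 h1)

theorem toClass_mem_L2sym2 {v : Fin 2 → ℂ → ℂ} (hv : ∀ j, IsTest (v j)) {l : ℤ}
    (h : ∀ j z, rot v j z = τ ^ l * v j z) : (fun j => (hv j).toClass) ∈ L2sym2 l := by
  refine ⟨fun j => (hv j).toClass_mem_L2, ?_⟩
  have h0 := (hv 0).coe_toClass
  have h1 := (hv 1).coe_toClass
  filter_upwards [h0, h1, quasiMeasurePreserving_mul_tau.ae h0,
    quasiMeasurePreserving_mul_tau.ae h1] with z a b c d
  rw [a, b, c, d]
  exact ⟨h 0 z, h 1 z⟩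

/-- A basis of smooth solutions gives a basis of the kernel of `D_S(α) + k`. -/
theorem kerDS_eq_span {V : Potential} {α k : ℂ} {u w : Fin 2 → ℂ → ℂ} (hu : u ∈ sol V α k)
    (hw : w ∈ sol V α k) (hf : Module.finrank ℂ (sol V α k) = 2)
    (hli : LinearIndependent ℂ ![(⟨u, hu⟩ : sol V α k), ⟨w, hw⟩]) :
    LinearIndependent ℂ ![fun j => (hu.1 j).toClass, fun j => (hw.1 j).toClass] ∧
      kerDS V α k = Submodule.span ℂ {fun j => (hu.1 j).toClass} ⊔
        Submodule.span ℂ {fun j => (hw.1 j).toClass} := by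
  let L : sol V α k →ₗ[ℂ] (Fin 2 → FunClass) :=
    (kerDS V α k).subtype ∘ₗ (solEquivKerDS V α k).toLinearMap
  have hLi : LinearMap.ker L = ⊥ := LinearMap.ker_eq_bot.2
    ((kerDS V α k).injective_subtype.comp (solEquivKerDS V α k).injective)
  have hLr : LinearMap.range L = kerDS V α k := by
    rw [LinearMap.range_comp, LinearEquiv.range, Submodule.map_top, Submodule.range_subtype]
  have e1 : L ⟨u, hu⟩ = fun j => (hu.1 j).toClass := rfl
  have e2 : L ⟨w, hw⟩ = fun j => (hw.1 j).toClass := rfl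
  have hspan := hli.span_eq_top_of_card_eq_finrank (by simp [hf])
  constructor
  · have h := hli.map' L hLi
    have e : (L ∘ ![(⟨u, hu⟩ : sol V α k), ⟨w, hw⟩]) =
        ![fun j => (hu.1 j).toClass, fun j => (hw.1 j).toClass] := by
      funext i
      fin_cases i
      · exact e1
      · exact e2
    rwa [e] at h
  · rw [← hLr, LinearMap.range_eq_map, ← hspan, Submodule.map_span, Matrix.range_cons_cons_empty,
      image_pair, e1, e2, Submodule.span_insert]

end ScalarModel

end

/-! ### The proposition -/

theorem mainTheorem7 (V : ScalarModel.Potential) (α : ℂ) (hα : α ∈ ScalarModel.magic V) :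
    (∃ u : ℂ → ℂ, ScalarModel.IsProtectedState V α u) ∧
    ∀ u : ℂ → ℂ, ScalarModel.IsProtectedState V α u →
      (ScalarModel.MultiplicityTwo V α ↔
        ScalarModel.ZerosExactlyStacking (ScalarModel.bold α u)) ∧
      (Module.finrank ℂ (ScalarModel.kerH V α 0) ≤ 4 →
        (ScalarModel.MultiplicityTwo V α ↔
          ScalarModel.VanishesAt (ScalarModel.bold α u) ScalarModel.zS ∧
          ScalarModel.VanishesAt (ScalarModel.bold α u) (-ScalarModel.zS))) ∧
      (ScalarModel.MultiplicityTwo V α →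
        ∃ U W : Fin 2 → ScalarModel.FunClass,
          (∀ j, ⇑(U j) =ᵐ[MeasureTheory.volume] ScalarModel.bold α u j) ∧
          U ∈ ScalarModel.L2sym2 0 ∧ W ∈ ScalarModel.L2sym2 2 ∧
          LinearIndependent ℂ ![U, W] ∧
          ScalarModel.kerDS V α 0 = Submodule.span ℂ {U} ⊔ Submodule.span ℂ {W}) := by
  refine ⟨ScalarModel.exists_isProtectedState V α, fun u hu => ?_⟩
  have hb := hu.bold_mem (ScalarModel.ne_zero_of_magic hα)
  have hr := hu.rot_bold
  have hb0 := hu.bold_ne_zero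
  have vanish (h : ScalarModel.MultiplicityTwo V α) :=
    ScalarModel.vanishesAt_zS hα hb hb0 hr ((ScalarModel.multiplicityTwo_iff V α).1 h 0)
  have stack (h : ScalarModel.MultiplicityTwo V α) :=
    ScalarModel.zerosExactlyStacking_of_finrank_le hb hb0
      ((ScalarModel.multiplicityTwo_iff V α).1 h 0).le (vanish h).1 (vanish h).2
  have mult (h : ScalarModel.ZerosExactlyStacking (ScalarModel.bold α u)) :=
    (ScalarModel.multiplicityTwo_iff V α).2 (ScalarModel.finrank_sol_of_zeros hα hb h)
  refine ⟨⟨stack, mult⟩, fun hk => ⟨vanish, fun h => mult ?_⟩, fun h => ?_⟩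
  -- The bound on `ker H(α,0)` gives `dim sol V α 0 ≤ 2`, which excludes further zeros and higher
  -- multiplicity.
  · rw [ScalarModel.finrank_kerH] at hk
    exact ScalarModel.zerosExactlyStacking_of_finrank_le hb hb0 (by omega) h.1 h.2
  · obtain ⟨w, hw, hrw, hli⟩ := ScalarModel.exists_rot_eigenvector hα hb hr (stack h)
    obtain ⟨h1, h2⟩ := ScalarModel.kerDS_eq_span hb hw
      ((ScalarModel.multiplicityTwo_iff V α).1 h 0) hli
    exact ⟨_, _, fun j => (hb.1 j).coe_toClass,
      ScalarModel.toClass_mem_L2sym2 hb.1 fun j z => by rw [hr, zpow_zero, one_mul],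
      ScalarModel.toClass_mem_L2sym2 hw.1 fun j z => hrw j z, h1, h2⟩
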